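/- **Theorem (Pieri growth).** For $n,k\ge 1$ let $A_1,\dots,A_n$ be i.i.d. random variables with the uniform distribution on $[0,1]$ and, independently of them, let $(B_1,\dots,B_k)$ be a vector of i.i.d. uniform random variables on $[0,1]$ conditioned to be in increasing order, i.e. chosen uniformly at random from $\{(b_1,\dots,b_k): 0\le b_1\le\dots\le b_k\le 1\}$. Let $\Lambda_n$ be the shape of the tableau obtained by Robinson–Schensted row insertion (RSK) of the sequence $(A_1,\dots,A_n)$ (so $\Lambda_n$ is a Plancherel-random Young diagram with $n$ boxes), and let $\Gamma_{n+k}\supset\Lambda_n$ be the RSK shape of the concatenated sequence $(A_1,\dots,A_n,B_1,\dots,B_k)$. Let $u_1,\dots,u_k$ be the $u$-coordinates of the $k$ boxes of $\Gamma_{n+k}\setminus\Lambda_n$, where the $u$-coordinate (content) of a box is its column index minus its row index, and let $$ m_{n,k}=\frac1k\sum_{\ell=1}^k \delta_{n^{-1/2}u_\ell}. $$ Let $\mathcal L_{SC}$ be the semicircle distribution, with density $\frac1{2\pi}\sqrt{4-w^2}$ on $[-2,2]$, and write $F_m(u)=m((-\infty,u])$ and $F_{SC}=F_{\mathcal L_{SC}}$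 for cumulative distribution functions. Let $k=k(n)\ge 1$ be a sequence of integers with $k=o(\sqrt n)$ as $n\to\infty$. Then: 1. if $k(n)\to\infty$ as $n\to\infty$, the random measures $m_{n,k}$ converge weakly in probability to $\mathcal L_{SC}$, i.e. for every bounded continuous $f:\mathbb R\to\mathbb R$, $\int f\,dm_{n,k}\to\int f\,d\mathcal L_{SC}$ in probability as $n\to\infty$; 2. for every $\epsilon>0$ and every $u\in\mathbb R$, $$ \operatorname{Prob}\left(\left|F_{m_{n,k}}(u)-F_{SC}(u)\right|>\epsilon\right)=O\left(\frac1k+\frac k{\sqrt n}\right)\quad\text{as } n\to\infty, $$ where the implied constant may depend on $\epsilon$, $u$ and the sequence $k(n)$. -/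

import Mathlib

namespace PieriGrowth

section RSK

variable {α : Type*} [LinearOrder α]

/-- Schensted row insertion of `x` into a row: `x` replaces the leftmost entry that is larger than
`x`, and that entry is bumped (returned as `some y`); if there is none, `x` is appended at the end
of the row and nothing is bumped. -/
def rowInsert (x : α) : List α → List α × Option α
  | [] => ([x], none)
  | y :: ys =>
      if x < y then (x :: ys, some y)
      else (y :: (rowInsert x ys).1, (rowInsert x ys).2)

/-- One insertion step into a tableau (the list of its rows, starting with the first row): the
entry bumped from a row is inserted into the next row, until nothing is bumped. -/
def tableauInsert (x : α) : List (List α) → List (List α)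
  | [] => [[x]]
  | r :: rs =>
      match (rowInsert x r).2 with
      | none => (rowInsert x r).1 :: rs
      | some y => (rowInsert x r).1 :: tableauInsert y rs

/-- The insertion tableau of a finite sequence, whose entries are inserted from left to right. -/
def insertionTableau (l : List α) : List (List α) :=
  l.foldl (fun P x => tableauInsert x P) []

/-- `Below r s`: the row `s` is not longer than `r` and each of its entries is larger than the
entry of `r` in the same column. -/
inductive Below : List α → List α → Prop
  | nil (r : List α) : Below r []
  | cons {a b : α} {r s : List α} : a < b → Below r s → Below (a :: r) (b :: s)

theorem Below.length_le {r s : List α} (h : Below r s) : s.length ≤ r.length := by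
  induction h with
  | nil r => simp
  | cons _ _ ih => simpa using ih

theorem lt_of_bump {x y : α} {r : List α} (h : (rowInsert x r).2 = some y) : x < y := by
  induction r with
  | nil => simp [rowInsert] at h
  | cons a r ih =>
    by_cases hx : x < a
    · simp only [rowInsert, hx, if_true, Option.some.injEq] at h
      exact h ▸ hx
    · simp only [rowInsert, hx, if_false] at h
      exact ih h

theorem Below.insert_left {r s : List α} (x : α) (h : Below r s) : Below (rowInsert x r).1 s := by
  induction h with
  | nil r => exact Below.nil _
  | @cons a b r s hab h ih =>
    by_cases hx : x < a
    · simpa [rowInsert, hx] using Below.cons (hx.trans hab) h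
    · simpa [rowInsert, hx] using Below.cons hab ih

theorem Below.insert_both {x y : α} {r s : List α} (h : Below r s)
    (hy : (rowInsert x r).2 = some y) : Below (rowInsert x r).1 (rowInsert y s).1 := by
  induction h with
  | nil r =>
    cases r with
    | nil => simp [rowInsert] at hy
    | cons a r =>
      have hxy := lt_of_bump hy
      by_cases hx : x < a
      · simpa [rowInsert, hx] using Below.cons hxy (Below.nil _)
      · simpa [rowInsert, hx] using Below.cons ((not_lt.1 hx).trans_lt hxy) (Below.nil _)
  | @cons a b r s hab h ih =>
    have hxy := lt_of_bump hy
    by_cases hx : x < a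
    · simp only [rowInsert, hx, if_true, Option.some.injEq] at hy
      subst hy
      simpa [rowInsert, hx, hab] using Below.cons hx h
    · have hay := (not_lt.1 hx).trans_lt hxy
      simp only [rowInsert, hx, if_false] at hy
      by_cases hyb : y < b
      · simpa [rowInsert, hx, hyb] using Below.cons hay (h.insert_left x)
      · simpa [rowInsert, hx, hyb] using Below.cons hab (ih hy)

theorem isChain_bump {P : List (List α)} : ∀ {x y : α} {r : List α},
    List.IsChain Below (r :: P) → (rowInsert x r).2 = some y →
      List.IsChain Below ((rowInsert x r).1 :: tableauInsert y P) := by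
  induction P with
  | nil =>
    intro x y r _ hy
    simpa [tableauInsert, rowInsert] using (Below.nil r).insert_both hy
  | cons s P ih =>
    intro x y r h hy
    rw [List.isChain_cons_cons] at h
    cases hz : (rowInsert y s).2 with
    | none =>
      simp only [tableauInsert, hz]
      refine List.isChain_cons_cons.2 ⟨h.1.insert_both hy, ?_⟩
      cases P with
      | nil => simp
      | cons t P =>
        rw [List.isChain_cons_cons] at h ⊢
        exact ⟨h.2.1.insert_left y, h.2.2⟩
    | some z =>
      simp only [tableauInsert, hz]
      exact List.isChain_cons_cons.2 ⟨h.1.insert_both hy, ih h.2 hz⟩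

theorem isChain_tableauInsert (x : α) {P : List (List α)} (h : List.IsChain Below P) :
    List.IsChain Below (tableauInsert x P) := by
  cases P with
  | nil => simp [tableauInsert]
  | cons r P =>
    cases hy : (rowInsert x r).2 with
    | none =>
      simp only [tableauInsert, hy]
      cases P with
      | nil => simp
      | cons t P =>
        rw [List.isChain_cons_cons] at h ⊢
        exact ⟨h.1.insert_left x, h.2⟩
    | some y =>
      simp only [tableauInsert, hy]
      exact isChain_bump h hy

theorem isChain_insertionTableau (l : List α) : List.IsChain Below (insertionTableau l) := by
  suffices H : ∀ (l : List α) (P : List (List α)), List.IsChain Below P →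
      List.IsChain Below (l.foldl (fun P x => tableauInsert x P) P) from H l [] (by simp)
  intro l
  induction l with
  | nil => exact fun P h => h
  | cons x l ih => exact fun P h => ih _ (isChain_tableauInsert x h)

theorem sortedGE_rowLengths (l : List α) :
    ((insertionTableau l).map List.length).SortedGE := by
  rw [List.sortedGE_iff_isChain, List.isChain_map]
  exact (isChain_insertionTableau l).imp fun _ _ h => h.length_le

/-- The RSK shape associated with a finite sequence: the Young diagram whose row lengths are those
of the insertion tableau. -/
def rskShape (l : List α) : YoungDiagram :=
  YoungDiagram.ofRowLens ((insertionTableau l).map List.length) (sortedGE_rowLengths l)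

end RSK

open MeasureTheory ProbabilityTheory

/-- The joint law of `(A₁, …, Aₙ)` and `(B₁, …, Bₖ)`: the `Aᵢ` are i.i.d. uniform on `[0, 1]`, and
independently of them the `Bᵢ` are i.i.d. uniform on `[0, 1]` conditioned to be in increasing
order. -/
noncomputable def inputLaw (n k : ℕ) : Measure ((Fin n → ℝ) × (Fin k → ℝ)) :=
  (Measure.pi fun _ : Fin n => (volume : Measure ℝ).restrict (Set.Icc 0 1)).prod
    (cond (Measure.pi fun _ : Fin k => (volume : Measure ℝ).restrict (Set.Icc 0 1))
      {b | Monotone b})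

/-- The smaller diagram `Λₙ` of the Pieri growth pair. -/
noncomputable def smallDiagram {n k : ℕ} (ω : (Fin n → ℝ) × (Fin k → ℝ)) : YoungDiagram :=
  rskShape (List.ofFn ω.1)

/-- The larger diagram `Γₙ₊ₖ` of the Pieri growth pair. -/
noncomputable def largeDiagram {n k : ℕ} (ω : (Fin n → ℝ) × (Fin k → ℝ)) : YoungDiagram :=
  rskShape (List.ofFn ω.1 ++ List.ofFn ω.2)

/-- The `u`-coordinate (content) of a box; a box of a Young diagram is a pair
`(row index, column index)`. -/
def uCoord (c : ℕ × ℕ) : ℤ := (c.2 : ℤ) - (c.1 : ℤ)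

/-- The random measure `m_{n,k}`: the empirical measure of the `u`-coordinates of the `k` boxes of
`Γₙ₊ₖ \ Λₙ`, scaled by `n ^ (-1/2)`. -/
noncomputable def empiricalMeasure {n k : ℕ} (ω : (Fin n → ℝ) × (Fin k → ℝ)) : Measure ℝ :=
  (k : ENNReal)⁻¹ • ∑ c ∈ (largeDiagram ω).cells \ (smallDiagram ω).cells,
    Measure.dirac ((uCoord c : ℝ) / √(n : ℝ))

/-- The semicircle distribution on `[-2, 2]`. -/
noncomputable def semicircle : Measure ℝ :=
  ((volume : Measure ℝ).restrict (Set.Icc (-2) 2)).withDensity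
    fun w => ENNReal.ofReal (1 / (2 * Real.pi) * √(4 - w ^ 2))

/-- Weak convergence in probability of a sequence of random measures `m n` (each on its own
probability space) to a deterministic measure `μ`: the integrals of every bounded continuous
function converge in probability. -/
def TendstoWeaklyInProbability {Ω : ℕ → Type*} [∀ n, MeasurableSpace (Ω n)]
    (P : ∀ n, Measure (Ω n)) (m : ∀ n, Ω n → Measure ℝ) (μ : Measure ℝ) : Prop :=
  ∀ f : BoundedContinuousFunction ℝ ℝ, ∀ ε : ℝ, 0 < ε →
    Filter.Tendsto (fun n => P n {ω | ε < |∫ x, f x ∂(m n ω) - ∫ x, f x ∂μ|})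
      Filter.atTop (nhds 0)

end PieriGrowth

open MeasureTheory ProbabilityTheory Filter Asymptotics PieriGrowth

namespace PieriGrowth

/-! ### Partitions, content sums and horizontal strips -/

section Young

open scoped Classical
open Finset

/-! The proof is by the method of moments. The `J`-th moment of the empirical measure is the sum of
`c ^ J` over the contents `c` of the new boxes, divided by `k * n ^ (J / 2)`. It suffices that this
sum is close to `k * momCenter J n` outside an event of probability `O(1 / k + k / √n)`: `momCenter
J n / n ^ (J / 2)` tends to the semicircle moment, and finitely many moments control the integral of
a given bounded continuous function, hence also the distribution function at a point, because the
semicircle density is bounded.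

The deviation is split in two (`exists_moment_deviation_le`). (a) Let each `B_i` be inserted
separately into the tableau of the `A`'s. By the row bumping lemma the box that `B_i` creates in the
true growth has at least the content of this separate box. An increment of `c ^ J` between ordered
contents is at most a constant times `n ^ (-(J + 1) / 2)` times the increment of the odd increasing
polynomial `c ^ (2 * J + 1) + n ^ J * c` (`domFun`), so the total discrepancy is bounded by an
expectation of `domFun` over the strip. Odd moments vanish for one insertion and are `O(k ^ 2 * n ^
J)` for `k` sorted insertions with `k ^ 2 ≤ n`; relative to `k * n ^ (J / 2)` this is `k / √n`. (b)
The separate contents are exchangeable, so the variance of their sum is at most `k` variances plus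
`k ^ 2` covariances. For two letters `x`, `z` the content of `z` inserted alone equals that of `x`,
or that of `z` inserted after `x`. Passing to the latter again costs an increment of `domFun`, and
its conditional mean is a moment of the transition measure of a Plancherel diagram, which is
concentrated (`exists_momVar_le`). Hence the covariance is `O(n ^ J / √n)`
(`exists_newContent_bounds`), and Chebyshev's inequality applies.

The moment estimates come from a commutation relation between adding a horizontal strip and removing
a box, weighted by contents (`sum_hor_add_box`). It yields the recursion `pieriE_succ`, from which
the bounds for even and odd degrees (`exists_bound_pieriE`) follow by induction; its one-box case
gives the concentration.

The link with insertion is the law of the pair of shapes: among the permutations with sorted tail,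
each horizontal strip `gam / lam` occurs `syt lam * syt gam` times (`card_pieri`). Only injectivity
of RSK is proved; equality follows by counting. Almost surely the uniform letters have no ties and
the shapes depend only on their order, which transfers the estimates from permutations to the input
law. -/

/-- The row lengths of a single box in row `i`. -/
noncomputable abbrev box (i : ℕ) : ℕ →₀ ℕ := Finsupp.single i 1

theorem add_box_self (p : ℕ →₀ ℕ) (i : ℕ) : (p + box i) i = p i + 1 := by simp [box]

theorem add_box_of_ne (p : ℕ →₀ ℕ) {i j : ℕ} (h : i ≠ j) : (p + box i) j = p j := by
  simp [box, h]

theorem sub_box_self (p : ℕ →₀ ℕ) (i : ℕ) : (p - box i) i = p i - 1 := by simp [box]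

theorem sub_box_of_ne (p : ℕ →₀ ℕ) {i j : ℕ} (h : i ≠ j) : (p - box i) j = p j := by
  simp [box, h]

theorem sub_box_add_box {p : ℕ →₀ ℕ} {i : ℕ} (h : 0 < p i) : p - box i + box i = p := by
  ext j
  by_cases hj : i = j
  · subst hj; rw [add_box_self, sub_box_self]; omega
  · rw [add_box_of_ne _ hj, sub_box_of_ne _ hj]

theorem add_box_sub_box (p : ℕ →₀ ℕ) (i : ℕ) : p + box i - box i = p :=
  add_tsub_cancel_right _ _

theorem degree_add_box (p : ℕ →₀ ℕ) (i : ℕ) : (p + box i).degree = p.degree + 1 := by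
  simp [box, Finsupp.degree_single]

theorem lt_degree_of_pos {p : ℕ →₀ ℕ} (hp : Antitone p) {i : ℕ} (hi : 0 < p i) :
    i < p.degree := by
  have hsub : range (i + 1) ⊆ p.support := by
    intro j hj
    have : p i ≤ p j := hp (by simpa [Nat.lt_succ_iff] using hj)
    simp; omega
  have h1 : (range (i + 1)).card ≤ ∑ j ∈ p.support, p j := by
    calc (range (i + 1)).card ≤ p.support.card := card_le_card hsub
      _ = ∑ j ∈ p.support, 1 := by simp
      _ ≤ _ := sum_le_sum fun j hj => Nat.one_le_iff_ne_zero.2 (by simpa using hj)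
  rw [card_range] at h1
  exact h1

theorem eq_zero_of_degree_le {p : ℕ →₀ ℕ} (hp : Antitone p) {i : ℕ} (hi : p.degree ≤ i) :
    p i = 0 := by
  by_contra h
  have := lt_degree_of_pos hp (Nat.pos_of_ne_zero h)
  omega

/-- The partitions of `n`, as finitely supported sequences of row lengths. -/
noncomputable def parts (n : ℕ) : Finset (ℕ →₀ ℕ) :=
  {p ∈ finsuppAntidiag (range n) n | Antitone p}

theorem mem_parts {n : ℕ} {p : ℕ →₀ ℕ} : p ∈ parts n ↔ Antitone p ∧ p.degree = n := by
  rw [parts, mem_filter, mem_finsuppAntidiag']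
  constructor
  · rintro ⟨⟨h, _⟩, hp⟩; exact ⟨hp, h⟩
  · rintro ⟨hp, h⟩
    refine ⟨⟨h, fun i hi => ?_⟩, hp⟩
    have := lt_degree_of_pos hp (Nat.pos_of_ne_zero (by simpa using hi))
    simp; omega

/-- Auxiliary recursion for the number of standard Young tableaux of shape `p` with `n` boxes. -/
noncomputable def sytAux : ℕ → (ℕ →₀ ℕ) → ℝ
  | 0, p => if p = 0 then 1 else 0
  | n + 1, p => if Antitone p then ∑ i ∈ p.support, sytAux n (p - box i) else 0

/-- The number of standard Young tableaux of shape `p`. -/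
noncomputable def syt (p : ℕ →₀ ℕ) : ℝ := sytAux p.degree p

theorem syt_zero : syt 0 = 1 := by simp [syt, sytAux]

theorem sytAux_nonneg (n : ℕ) (p : ℕ →₀ ℕ) : 0 ≤ sytAux n p := by
  induction n generalizing p with
  | zero => rw [sytAux]; split_ifs <;> norm_num
  | succ n ih => rw [sytAux]; split_ifs; exacts [sum_nonneg fun i _ => ih _, le_rfl]

theorem syt_nonneg (p : ℕ →₀ ℕ) : 0 ≤ syt p := sytAux_nonneg _ _

theorem syt_eq_zero {p : ℕ →₀ ℕ} (h : ¬ Antitone p) : syt p = 0 := by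
  have h0 : p ≠ 0 := by rintro rfl; exact h fun _ _ _ => le_rfl
  have : p.degree ≠ 0 := by simpa [Finsupp.degree_eq_zero_iff] using h0
  obtain ⟨n, hn⟩ := Nat.exists_eq_succ_of_ne_zero this
  rw [syt, hn, sytAux, if_neg h]

theorem degree_sub_box {p : ℕ →₀ ℕ} {i : ℕ} (h : 0 < p i) :
    (p - box i).degree + 1 = p.degree := by
  rw [← degree_add_box, sub_box_add_box h]

theorem syt_eq_sum {p : ℕ →₀ ℕ} (hp : Antitone p) (h0 : p ≠ 0) :
    syt p = ∑ i ∈ p.support, syt (p - box i) := by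
  have : p.degree ≠ 0 := by simpa [Finsupp.degree_eq_zero_iff] using h0
  obtain ⟨n, hn⟩ := Nat.exists_eq_succ_of_ne_zero this
  rw [syt, hn, sytAux, if_pos hp]
  refine sum_congr rfl fun i hi => ?_
  have := degree_sub_box (p := p) (i := i) (Nat.pos_of_ne_zero (by simpa using hi))
  rw [syt, show (p - box i).degree = n by omega]

/-- A summation range independent of `p` is what allows sums over shapes and over rows to be
exchanged; the added terms vanish. -/
theorem syt_eq_sum_range {p : ℕ →₀ ℕ} {m M : ℕ} (hp : p ∈ parts (m + 1)) (hM : m + 1 ≤ M) :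
    syt p = ∑ i ∈ range M, if 0 < p i ∧ Antitone (p - box i) then syt (p - box i) else 0 := by
  rw [mem_parts] at hp
  have h0 : p ≠ 0 := by rintro rfl; simp at hp
  rw [syt_eq_sum hp.1 h0]
  have hs : p.support ⊆ range M := fun i hi => by
    have := lt_degree_of_pos hp.1 (Nat.pos_of_ne_zero (by simpa using hi))
    simp; omega
  rw [← sum_subset hs (f := fun i => if 0 < p i ∧ Antitone (p - box i) then _ else _)]
  · refine sum_congr rfl fun i hi => ?_
    have hi' : 0 < p i := Nat.pos_of_ne_zero (by simpa using hi)
    by_cases h : Antitone (p - box i)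
    · rw [if_pos ⟨hi', h⟩]
    · rw [if_neg (fun H => h H.2), syt_eq_zero h]
  · intro i _ hi
    have : p i = 0 := by simpa using hi
    simp [this]

/-- Exchange between the removal and the addition of a box. -/
theorem sum_remove_eq_sum_add (m M : ℕ) (Ψ : (ℕ →₀ ℕ) → (ℕ →₀ ℕ) → ℝ) :
    (∑ p ∈ parts (m + 1), ∑ i ∈ range M,
        if 0 < p i ∧ Antitone (p - box i) then Ψ p (p - box i) else 0)
      = ∑ q ∈ parts m, ∑ i ∈ range M, if Antitone (q + box i) then Ψ (q + box i) q else 0 := by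
  rw [← sum_product', ← sum_product', ← sum_filter, ← sum_filter]
  refine sum_bij' (fun x _ => (x.1 - box x.2, x.2)) (fun x _ => (x.1 + box x.2, x.2)) ?_ ?_ ?_ ?_ ?_
  · rintro ⟨p, i⟩ h
    simp only [mem_filter, mem_product, mem_parts] at h ⊢
    obtain ⟨⟨⟨h1, h2⟩, h3⟩, h4, h5⟩ := h
    have := degree_sub_box h4
    exact ⟨⟨⟨h5, by omega⟩, h3⟩, by rwa [sub_box_add_box h4]⟩
  · rintro ⟨p, i⟩ h
    simp only [mem_filter, mem_product, mem_parts] at h ⊢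
    obtain ⟨⟨⟨h1, h2⟩, h3⟩, h5⟩ := h
    refine ⟨⟨⟨h5, by rw [degree_add_box, h2]⟩, h3⟩, by rw [add_box_self]; omega, ?_⟩
    rwa [add_box_sub_box]
  · rintro ⟨p, i⟩ h
    simp only [mem_filter, mem_product, mem_parts] at h
    simp only [sub_box_add_box h.2.1]
  · rintro ⟨p, i⟩ h
    simp only [add_box_sub_box]
  · rintro ⟨p, i⟩ h
    simp only [mem_filter, mem_product, mem_parts] at h
    simp only [sub_box_add_box h.2.1]

/-- Summation by parts on Young's lattice: `syt p` is expanded over removable boxes and the edges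
are re-indexed by their lower end. -/
theorem sum_syt_mul (m M : ℕ) (hM : m + 1 ≤ M) (Φ : (ℕ →₀ ℕ) → ℝ) :
    ∑ p ∈ parts (m + 1), syt p * Φ p
      = ∑ q ∈ parts m, syt q * ∑ i ∈ range M,
          if Antitone (q + box i) then Φ (q + box i) else 0 := by
  have h1 := sum_remove_eq_sum_add m M fun p q => syt q * Φ p
  rw [sum_congr rfl fun p hp => by rw [syt_eq_sum_range hp hM, sum_mul]]
  simp only [ite_mul, zero_mul, mul_sum, mul_ite, mul_zero]
  exact h1

/-- `Hor p q`: the skew shape `q / p` is a horizontal strip. -/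
def Hor (p q : ℕ →₀ ℕ) : Prop := ∀ j, p j ≤ q j ∧ q (j + 1) ≤ p j

theorem Hor.antitone_left {p q : ℕ →₀ ℕ} (h : Hor p q) : Antitone p :=
  antitone_nat_of_succ_le fun j => (h (j + 1)).1.trans (h j).2

theorem Hor.antitone_right {p q : ℕ →₀ ℕ} (h : Hor p q) : Antitone q :=
  antitone_nat_of_succ_le fun j => (h j).2.trans (h j).1

/-- The sum of `g` over the contents of the boxes of the diagram `p`. -/
noncomputable def contentSum (g : ℤ → ℝ) (p : ℕ →₀ ℕ) : ℝ :=
  p.sum fun i m => ∑ x ∈ range m, g ((x : ℤ) - i)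

theorem contentSum_zero (g : ℤ → ℝ) : contentSum g 0 = 0 := by simp [contentSum]

theorem contentSum_eq_sum_range (g : ℤ → ℝ) {p : ℕ →₀ ℕ} {M : ℕ} (h : ∀ i, M ≤ i → p i = 0) :
    contentSum g p = ∑ i ∈ range M, ∑ x ∈ range (p i), g ((x : ℤ) - i) := by
  rw [contentSum, Finsupp.sum_of_support_subset (s := range M)]
  · intro i hi
    by_contra hc
    exact (by simpa using hi : p i ≠ 0) (h i (by simpa using hc))
  · intro i _; simp

theorem contentSum_add_box (g : ℤ → ℝ) (p : ℕ →₀ ℕ) (i : ℕ) :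
    contentSum g (p + box i) = contentSum g p + g ((p i : ℤ) - i) := by
  obtain ⟨M, hM⟩ : ∃ M, ∀ j, M ≤ j → p j = 0 := by
    refine ⟨p.support.sup id + 1, fun j hj => ?_⟩
    by_contra hc
    have : j ≤ p.support.sup id := le_sup (f := id) (by simpa using hc)
    omega
  have h1 : ∀ j, max M (i + 1) ≤ j → p j = 0 := fun j hj => hM j (by omega)
  have h2 : ∀ j, max M (i + 1) ≤ j → (p + box i) j = 0 := fun j hj => by
    rw [add_box_of_ne _ (by omega)]; exact h1 j hj
  rw [contentSum_eq_sum_range g h1, contentSum_eq_sum_range g h2]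
  have hi : i ∈ range (max M (i + 1)) := by simp
  rw [← add_sum_erase _ _ hi, ← add_sum_erase _ (fun j => ∑ x ∈ range (p j), g ((x : ℤ) - j)) hi,
    add_box_self, sum_range_succ]
  have h3 : ∀ j ∈ (range (max M (i + 1))).erase i,
      ∑ x ∈ range ((p + box i) j), g ((x : ℤ) - j) = ∑ x ∈ range (p j), g ((x : ℤ) - j) :=
    fun j hj => by rw [add_box_of_ne p (ne_of_mem_erase hj).symm]
  rw [sum_congr rfl h3]
  ring

theorem contentSum_add_fun (g h : ℤ → ℝ) (p : ℕ →₀ ℕ) :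
    contentSum (fun c => g c + h c) p = contentSum g p + contentSum h p := by
  simp [contentSum, Finsupp.sum, sum_add_distrib]

theorem contentSum_mul_fun (a : ℝ) (g : ℤ → ℝ) (p : ℕ →₀ ℕ) :
    contentSum (fun c => a * g c) p = a * contentSum g p := by
  simp [contentSum, Finsupp.sum, mul_sum]

/-- The forward difference. -/
def fwd (g : ℤ → ℝ) (c : ℤ) : ℝ := g (c + 1) - g c

/-- The symmetric second difference. -/
def sndDiff (g : ℤ → ℝ) (c : ℤ) : ℝ := g (c + 1) + g (c - 1) - 2 * g c

/-- The sum of `g` over the contents of the addable boxes minus the sum over the contents of the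
removable boxes. -/
noncomputable def cornerSum (g : ℤ → ℝ) (p : ℕ →₀ ℕ) : ℝ := g 0 + contentSum (sndDiff g) p

theorem contentSum_fwd (g : ℤ → ℝ) {p : ℕ →₀ ℕ} {M : ℕ} (h : ∀ i, M ≤ i → p i = 0) :
    contentSum (fwd g) p = ∑ i ∈ range M, (g ((p i : ℤ) - i) - g (-(i : ℤ))) := by
  rw [contentSum_eq_sum_range _ h]
  refine sum_congr rfl fun i _ => ?_
  have := sum_range_sub (fun x : ℕ => g ((x : ℤ) - i)) (p i)
  simp only [Nat.cast_zero, zero_sub] at this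
  rw [← this]
  refine sum_congr rfl fun x _ => ?_
  rw [fwd]; push_cast; congr 2; ring

/-- Second differences telescope along each row. When two consecutive rows are equal, the term of
the lower row in the first sum cancels that of the upper row in the second, so only genuine corners
survive. -/
theorem cornerSum_eq (g : ℤ → ℝ) {p : ℕ →₀ ℕ} {K : ℕ} (h : ∀ i, K ≤ i → p i = 0) :
    cornerSum g p = ∑ i ∈ range (K + 1), g ((p i : ℤ) - i)
      - ∑ i ∈ range K, g ((p i : ℤ) - 1 - i) := by
  have h1 : contentSum (sndDiff g) p
      = contentSum (fwd g) p - contentSum (fwd fun c => g (c - 1)) p := by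
    rw [contentSum, contentSum, contentSum, Finsupp.sum, Finsupp.sum, Finsupp.sum,
      ← sum_sub_distrib]
    refine sum_congr rfl fun i _ => ?_
    rw [← sum_sub_distrib]
    refine sum_congr rfl fun x _ => ?_
    simp only [sndDiff, fwd, add_sub_cancel_right]; ring
  rw [cornerSum, h1, contentSum_fwd _ h, contentSum_fwd _ h, sum_sub_distrib, sum_sub_distrib,
    sum_range_succ, h K le_rfl]
  have h2 : ∑ i ∈ range K, g ((p i : ℤ) - i - 1) = ∑ i ∈ range K, g ((p i : ℤ) - 1 - i) :=
    sum_congr rfl fun i _ => by congr 1; ring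
  have h3 := sum_range_sub (fun i : ℕ => g (-(i : ℤ))) K
  rw [sum_sub_distrib] at h3
  have h4 : ∑ i ∈ range K, g (-(i : ℤ) - 1) = ∑ i ∈ range K, g (-((i + 1 : ℕ) : ℤ)) :=
    sum_congr rfl fun i _ => by congr 1; push_cast; ring
  rw [h2, h4]
  simp only [Nat.cast_zero, neg_zero, zero_sub] at h3 ⊢
  linarith

/-- The same inequality governs addition in row `i + 1` and removal in row `i` (`hor_sub_box_iff`).
This shift pairs the two kinds of moves and leaves addition in row 0 unpaired. -/
theorem hor_add_box_iff {p q : ℕ →₀ ℕ} (h : Hor p q) (i : ℕ) :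
    Hor p (q + box (i + 1)) ↔ q (i + 1) < p i := by
  constructor
  · intro H
    have := (H i).2
    rw [add_box_self] at this; omega
  · intro H j
    constructor
    · exact (h j).1.trans (by simp)
    · by_cases hj : i + 1 = j + 1
      · have : i = j := by omega
        subst this
        rw [add_box_self]; omega
      · rw [add_box_of_ne _ hj]; exact (h j).2

theorem hor_add_box_zero {p q : ℕ →₀ ℕ} (h : Hor p q) : Hor p (q + box 0) := fun j =>
  ⟨(h j).1.trans (by simp), by rw [add_box_of_ne _ (by omega)]; exact (h j).2⟩

theorem hor_sub_box_iff {p q : ℕ →₀ ℕ} (h : Hor p q) (i : ℕ) :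
    (0 < p i ∧ Hor (p - box i) q) ↔ q (i + 1) < p i := by
  constructor
  · rintro ⟨h0, H⟩
    have := (H i).2
    rw [sub_box_self] at this; omega
  · intro H
    refine ⟨by omega, fun j => ?_⟩
    by_cases hj : i = j
    · subst hj
      rw [sub_box_self]
      have := h i; omega
    · rw [sub_box_of_ne _ hj]; exact h j

/-- A failure of the strip condition that one box can repair must be `q i < p i` in that very row,
and then either move repairs it. -/
theorem hor_add_iff_hor_sub {p q : ℕ →₀ ℕ} (hp : Antitone p) (hq : Antitone q) (h : ¬ Hor p q)
    (i : ℕ) : Hor p (q + box i) ↔ 0 < p i ∧ Hor (p - box i) q := by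
  constructor
  · intro H
    have hlt : q i < p i := by
      by_contra hc
      refine h fun j => ?_
      have h1 := H j
      have h2 : q (j + 1) ≤ (q + box i) (j + 1) := by simp
      refine ⟨?_, h2.trans h1.2⟩
      by_cases hj : i = j
      · subst hj; omega
      · rw [add_box_of_ne _ hj] at h1; exact h1.1
    refine ⟨by omega, fun j => ?_⟩
    have h1 := H j
    have h2 : q (j + 1) ≤ (q + box i) (j + 1) := by simp
    by_cases hj : i = j
    · subst hj
      have h3 := hq (Nat.le_succ i)
      rw [add_box_self] at h1
      rw [sub_box_self]; simp only [Nat.succ_eq_add_one] at h3; omega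
    · rw [add_box_of_ne _ hj] at h1; rw [sub_box_of_ne _ hj]
      exact ⟨h1.1, h2.trans h1.2⟩
  · rintro ⟨h0, H⟩
    have hlt : q i < p i := by
      by_contra hc
      refine h fun j => ?_
      have h1 := H j
      by_cases hj : i = j
      · subst hj; rw [sub_box_self] at h1; omega
      · rwa [sub_box_of_ne _ hj] at h1
    intro j
    have h1 := H j
    constructor
    · by_cases hj : i = j
      · subst hj; rw [sub_box_self] at h1; rw [add_box_self]; omega
      · rw [sub_box_of_ne _ hj] at h1; rw [add_box_of_ne _ hj]; exact h1.1
    · by_cases hj : i = j + 1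
      · subst hj
        have h2 := hp (Nat.le_succ j)
        rw [add_box_self]; simp only [Nat.succ_eq_add_one] at h2; omega
      · rw [add_box_of_ne _ hj]
        refine h1.2.trans ?_
        by_cases hj' : i = j
        · subst hj'; rw [sub_box_self]; omega
        · rw [sub_box_of_ne _ hj']

theorem eq_of_hor_add_of_not {p q : ℕ →₀ ℕ} (h : ¬ Hor p q) {i : ℕ}
    (H : Hor p (q + box i)) : p i = q i + 1 := by
  have hlt : q i < p i := by
    by_contra hc
    refine h fun j => ?_
    have h1 := H j
    have h2 : q (j + 1) ≤ (q + box i) (j + 1) := by simp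
    refine ⟨?_, h2.trans h1.2⟩
    by_cases hj : i = j
    · subst hj; omega
    · rw [add_box_of_ne _ hj] at h1; exact h1.1
  have := (H i).1
  rw [add_box_self] at this; omega

theorem contentSum_sub_box (g : ℤ → ℝ) {p : ℕ →₀ ℕ} {i : ℕ} (h : 0 < p i) :
    contentSum g (p - box i) = contentSum g p - g ((p i : ℤ) - 1 - i) := by
  have := contentSum_add_box g (p - box i) i
  rw [sub_box_add_box h, sub_box_self, Nat.cast_sub (by omega)] at this
  rw [this]; push_cast; ring

/-- The commutation relation between adding a horizontal strip and removing a box, with weights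
that depend on the contents of the boxes of the strip. -/
theorem sum_hor_add_box (c₀ : ℝ) (g : ℤ → ℝ) {p q : ℕ →₀ ℕ} (hp : Antitone p) (hq : Antitone q)
    {K : ℕ} (hK : p K = 0) :
    (∑ i ∈ range (K + 1), if Hor p (q + box i) then
        c₀ + contentSum g (q + box i) - contentSum g p else 0)
      = (∑ i ∈ range (K + 1), if 0 < p i ∧ Hor (p - box i) q then
          c₀ + contentSum g q - contentSum g (p - box i) else 0)
        + if Hor p q then c₀ + contentSum g q - contentSum g p + cornerSum g p
          + (contentSum (fwd g) q - contentSum (fwd g) p) else 0 := by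
  have hK' : ∀ i, K ≤ i → p i = 0 := fun i hi => by
    have := hp hi; omega
  by_cases h : Hor p q
  · have hq' : ∀ i, K + 1 ≤ i → q i = 0 := fun i hi => by
      have := (h (i - 1)).2
      rw [hK' (i - 1) (by omega), show i - 1 + 1 = i by omega] at this; omega
    -- Row `i + 1` of the additions is matched with row `i` of the removals. Row 0, where addition
    -- is always allowed, produces the extra term; row `K` is empty in `p` and allows no removal.
    rw [if_pos h, sum_range_succ', if_pos (hor_add_box_zero h)]
    simp only [hor_add_box_iff h, hor_sub_box_iff h]
    rw [sum_range_succ (fun i => if q (i + 1) < p i then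
      c₀ + contentSum g q - contentSum g (p - box i) else 0), hK, if_neg (by omega), add_zero]
    set W := c₀ + contentSum g q - contentSum g p with hW
    have e1 : (∑ i ∈ range K, if q (i + 1) < p i then
          c₀ + contentSum g (q + box (i + 1)) - contentSum g p else 0)
        - (∑ i ∈ range K, if q (i + 1) < p i then
          c₀ + contentSum g q - contentSum g (p - box i) else 0)
        = ∑ i ∈ range K, (g ((q (i + 1) : ℤ) - (i + 1 : ℕ)) - g ((p i : ℤ) - 1 - i)) := by
      rw [← sum_sub_distrib]
      refine sum_congr rfl fun i _ => ?_
      split_ifs with hlt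
      · rw [contentSum_add_box, contentSum_sub_box g (by omega)]; ring
      -- Where neither move is allowed, the two would-be boxes have the same content, so the
      -- difference may be summed over all rows.
      · have : q (i + 1) = p i := le_antisymm (h i).2 (by omega)
        rw [this]; push_cast; rw [show (p i : ℤ) - (i + 1) = p i - 1 - i by ring]; ring
    have e2 : contentSum (fwd g) q - contentSum (fwd g) p
        = ∑ i ∈ range (K + 1), g ((q i : ℤ) - i) - ∑ i ∈ range (K + 1), g ((p i : ℤ) - i) := by
      rw [contentSum_fwd g hq', contentSum_fwd g (M := K + 1) (fun i hi => hK' i (by omega)),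
        sum_sub_distrib, sum_sub_distrib]
      ring
    rw [e2, cornerSum_eq g hK', contentSum_add_box, sum_range_succ' (fun i => g ((q i : ℤ) - i))]
    rw [sum_sub_distrib] at e1
    linarith
  · rw [if_neg h, add_zero]
    refine sum_congr rfl fun i _ => ?_
    by_cases H : Hor p (q + box i)
    · have hHor := (hor_add_iff_hor_sub hp hq h i).1 H
      rw [if_pos H, if_pos hHor, contentSum_add_box, contentSum_sub_box g hHor.1,
        eq_of_hor_add_of_not h H]
      push_cast
      rw [show (q i : ℤ) + 1 - 1 - i = q i - i by ring]; ring
    · rw [if_neg H, if_neg fun hHor => H ((hor_add_iff_hor_sub hp hq h i).2 hHor)]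

/-- The sum, over the horizontal strips `q / p` with `q` of size `N`, of the number of standard
tableaux of shape `q` weighted by an affine function of the strip. -/
noncomputable def stripSum (c₀ : ℝ) (g : ℤ → ℝ) (p : ℕ →₀ ℕ) (N : ℕ) : ℝ :=
  ∑ q ∈ parts N, syt q * if Hor p q then c₀ + contentSum g q - contentSum g p else 0

/-- Expand `syt` of the outer shape over its removable boxes and commute the removal past the strip.
The class of affine weights is closed under this: in the extra term the constant gains a corner sum
and `g` becomes `g + fwd g`. -/
theorem stripSum_succ (c₀ : ℝ) (g : ℤ → ℝ) {p : ℕ →₀ ℕ} {n k : ℕ} (hp : p ∈ parts n) :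
    stripSum c₀ g p (n + k + 1)
      = (∑ i ∈ range (n + k + 1), if 0 < p i then stripSum c₀ g (p - box i) (n + k) else 0)
        + stripSum (c₀ + cornerSum g p) (fun c => g c + fwd g c) p (n + k) := by
  rw [mem_parts] at hp
  rw [stripSum, sum_syt_mul (n + k) (n + k + 1) le_rfl]
  have h1 : ∀ q ∈ parts (n + k), (∑ i ∈ range (n + k + 1), if Antitone (q + box i) then
      (if Hor p (q + box i) then c₀ + contentSum g (q + box i) - contentSum g p else 0) else 0)
      = (∑ i ∈ range (n + k + 1), if 0 < p i ∧ Hor (p - box i) q then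
          c₀ + contentSum g q - contentSum g (p - box i) else 0)
        + if Hor p q then c₀ + contentSum g q - contentSum g p + cornerSum g p
          + (contentSum (fwd g) q - contentSum (fwd g) p) else 0 := by
    intro q hq
    rw [mem_parts] at hq
    rw [← sum_hor_add_box c₀ g hp.1 hq.1 (eq_zero_of_degree_le hp.1 (by omega))]
    refine sum_congr rfl fun i _ => ?_
    by_cases H : Hor p (q + box i)
    · rw [if_pos H.antitone_right]
    · simp [H]
  rw [sum_congr rfl fun q hq => by rw [h1 q hq, mul_add], sum_add_distrib]
  congr 1
  · simp only [mul_sum, stripSum]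
    rw [sum_comm]
    refine sum_congr rfl fun i _ => ?_
    split_ifs with h0
    · simp [h0]
    · simp [h0]
  · rw [stripSum]
    refine sum_congr rfl fun q _ => ?_
    split_ifs
    · rw [contentSum_add_fun, contentSum_add_fun]; ring
    · rfl

theorem stripSum_add (c c' : ℝ) (g g' : ℤ → ℝ) (p : ℕ →₀ ℕ) (N : ℕ) :
    stripSum (c + c') (fun x => g x + g' x) p N = stripSum c g p N + stripSum c' g' p N := by
  rw [stripSum, stripSum, stripSum, ← sum_add_distrib]
  refine sum_congr rfl fun q _ => ?_
  split_ifs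
  · rw [contentSum_add_fun, contentSum_add_fun]; ring
  · ring

theorem stripSum_mul (a c : ℝ) (g : ℤ → ℝ) (p : ℕ →₀ ℕ) (N : ℕ) :
    stripSum (a * c) (fun x => a * g x) p N = a * stripSum c g p N := by
  rw [stripSum, stripSum, mul_sum]
  refine sum_congr rfl fun q _ => ?_
  split_ifs
  · rw [contentSum_mul_fun, contentSum_mul_fun]; ring
  · ring

theorem stripSum_eq_zero (c : ℝ) (g : ℤ → ℝ) {p : ℕ →₀ ℕ} (hp : ¬ Antitone p) (N : ℕ) :
    stripSum c g p N = 0 :=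
  sum_eq_zero fun q _ => by rw [if_neg fun h => hp h.antitone_left, mul_zero]

theorem hor_self {p : ℕ →₀ ℕ} (hp : Antitone p) : Hor p p := fun j =>
  ⟨le_rfl, hp (Nat.le_succ j)⟩

theorem eq_of_hor_of_degree_eq {p q : ℕ →₀ ℕ} (h : Hor p q) (hd : p.degree = q.degree) :
    p = q := by
  have hle : p ≤ q := fun j => (h j).1
  have h1 : q = p + (q - p) := (add_tsub_cancel_of_le hle).symm
  have h2 : (q - p).degree = 0 := by
    have := congrArg Finsupp.degree h1
    rw [map_add] at this; omega
  rw [Finsupp.degree_eq_zero_iff] at h2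
  rw [h1, h2, add_zero]

theorem stripSum_same (c : ℝ) (g : ℤ → ℝ) {p : ℕ →₀ ℕ} {n : ℕ} (hp : p ∈ parts n) :
    stripSum c g p n = c * syt p := by
  rw [stripSum, sum_eq_single_of_mem p hp]
  · rw [if_pos (hor_self (mem_parts.1 hp).1)]; ring
  · intro q hq hne
    rw [if_neg fun h => hne (eq_of_hor_of_degree_eq h ?_).symm, mul_zero]
    rw [(mem_parts.1 hp).2, (mem_parts.1 hq).2]

end Young

end PieriGrowth

namespace PieriGrowth

/-! ### Expectations under the Plancherel measure and the Pieri growth, and their recursions -/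

section Pieri

open scoped Classical
open Finset

theorem stripSum_eq_add (c : ℝ) (g : ℤ → ℝ) (p : ℕ →₀ ℕ) (N : ℕ) :
    stripSum c g p N = c * stripSum 1 (fun _ => 0) p N + stripSum 0 g p N := by
  rw [← stripSum_mul, ← stripSum_add]; simp

theorem cornerSum_zero_fun (p : ℕ →₀ ℕ) : cornerSum (fun _ => 0) p = 0 := by
  simp [cornerSum, contentSum, sndDiff, Finsupp.sum]

theorem sum_syt_sub_box {p : ℕ →₀ ℕ} {m M : ℕ} (hp : p ∈ parts (m + 1)) (hM : m + 1 ≤ M) :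
    ∑ i ∈ range M, (if 0 < p i then syt (p - box i) else 0) = syt p := by
  rw [syt_eq_sum_range hp hM]
  refine sum_congr rfl fun i _ => ?_
  by_cases h : Antitone (p - box i)
  · simp only [h, and_true]
  · simp only [h, and_false, syt_eq_zero h, ite_self]

theorem sub_box_mem_parts {p : ℕ →₀ ℕ} {m i : ℕ} (hp : p ∈ parts (m + 1)) (hi : 0 < p i)
    (h : Antitone (p - box i)) : p - box i ∈ parts m := by
  rw [mem_parts] at hp ⊢
  have := degree_sub_box hi
  exact ⟨h, by omega⟩

theorem eq_zero_of_mem_parts_zero {p : ℕ →₀ ℕ} (hp : p ∈ parts 0) : p = 0 := by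
  rw [mem_parts] at hp
  simpa [Finsupp.degree_eq_zero_iff] using hp.2

/-- The number of pairs of a horizontal strip of size `k` over `p` and a standard tableau of the
resulting shape. -/
theorem stripSum_one (n k : ℕ) {p : ℕ →₀ ℕ} (hp : p ∈ parts n) :
    stripSum 1 (fun _ => 0) p (n + k) = (n + k).choose k * syt p := by
  induction k generalizing n p with
  | zero => rw [add_zero, stripSum_same _ _ hp]; simp
  | succ k ihk =>
    have hz : (fun c => (0 : ℝ) + fwd (fun _ => 0) c) = fun _ => 0 := by
      funext c; simp [fwd]
    induction n generalizing p with
    | zero =>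
      rw [← add_assoc, stripSum_succ _ _ hp, cornerSum_zero_fun, hz, add_zero, ihk 0 hp]
      rw [eq_zero_of_mem_parts_zero hp]
      simp
    | succ n ihn =>
      rw [← add_assoc, stripSum_succ _ _ hp, cornerSum_zero_fun, hz, add_zero, ihk (n + 1) hp]
      have h1 : ∀ i ∈ range (n + 1 + k + 1),
          (if 0 < p i then stripSum 1 (fun _ => 0) (p - box i) (n + 1 + k) else 0)
          = ((n + 1 + k).choose (k + 1) : ℝ) * if 0 < p i then syt (p - box i) else 0 := by
        intro i _
        split_ifs with hi
        · by_cases h : Antitone (p - box i)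
          · have := ihn (sub_box_mem_parts hp hi h)
            rw [show n + 1 + k = n + (k + 1) by ring, this]
          · rw [stripSum_eq_zero _ _ h, syt_eq_zero h, mul_zero]
        · simp
      -- Pascal's rule joins the shorter strips over `p` to the strips of full length over the
      -- shapes `p - box i`.
      rw [sum_congr rfl h1, ← mul_sum, sum_syt_sub_box hp (by omega),
        Nat.choose_succ_succ (n + 1 + k) k]
      push_cast; ring

theorem stripSum_succ' (g : ℤ → ℝ) {p : ℕ →₀ ℕ} {n k : ℕ} (hp : p ∈ parts n) :
    stripSum 0 g p (n + k + 1)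
      = (∑ i ∈ range (n + k + 1), if 0 < p i then stripSum 0 g (p - box i) (n + k) else 0)
        + stripSum 0 g p (n + k) + cornerSum g p * ((n + k).choose k * syt p)
        + stripSum 0 (fwd g) p (n + k) := by
  rw [stripSum_succ 0 g hp, stripSum_add, stripSum_eq_add (cornerSum g p), stripSum_one n k hp]
  ring

/-- Growth by one box, as a sum over rows. -/
theorem sum_hor_one {n : ℕ} {p : ℕ →₀ ℕ} (hp : p ∈ parts n) {M : ℕ} (hM : n + 1 ≤ M)
    (Φ : (ℕ →₀ ℕ) → ℝ) :
    (∑ q ∈ parts (n + 1), if Hor p q then Φ q else 0)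
      = ∑ i ∈ range M, if Antitone (p + box i) then Φ (p + box i) else 0 := by
  rw [← sum_filter, ← sum_filter]
  symm
  rw [mem_parts] at hp
  refine sum_bij (fun i _ => p + box i) ?_ ?_ ?_ ?_
  · intro i hi
    rw [mem_filter] at hi ⊢
    refine ⟨mem_parts.2 ⟨hi.2, by rw [degree_add_box, hp.2]⟩, fun j => ⟨by simp, ?_⟩⟩
    by_cases hj : i = j + 1
    · subst hj
      have := hi.2 (Nat.le_succ j)
      rw [add_box_of_ne p (show j + 1 ≠ j by omega)] at this
      exact this
    · rw [add_box_of_ne _ hj]; exact hp.1 (Nat.le_succ j)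
  · intro i _ j _ h
    have h' : box i = box j := add_left_cancel h
    exact Finsupp.single_left_injective one_ne_zero h'
  · intro q hq
    rw [mem_filter, mem_parts] at hq
    obtain ⟨⟨hq1, hq2⟩, hq3⟩ := hq
    have hle : p ≤ q := fun j => (hq3 j).1
    have h1 : q = p + (q - p) := (add_tsub_cancel_of_le hle).symm
    have h2 : (q - p).degree = 1 := by
      have := congrArg Finsupp.degree h1
      rw [map_add] at this; omega
    obtain ⟨i, hi⟩ : ∃ i, 0 < (q - p) i := by
      by_contra hc
      push Not at hc
      have : q - p = 0 := by ext i; have := hc i; simp only [Finsupp.coe_zero, Pi.zero_apply]; omega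
      rw [this] at h2; simp at h2
    have h3 := degree_sub_box hi
    have h4 : (q - p) - box i = 0 := by
      rw [← Finsupp.degree_eq_zero_iff]; omega
    have h5 : q - p = box i := by
      rw [← sub_box_add_box hi, h4, zero_add]
    have h6 : q = p + box i := by rw [h1, h5]
    refine ⟨i, ?_, h6.symm⟩
    have : i < q.degree := lt_degree_of_pos hq1 (by rw [h6, add_box_self]; omega)
    rw [mem_filter, mem_range]
    exact ⟨by omega, h6 ▸ hq1⟩
  · intro i _; rfl

/-- The strip count for a single box. It makes `syt (p + box i) / ((n + 1) * syt p)` the transition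
probabilities of the Plancherel growth. -/
theorem sum_syt_add_box {n : ℕ} {p : ℕ →₀ ℕ} (hp : p ∈ parts n) {M : ℕ} (hM : n + 1 ≤ M) :
    (∑ i ∈ range M, if Antitone (p + box i) then syt (p + box i) else 0) = (n + 1) * syt p := by
  have h := stripSum_one n 1 hp
  rw [stripSum] at h
  rw [← sum_hor_one hp hM]
  rw [Nat.choose_one_right] at h
  push_cast at h
  rw [← h]
  refine sum_congr rfl fun q _ => ?_
  simp [contentSum, Finsupp.sum]

theorem stripSum_one_step (g : ℤ → ℝ) {n : ℕ} {p : ℕ →₀ ℕ} (hp : p ∈ parts n) {M : ℕ}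
    (hM : n + 1 ≤ M) :
    stripSum 0 g p (n + 1)
      = ∑ i ∈ range M, if Antitone (p + box i) then syt (p + box i) * g ((p i : ℤ) - i)
        else 0 := by
  have h := sum_hor_one hp hM fun q => syt q * (contentSum g q - contentSum g p)
  rw [stripSum]
  simp only [mul_ite, mul_zero, zero_add]
  rw [h]
  refine sum_congr rfl fun i _ => ?_
  rw [contentSum_add_box, add_sub_cancel_left]

/-- Expectation with respect to the Plancherel measure on partitions of `n`. -/
noncomputable def planch (n : ℕ) (φ : (ℕ →₀ ℕ) → ℝ) : ℝ :=
  (∑ p ∈ parts n, syt p ^ 2 * φ p) / n.factorial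

theorem sum_syt_sq_succ (n : ℕ) (φ : (ℕ →₀ ℕ) → ℝ) :
    ∑ p ∈ parts (n + 1), syt p ^ 2 * φ p
      = ∑ p ∈ parts n, syt p * ∑ i ∈ range (n + 1),
          if Antitone (p + box i) then syt (p + box i) * φ (p + box i) else 0 := by
  rw [← sum_syt_mul n (n + 1) le_rfl fun p => syt p * φ p]
  exact sum_congr rfl fun p _ => by ring

theorem planch_add (n : ℕ) (φ ψ : (ℕ →₀ ℕ) → ℝ) :
    planch n (fun p => φ p + ψ p) = planch n φ + planch n ψ := by
  simp only [planch, mul_add, sum_add_distrib, add_div]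

theorem planch_mul (n : ℕ) (a : ℝ) (φ : (ℕ →₀ ℕ) → ℝ) :
    planch n (fun p => a * φ p) = a * planch n φ := by
  rw [planch, planch, ← mul_div_assoc, mul_sum]
  congr 1
  exact sum_congr rfl fun p _ => by ring

theorem planch_sum {ι : Type*} (s : Finset ι) (n : ℕ) (φ : ι → (ℕ →₀ ℕ) → ℝ) :
    planch n (fun p => ∑ i ∈ s, φ i p) = ∑ i ∈ s, planch n (φ i) := by
  simp only [planch, mul_sum, ← sum_div]
  rw [sum_comm]

theorem planch_mono (n : ℕ) {φ ψ : (ℕ →₀ ℕ) → ℝ} (h : ∀ p ∈ parts n, φ p ≤ ψ p) :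
    planch n φ ≤ planch n ψ := by
  rw [planch, planch]
  gcongr with p hp
  exact h p hp

theorem planch_nonneg (n : ℕ) {φ : (ℕ →₀ ℕ) → ℝ} (h : ∀ p ∈ parts n, 0 ≤ φ p) :
    0 ≤ planch n φ := by
  rw [planch]
  exact div_nonneg (sum_nonneg fun p hp => mul_nonneg (sq_nonneg _) (h p hp)) (by positivity)

theorem planch_congr (n : ℕ) {φ ψ : (ℕ →₀ ℕ) → ℝ} (h : ∀ p ∈ parts n, φ p = ψ p) :
    planch n φ = planch n ψ :=
  le_antisymm (planch_mono n fun p hp => (h p hp).le) (planch_mono n fun p hp => (h p hp).ge)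

theorem parts_zero : parts 0 = {0} := by
  ext p
  rw [mem_singleton]
  refine ⟨eq_zero_of_mem_parts_zero, ?_⟩
  rintro rfl
  exact mem_parts.2 ⟨fun _ _ _ => le_rfl, by simp⟩

theorem planch_zero (φ : (ℕ →₀ ℕ) → ℝ) : planch 0 φ = φ 0 := by
  simp [planch, parts_zero, syt_zero]

theorem sum_syt_sq (n : ℕ) : ∑ p ∈ parts n, syt p ^ 2 = n.factorial := by
  induction n with
  | zero => simp [parts_zero, syt_zero]
  | succ n ih =>
    have h := sum_syt_sq_succ n fun _ => 1
    simp only [mul_one] at h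
    rw [h, sum_congr rfl fun p hp => by rw [sum_syt_add_box hp le_rfl], Nat.factorial_succ]
    push_cast
    rw [← ih, mul_sum]
    exact sum_congr rfl fun p _ => by ring

theorem planch_const (n : ℕ) (a : ℝ) : planch n (fun _ => a) = a := by
  rw [planch, ← sum_mul, sum_syt_sq]
  field_simp

/-- The unnormalized expectation of the sum of `g` over the contents of the boxes added by the
Pieri growth from `n` to `n + k` boxes. -/
noncomputable def pieriSum (g : ℤ → ℝ) (n k : ℕ) : ℝ :=
  ∑ p ∈ parts n, syt p * stripSum 0 g p (n + k)

/-- The expectation of the sum of `g` over the contents of the boxes added by the Pieri growth. -/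
noncomputable def pieriE (g : ℤ → ℝ) (n k : ℕ) : ℝ :=
  k.factorial / (n + k).factorial * pieriSum g n k

/-- Removing a box from shapes weighted by `syt` reproduces the weights one level below. The terms
at `p - box i` of the strip recursion thus become the same quantity with `n` lowered by one. -/
theorem sum_sum_sub_box (n M : ℕ) (hM : n + 1 ≤ M) (Φ : (ℕ →₀ ℕ) → ℝ) :
    (∑ p ∈ parts (n + 1), syt p * ∑ i ∈ range M,
        if 0 < p i ∧ Antitone (p - box i) then Φ (p - box i) else 0)
      = (n + 1) * ∑ q ∈ parts n, syt q * Φ q := by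
  have h := sum_remove_eq_sum_add n M fun p q => syt p * Φ q
  simp only [mul_sum, mul_ite, mul_zero]
  rw [h]
  refine sum_congr rfl fun q hq => ?_
  rw [← mul_assoc, ← sum_syt_add_box hq hM, sum_mul]
  exact sum_congr rfl fun i _ => by split_ifs <;> simp

theorem pieriSum_succ (g : ℤ → ℝ) (n k : ℕ) :
    pieriSum g n (k + 1)
      = n * pieriSum g (n - 1) (k + 1) + pieriSum g n k
        + (n + k).choose k * (n.factorial * planch n (cornerSum g)) + pieriSum (fwd g) n k := by
  have e1 : ((n + k).choose k : ℝ) * (n.factorial * planch n (cornerSum g))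
      = ∑ p ∈ parts n, syt p * (cornerSum g p * ((n + k).choose k * syt p)) := by
    rw [planch, mul_div_cancel₀ _ (by positivity), mul_sum]
    exact sum_congr rfl fun p _ => by ring
  have e2 : (n : ℝ) * pieriSum g (n - 1) (k + 1) = ∑ p ∈ parts n, syt p *
      ∑ i ∈ range (n + k + 1), if 0 < p i then stripSum 0 g (p - box i) (n + k) else 0 := by
    cases n with
    | zero => simp [parts_zero]
    | succ n =>
      have h := sum_sum_sub_box n (n + 1 + k + 1) (by omega) fun q => stripSum 0 g q (n + 1 + k)
      rw [pieriSum, Nat.add_sub_cancel, show n + (k + 1) = n + 1 + k by ring]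
      push_cast
      rw [← h]
      refine sum_congr rfl fun p _ => ?_
      congr 1
      refine sum_congr rfl fun i _ => ?_
      by_cases ha : Antitone (p - box i)
      · simp only [ha, and_true]
      · simp only [ha, and_false, stripSum_eq_zero _ _ ha, ite_self]
  rw [e1, e2, pieriSum, pieriSum, pieriSum, ← sum_add_distrib, ← sum_add_distrib,
    ← sum_add_distrib]
  refine sum_congr rfl fun p hp => ?_
  rw [← add_assoc n k 1, stripSum_succ' g hp]
  ring

/-- Summed against `syt p`, the strip recursion closes up. The weights `n` and `k + 1` add up to `n
+ k + 1`, so it is a weighted mean; at `n = 0` the truncated `n - 1` is multiplied by zero. -/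
theorem pieriE_succ (g : ℤ → ℝ) (n k : ℕ) :
    (n + k + 1) * pieriE g n (k + 1)
      = n * pieriE g (n - 1) (k + 1)
        + (k + 1) * (pieriE g n k + planch n (cornerSum g) + pieriE (fwd g) n k) := by
  have hc : ((n + k).choose k : ℝ) * n.factorial * k.factorial = (n + k).factorial := by
    have := Nat.add_choose_mul_factorial_mul_factorial n k
    exact_mod_cast this
  have hN : ((n + k).factorial : ℝ) ≠ 0 := by positivity
  rw [pieriE, pieriSum_succ, ← add_assoc n k 1, Nat.factorial_succ (n + k), Nat.factorial_succ k]
  have e1 : (n : ℝ) * pieriE g (n - 1) (k + 1)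
      = (k + 1) * k.factorial / (n + k).factorial * (n * pieriSum g (n - 1) (k + 1)) := by
    cases n with
    | zero => simp
    | succ n =>
      rw [pieriE, Nat.add_sub_cancel, show n + (k + 1) = n + 1 + k by ring, Nat.factorial_succ k]
      push_cast; ring
  rw [e1, pieriE, pieriE]
  have hN' := hN
  rw [← hc] at hN' ⊢
  push_cast
  have hk : (k.factorial : ℝ) ≠ 0 := by positivity
  have hn : (n.factorial : ℝ) ≠ 0 := by positivity
  have hch : ((n + k).choose k : ℝ) ≠ 0 := by
    intro h; rw [h] at hN'; simp at hN'
  have hnk : (n : ℝ) + k + 1 ≠ 0 := by positivity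
  field_simp
  rw [← hc]
  ring

theorem pieriE_zero_right (g : ℤ → ℝ) (n : ℕ) : pieriE g n 0 = 0 := by
  have h : pieriSum g n 0 = 0 := sum_eq_zero fun p hp => by
    rw [add_zero, stripSum_same _ _ hp]; simp
  rw [pieriE, h, mul_zero]

theorem pieriE_mul (a : ℝ) (g : ℤ → ℝ) (n k : ℕ) :
    pieriE (fun c => a * g c) n k = a * pieriE g n k := by
  have h : pieriSum (fun c => a * g c) n k = a * pieriSum g n k := by
    rw [pieriSum, pieriSum, mul_sum]
    refine sum_congr rfl fun p _ => ?_
    have := stripSum_mul a 0 g p (n + k)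
    rw [mul_zero] at this
    rw [this]; ring
  rw [pieriE, pieriE, h]; ring

theorem pieriE_add (g h : ℤ → ℝ) (n k : ℕ) :
    pieriE (fun c => g c + h c) n k = pieriE g n k + pieriE h n k := by
  rw [pieriE, pieriE, pieriE, pieriSum, pieriSum, pieriSum, ← mul_add, ← sum_add_distrib]
  congr 1
  refine sum_congr rfl fun p _ => ?_
  have := stripSum_add 0 0 g h p (n + k)
  rw [add_zero] at this
  rw [this]; ring

theorem pieriE_sum {ι : Type*} (s : Finset ι) (a : ι → ℝ) (g : ι → ℤ → ℝ) (n k : ℕ) :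
    pieriE (fun c => ∑ i ∈ s, a i * g i c) n k = ∑ i ∈ s, a i * pieriE (g i) n k := by
  induction s using Finset.induction_on with
  | empty =>
    simp only [sum_empty]
    have := pieriE_mul 0 (fun _ => 0) n k
    simpa using this
  | insert i s hi ih =>
    simp only [sum_insert hi]
    rw [pieriE_add, pieriE_mul, ih]

theorem pieriE_one_eq (g : ℤ → ℝ) (n : ℕ) :
    pieriE g n 1 = (∑ p ∈ parts n, syt p * ∑ i ∈ range (n + 1),
      if Antitone (p + box i) then syt (p + box i) * g ((p i : ℤ) - i) else 0)
        / (n + 1).factorial := by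
  rw [pieriE, pieriSum, sum_congr rfl fun p hp => by rw [stripSum_one_step g hp le_rfl]]
  simp; ring

theorem pieriE_one_mono {g h : ℤ → ℝ} (hgh : ∀ c, g c ≤ h c) (n : ℕ) :
    pieriE g n 1 ≤ pieriE h n 1 := by
  rw [pieriE_one_eq, pieriE_one_eq]
  gcongr with p _ i _
  · exact syt_nonneg _
  · split_ifs
    · exact mul_le_mul_of_nonneg_left (hgh _) (syt_nonneg _)
    · exact le_rfl

/-- One step of the Plancherel growth. -/
theorem planch_succ (n : ℕ) (φ : (ℕ →₀ ℕ) → ℝ) :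
    planch (n + 1) φ = (∑ p ∈ parts n, syt p * ∑ i ∈ range (n + 1),
      if Antitone (p + box i) then syt (p + box i) * φ (p + box i) else 0)
        / (n + 1).factorial := by
  rw [planch, sum_syt_sq_succ]

theorem planch_eq_sum_step (n : ℕ) (φ : (ℕ →₀ ℕ) → ℝ) :
    planch n φ = (∑ p ∈ parts n, syt p * ∑ i ∈ range (n + 1),
      if Antitone (p + box i) then syt (p + box i) * φ p else 0) / (n + 1).factorial := by
  rw [planch, Nat.factorial_succ]
  have : ∀ p ∈ parts n, syt p * (∑ i ∈ range (n + 1),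
      if Antitone (p + box i) then syt (p + box i) * φ p else 0)
      = (n + 1) * (syt p ^ 2 * φ p) := by
    intro p hp
    have h := sum_syt_add_box hp le_rfl
    have h2 : (∑ i ∈ range (n + 1), if Antitone (p + box i) then syt (p + box i) * φ p else 0)
        = (∑ i ∈ range (n + 1), if Antitone (p + box i) then syt (p + box i) else 0) * φ p := by
      rw [sum_mul]; exact sum_congr rfl fun i _ => by split_ifs <;> simp
    rw [h2, h]; ring
  rw [sum_congr rfl this, ← mul_sum]
  push_cast
  have : (n : ℝ) + 1 ≠ 0 := by positivity
  field_simp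

theorem planch_contentSum_succ (g : ℤ → ℝ) (n : ℕ) :
    planch (n + 1) (contentSum g) = planch n (contentSum g) + pieriE g n 1 := by
  rw [planch_succ, planch_eq_sum_step, pieriE_one_eq, ← add_div, ← sum_add_distrib]
  congr 1
  refine sum_congr rfl fun p _ => ?_
  rw [← mul_add, ← sum_add_distrib]
  congr 1
  refine sum_congr rfl fun i _ => ?_
  split_ifs
  · rw [contentSum_add_box]; ring
  · simp

/-- A new box of content `c` changes the corner sum by `sndDiff g c`; these changes are added up
along the Plancherel growth. -/
theorem planch_cornerSum (g : ℤ → ℝ) (n : ℕ) :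
    planch n (cornerSum g) = g 0 + ∑ t ∈ range n, pieriE (sndDiff g) t 1 := by
  have h : planch n (cornerSum g) = g 0 + planch n (contentSum (sndDiff g)) := by
    have := planch_add n (fun _ => g 0) (contentSum (sndDiff g))
    rw [planch_const] at this
    exact this
  rw [h]
  congr 1
  clear h
  induction n with
  | zero => simp [planch_zero, contentSum_zero]
  | succ n ih => rw [planch_contentSum_succ, sum_range_succ, ih]

end Pieri

end PieriGrowth

namespace PieriGrowth

/-! ### Bounds for the expected moments of the contents -/

section Moments

open scoped Classical
open Finset

/-- The monomial of degree `j`, as a function of the content. -/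
noncomputable def pw (j : ℕ) (c : ℤ) : ℝ := (c : ℝ) ^ j

/-- The coefficients of the symmetric second difference of a monomial. -/
noncomputable def sndCoeff (j i : ℕ) : ℝ := (1 + (-1) ^ (j - i)) * j.choose i

theorem fwd_pw (j : ℕ) : fwd (pw j) = fun c => ∑ i ∈ range j, (j.choose i : ℝ) * pw i c := by
  funext c
  simp only [fwd, pw]
  push_cast
  rw [add_pow, sum_range_succ]
  simp only [one_pow, mul_one, Nat.choose_self, Nat.cast_one, add_sub_cancel_right]
  exact sum_congr rfl fun i _ => by ring

theorem sndDiff_pw (j : ℕ) :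
    sndDiff (pw j) = fun c => ∑ i ∈ range j, sndCoeff j i * pw i c := by
  funext c
  simp only [sndDiff, pw]
  push_cast
  rw [sub_eq_add_neg (c : ℝ) 1, add_pow, add_pow, sum_range_succ, sum_range_succ]
  simp only [one_pow, mul_one, Nat.choose_self, Nat.cast_one, Nat.sub_self, pow_zero]
  have : ∑ i ∈ range j, sndCoeff j i * (c : ℝ) ^ i
      = ∑ i ∈ range j, (c : ℝ) ^ i * (j.choose i) +
        ∑ i ∈ range j, (c : ℝ) ^ i * (-1) ^ (j - i) * (j.choose i) := by
    rw [← sum_add_distrib]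
    exact sum_congr rfl fun i _ => by rw [sndCoeff]; ring
  rw [this]; ring

theorem sndCoeff_eq_zero {j i : ℕ} (h : Odd (j - i)) : sndCoeff j i = 0 := by
  simp [sndCoeff, h.neg_one_pow]

theorem sndCoeff_nonneg (j i : ℕ) : 0 ≤ sndCoeff j i := by
  rw [sndCoeff]
  rcases neg_one_pow_eq_or ℝ (j - i) with h | h <;> rw [h] <;> norm_num

theorem add_two_le_of_sndCoeff_ne {j i : ℕ} (hi : i < j) (h : sndCoeff j i ≠ 0) : i + 2 ≤ j := by
  by_contra hc
  have : j - i = 1 := by omega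
  exact h (sndCoeff_eq_zero (by rw [this]; exact odd_one))

theorem pieriE_sndDiff (j n k : ℕ) :
    pieriE (sndDiff (pw j)) n k = ∑ i ∈ range j, sndCoeff j i * pieriE (pw i) n k := by
  rw [sndDiff_pw, pieriE_sum]

theorem pieriE_one_rec (g : ℤ → ℝ) (n : ℕ) :
    (n + 1) * pieriE g n 1 = n * pieriE g (n - 1) 1 + planch n (cornerSum g) := by
  have := pieriE_succ g n 0
  simpa [pieriE_zero_right] using this

/-- The second difference preserves parity, so the recursions never create an odd moment. This is
the transposition symmetry of the Plancherel growth. -/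
theorem pieriE_one_odd (j : ℕ) (hj : Odd j) :
    ∀ n, pieriE (pw j) n 1 = 0 ∧ planch n (cornerSum (pw j)) = 0 := by
  induction j using Nat.strong_induction_on with
  | _ j ih =>
  have hs : ∀ n, planch n (cornerSum (pw j)) = 0 := by
    intro n
    rw [planch_cornerSum]
    have h0 : pw j 0 = 0 := by simp [pw, hj.pos.ne']
    rw [h0, zero_add]
    refine sum_eq_zero fun t _ => ?_
    rw [pieriE_sndDiff]
    refine sum_eq_zero fun i hi => ?_
    have hi' := mem_range.1 hi
    rcases Nat.even_or_odd i with he | ho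
    · rw [sndCoeff_eq_zero (Nat.Odd.sub_even hi'.le hj he), zero_mul]
    · rw [(ih i hi' ho t).1, mul_zero]
  intro n
  refine ⟨?_, hs n⟩
  induction n with
  | zero => have := pieriE_one_rec (pw j) 0; rw [hs] at this; simpa using this
  | succ n ihn =>
    have := pieriE_one_rec (pw j) (n + 1)
    rw [hs, Nat.add_sub_cancel, ihn, mul_zero, add_zero] at this
    rcases mul_eq_zero.1 this with h | h
    · exfalso; push_cast at h; linarith [(Nat.cast_nonneg n : (0 : ℝ) ≤ n)]
    · exact h

/-- The second difference lowers the degree by at least two, hence the exponent `j / 2` by one, and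
the sum over the `n` growth steps restores that power. -/
theorem exists_bound_one (j : ℕ) : ∃ C : ℝ, 0 ≤ C ∧ ∀ n : ℕ,
    |pieriE (pw j) n 1| ≤ C * ((n : ℝ) + 1) ^ (j / 2) ∧
      |planch n (cornerSum (pw j))| ≤ C * ((n : ℝ) + 1) ^ (j / 2) := by
  induction j using Nat.strong_induction_on with
  | _ j ih =>
  choose! D hD0 hD using ih
  set E : ℝ := 1 + ∑ i ∈ range j, sndCoeff j i * D i with hE
  have hsum : 0 ≤ ∑ i ∈ range j, sndCoeff j i * D i :=
    sum_nonneg fun i hi => mul_nonneg (sndCoeff_nonneg _ _) (hD0 i (mem_range.1 hi))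
  have hE0 : 0 ≤ E := by positivity
  have hs : ∀ n : ℕ, |planch n (cornerSum (pw j))| ≤ E * ((n : ℝ) + 1) ^ (j / 2) := by
    intro n
    rw [planch_cornerSum]
    have h0 : |pw j 0| ≤ 1 := by
      rcases Nat.eq_zero_or_pos j with h | h
      · subst h; simp [pw]
      · simp [pw, h.ne']
    have h1 : ∀ t ∈ range n, |pieriE (sndDiff (pw j)) t 1| * ((n : ℝ) + 1)
        ≤ (∑ i ∈ range j, sndCoeff j i * D i) * ((n : ℝ) + 1) ^ (j / 2) := by
      intro t ht
      have ht' : (t : ℝ) ≤ n := by exact_mod_cast (mem_range.1 ht).le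
      rw [pieriE_sndDiff, sum_mul]
      refine (mul_le_mul_of_nonneg_right (abs_sum_le_sum_abs _ _) (by positivity)).trans ?_
      rw [sum_mul]
      refine sum_le_sum fun i hi => ?_
      by_cases hz : sndCoeff j i = 0
      · simp [hz]
      · have h2 := add_two_le_of_sndCoeff_ne (mem_range.1 hi) hz
        have h3 : j / 2 = (j / 2 - 1) + 1 := by omega
        have h4 : i / 2 ≤ j / 2 - 1 := by omega
        rw [abs_mul, abs_of_nonneg (sndCoeff_nonneg _ _), mul_assoc, mul_assoc]
        refine mul_le_mul_of_nonneg_left ?_ (sndCoeff_nonneg _ _)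
        have h5 := (hD i (mem_range.1 hi) t).1
        have h6 : ((t : ℝ) + 1) ^ (i / 2) ≤ ((n : ℝ) + 1) ^ (j / 2 - 1) :=
          (pow_le_pow_left₀ (by positivity) (by linarith) _).trans
            (pow_le_pow_right₀ (by linarith [(Nat.cast_nonneg n : (0 : ℝ) ≤ n)]) h4)
        rw [h3, pow_succ, ← mul_assoc]
        refine mul_le_mul_of_nonneg_right (h5.trans ?_) (by positivity)
        exact mul_le_mul_of_nonneg_left h6 (hD0 i (mem_range.1 hi))
    have h2 : |∑ t ∈ range n, pieriE (sndDiff (pw j)) t 1|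
        ≤ (∑ i ∈ range j, sndCoeff j i * D i) * ((n : ℝ) + 1) ^ (j / 2) := by
      refine (abs_sum_le_sum_abs _ _).trans ?_
      have hn : (0 : ℝ) < n + 1 := by positivity
      refine le_of_mul_le_mul_right ?_ hn
      rw [sum_mul]
      refine (sum_le_sum h1).trans ?_
      rw [sum_const, card_range, nsmul_eq_mul, mul_comm]
      refine mul_le_mul_of_nonneg_left (by linarith) (by positivity)
    have h3 : (1 : ℝ) ≤ ((n : ℝ) + 1) ^ (j / 2) :=
      one_le_pow₀ (by linarith [(Nat.cast_nonneg n : (0 : ℝ) ≤ n)])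
    calc _ ≤ |pw j 0| + |∑ t ∈ range n, pieriE (sndDiff (pw j)) t 1| := abs_add_le _ _
      _ ≤ 1 * ((n : ℝ) + 1) ^ (j / 2)
          + (∑ i ∈ range j, sndCoeff j i * D i) * ((n : ℝ) + 1) ^ (j / 2) := by linarith
      _ = _ := by rw [hE]; ring
  refine ⟨E, hE0, fun n => ⟨?_, hs n⟩⟩
  induction n with
  | zero =>
    have h1 := pieriE_one_rec (pw j) 0
    have h2 := hs 0
    simp only [Nat.cast_zero, zero_add, one_mul, zero_mul] at h1 h2 ⊢
    rwa [h1]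
  | succ n ihn =>
    have h1 := pieriE_one_rec (pw j) (n + 1)
    rw [Nat.add_sub_cancel] at h1
    have h2 := hs (n + 1)
    have hn : (0 : ℝ) < (n + 1 : ℕ) + 1 := by positivity
    refine le_of_mul_le_mul_left ?_ hn
    have h3 : ((n : ℝ) + 1) ^ (j / 2) ≤ ((n + 1 : ℕ) + 1 : ℝ) ^ (j / 2) :=
      pow_le_pow_left₀ (by positivity) (by push_cast; linarith) _
    calc _ = |((n + 1 : ℕ) + 1 : ℝ) * pieriE (pw j) (n + 1) 1| := by
            rw [abs_mul, abs_of_pos hn]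
      _ = |((n + 1 : ℕ) : ℝ) * pieriE (pw j) n 1 + planch (n + 1) (cornerSum (pw j))| := by
            rw [h1]
      _ ≤ (n + 1 : ℕ) * |pieriE (pw j) n 1| + |planch (n + 1) (cornerSum (pw j))| := by
            refine (abs_add_le _ _).trans ?_
            rw [abs_mul, Nat.abs_cast]
      _ ≤ (n + 1 : ℕ) * (E * ((n + 1 : ℕ) + 1 : ℝ) ^ (j / 2))
            + E * ((n + 1 : ℕ) + 1 : ℝ) ^ (j / 2) := by
            gcongr
            exact ihn.trans (mul_le_mul_of_nonneg_left h3 hE0)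
      _ = _ := by ring

/-- The induction behind the bounds for the Pieri growth. -/
theorem abs_pieriE_le {g : ℤ → ℝ} {v w : ℕ → ℝ} {E : ℝ} {l : ℕ} (hE : 0 ≤ E)
    (hw : ∀ n k : ℕ, |planch n (cornerSum g) + pieriE (fwd g) n k|
      ≤ E * (w k * ((n : ℝ) + ((k + 1 : ℕ) : ℝ) ^ 2) ^ l))
    (hv0 : ∀ k, 0 ≤ v k) (hv : ∀ k : ℕ, v k + w k ≤ v (k + 1)) (n k : ℕ) :
    |pieriE g n k| ≤ E * (v k * ((n : ℝ) + (k : ℝ) ^ 2) ^ l) := by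
  induction k generalizing n with
  | zero =>
    rw [pieriE_zero_right, abs_zero]
    have := hv0 0
    positivity
  | succ k ihk =>
    -- The recursion averages the bound at `n - 1`, with weight `n`, and the bounds at `k`, with
    -- weight `k + 1`; so only `v k + w k ≤ v (k + 1)` is needed.
    have key : ∀ n : ℕ, (n : ℝ) * |pieriE g (n - 1) (k + 1)|
        ≤ n * (E * (v (k + 1) * ((n : ℝ) + ((k + 1 : ℕ) : ℝ) ^ 2) ^ l)) →
        |pieriE g n (k + 1)| ≤ E * (v (k + 1) * ((n : ℝ) + ((k + 1 : ℕ) : ℝ) ^ 2) ^ l) := by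
      intro n hn
      set b : ℝ := ((n : ℝ) + ((k + 1 : ℕ) : ℝ) ^ 2) ^ l with hb
      have hb0 : 0 ≤ b := by positivity
      have hN : (0 : ℝ) < n + k + 1 := by positivity
      refine le_of_mul_le_mul_left ?_ hN
      have h1 : |pieriE g n k| ≤ E * (v k * b) := by
        refine (ihk n).trans (mul_le_mul_of_nonneg_left ?_ hE)
        refine mul_le_mul_of_nonneg_left (pow_le_pow_left₀ (by positivity) ?_ _) (hv0 k)
        push_cast; nlinarith [(Nat.cast_nonneg k : (0 : ℝ) ≤ k)]
      have h2 := hw n k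
      calc _ = |((n : ℝ) + k + 1) * pieriE g n (k + 1)| := by rw [abs_mul, abs_of_pos hN]
        _ = |(n : ℝ) * pieriE g (n - 1) (k + 1) + (k + 1) * (pieriE g n k
              + (planch n (cornerSum g) + pieriE (fwd g) n k))| := by
            rw [pieriE_succ, add_assoc (pieriE g n k)]
        _ ≤ n * |pieriE g (n - 1) (k + 1)| + (k + 1) * (|pieriE g n k|
              + |planch n (cornerSum g) + pieriE (fwd g) n k|) := by
            refine (abs_add_le _ _).trans ?_
            rw [abs_mul, abs_mul, Nat.abs_cast, abs_of_pos (by positivity : (0 : ℝ) < k + 1)]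
            gcongr
            exact abs_add_le _ _
        _ ≤ n * (E * (v (k + 1) * b)) + (k + 1) * (E * (v k * b) + E * (w k * b)) := by gcongr
        _ = n * (E * (v (k + 1) * b)) + (k + 1) * (E * ((v k + w k) * b)) := by ring
        _ ≤ n * (E * (v (k + 1) * b)) + (k + 1) * (E * (v (k + 1) * b)) := by
            gcongr
            exact hv k
        _ = _ := by ring
    induction n with
    | zero => exact key 0 (by simp)
    | succ n ihn =>
      refine key (n + 1) (mul_le_mul_of_nonneg_left ?_ (by positivity))
      rw [Nat.add_sub_cancel]
      refine ihn.trans (mul_le_mul_of_nonneg_left ?_ hE)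
      refine mul_le_mul_of_nonneg_left (pow_le_pow_left₀ (by positivity) ?_ _) (hv0 _)
      push_cast; linarith

/-- Bounds for the moments of the boxes of the Pieri growth, even and odd. -/
theorem exists_bound_pieriE (l : ℕ) : ∃ C : ℝ, 0 ≤ C ∧ ∀ n k : ℕ,
    |pieriE (pw (2 * l)) n k| ≤ C * (k * ((n : ℝ) + (k : ℝ) ^ 2) ^ l) ∧
      |pieriE (pw (2 * l + 1)) n k| ≤ C * ((k : ℝ) ^ 2 * ((n : ℝ) + (k : ℝ) ^ 2) ^ l) := by
  induction l using Nat.strong_induction_on with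
  | _ l ih =>
  choose! D hD0 hD using ih
  obtain ⟨B, hB0, hB⟩ := exists_bound_one (2 * l)
  have hdiv : 2 * l / 2 = l := by omega
  rw [hdiv] at hB
  have hmono : ∀ n k : ℕ, (n : ℝ) + (k : ℝ) ^ 2 ≤ (n : ℝ) + ((k + 1 : ℕ) : ℝ) ^ 2 := by
    intro n k
    push_cast; nlinarith [(Nat.cast_nonneg k : (0 : ℝ) ≤ k)]
  -- In degree below `2 * l` the prefactor `k` or `k ^ 2` is absorbed into one more power of `n + (k
  -- + 1) ^ 2`.
  have hlow : ∀ i, i < 2 * l → ∀ n k : ℕ,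
      |pieriE (pw i) n k| ≤ D (i / 2) * ((n : ℝ) + ((k + 1 : ℕ) : ℝ) ^ 2) ^ l := by
    intro i hi n k
    have hi2 : i / 2 < l := by omega
    have hp := hD _ hi2 n k
    set b : ℝ := (n : ℝ) + ((k + 1 : ℕ) : ℝ) ^ 2 with hb
    have hb1 : (1 : ℝ) ≤ b := by
      rw [hb]; push_cast
      nlinarith [(Nat.cast_nonneg k : (0 : ℝ) ≤ k), (Nat.cast_nonneg n : (0 : ℝ) ≤ n)]
    have hk2 : (k : ℝ) ^ 2 ≤ b := by
      rw [hb]; push_cast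
      nlinarith [(Nat.cast_nonneg k : (0 : ℝ) ≤ k), (Nat.cast_nonneg n : (0 : ℝ) ≤ n)]
    have hk1 : (k : ℝ) ≤ b := by
      rw [hb]; push_cast
      nlinarith [(Nat.cast_nonneg k : (0 : ℝ) ≤ k), (Nat.cast_nonneg n : (0 : ℝ) ≤ n)]
    have hle : ∀ x : ℝ, 0 ≤ x → x ≤ b →
        x * ((n : ℝ) + (k : ℝ) ^ 2) ^ (i / 2) ≤ b ^ l := by
      intro x hx hxb
      calc x * ((n : ℝ) + (k : ℝ) ^ 2) ^ (i / 2) ≤ b * b ^ (i / 2) := by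
            gcongr; exact hmono n k
        _ = b ^ (i / 2 + 1) := by ring
        _ ≤ _ := pow_le_pow_right₀ hb1 hi2
    rcases Nat.even_or_odd i with he | ho
    · rw [Nat.two_mul_div_two_of_even he] at hp
      exact hp.1.trans (mul_le_mul_of_nonneg_left (hle _ (by positivity) hk1) (hD0 _ hi2))
    · rw [Nat.two_mul_div_two_add_one_of_odd ho] at hp
      exact hp.2.trans (mul_le_mul_of_nonneg_left (hle _ (by positivity) hk2) (hD0 _ hi2))
  have hDi : ∀ i ∈ range (2 * l), 0 ≤ D (i / 2) := fun i hi =>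
    hD0 _ (by have := mem_range.1 hi; omega)
  set E : ℝ := B + ∑ i ∈ range (2 * l), ((2 * l).choose i : ℝ) * D (i / 2) with hE
  have hE0 : 0 ≤ E := add_nonneg hB0 (sum_nonneg fun i hi => mul_nonneg (by positivity) (hDi i hi))
  have heven : ∀ n k : ℕ,
      |pieriE (pw (2 * l)) n k| ≤ E * (k * ((n : ℝ) + (k : ℝ) ^ 2) ^ l) := by
    refine abs_pieriE_le (v := fun k => (k : ℝ)) (w := fun _ => 1) hE0 (fun n k => ?_)
      (fun k => by positivity) (fun k => by push_cast; linarith)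
    refine (abs_add_le _ _).trans ?_
    rw [hE, one_mul, add_mul]
    refine add_le_add ((hB n).2.trans (mul_le_mul_of_nonneg_left ?_ hB0)) ?_
    · refine pow_le_pow_left₀ (by positivity) ?_ _
      push_cast; nlinarith [(Nat.cast_nonneg k : (0 : ℝ) ≤ k)]
    · rw [fwd_pw, pieriE_sum, sum_mul]
      refine (abs_sum_le_sum_abs _ _).trans (sum_le_sum fun i hi => ?_)
      rw [abs_mul, Nat.abs_cast, mul_assoc]
      exact mul_le_mul_of_nonneg_left (hlow i (mem_range.1 hi) n k) (by positivity)
  set G : ℝ := E * (2 * l + 1 : ℕ)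
    + ∑ i ∈ range (2 * l), ((2 * l + 1).choose i : ℝ) * D (i / 2) with hG
  have hG0 : 0 ≤ G := add_nonneg (by positivity)
    (sum_nonneg fun i hi => mul_nonneg (by positivity) (hDi i hi))
  have hodd : ∀ n k : ℕ,
      |pieriE (pw (2 * l + 1)) n k| ≤ G * ((k : ℝ) ^ 2 * ((n : ℝ) + (k : ℝ) ^ 2) ^ l) := by
    -- In odd degree the Plancherel term vanishes, and the leading term of the forward difference
    -- has even degree, of size `k * (n + k ^ 2) ^ l`. Summed over `k` this gives `k ^ 2`. Having
    -- `k` here in place of `√n` is the source of the rate `k / √n`.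
    refine abs_pieriE_le (v := fun k => (k : ℝ) ^ 2) (w := fun k => 2 * k + 1) hG0
      (fun n k => ?_) (fun k => by positivity) (fun k => by push_cast; nlinarith)
    rw [(pieriE_one_odd _ (odd_two_mul_add_one l) n).2, zero_add, fwd_pw, pieriE_sum,
      sum_range_succ, hG, add_mul, add_comm]
    refine (abs_add_le _ _).trans (add_le_add ?_ ?_)
    · rw [abs_mul, Nat.abs_cast, Nat.choose_succ_self_right, mul_comm E, mul_assoc]
      refine mul_le_mul_of_nonneg_left ((heven n k).trans ?_) (by positivity)
      refine mul_le_mul_of_nonneg_left ?_ hE0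
      have := pow_le_pow_left₀ (by positivity) (hmono n k) l
      refine mul_le_mul ?_ this (by positivity) (by positivity)
      linarith [(Nat.cast_nonneg k : (0 : ℝ) ≤ k)]
    · rw [sum_mul]
      refine (abs_sum_le_sum_abs _ _).trans (sum_le_sum fun i hi => ?_)
      rw [abs_mul, Nat.abs_cast, mul_assoc]
      refine mul_le_mul_of_nonneg_left ((hlow i (mem_range.1 hi) n k).trans ?_) (by positivity)
      refine mul_le_mul_of_nonneg_left ?_ (hDi i hi)
      refine le_mul_of_one_le_left (by positivity) ?_
      linarith [(Nat.cast_nonneg k : (0 : ℝ) ≤ k)]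
  refine ⟨max E G, hE0.trans (le_max_left _ _), fun n k => ⟨(heven n k).trans ?_,
    (hodd n k).trans ?_⟩⟩
  · exact mul_le_mul_of_nonneg_right (le_max_left _ _) (by positivity)
  · exact mul_le_mul_of_nonneg_right (le_max_right _ _) (by positivity)

end Moments

end PieriGrowth

namespace PieriGrowth

/-! ### Concentration of the moments of the transition measure of a Plancherel diagram -/

section Concentration

open scoped Classical
open Finset

/-- The integral of `g` against the transition measure of the partition `p` of `n`. -/
noncomputable def transE (g : ℤ → ℝ) (n : ℕ) (p : ℕ →₀ ℕ) : ℝ :=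
  stripSum 0 g p (n + 1) / ((n + 1) * syt p)

/-- Also true where `syt p = 0` and the quotient takes its default value: then the nonnegative
numbers `syt (p + box i)` add up to zero, so the left side vanishes. -/
theorem stripSum_eq_transE (g : ℤ → ℝ) {n : ℕ} {p : ℕ →₀ ℕ} (hp : p ∈ parts n) :
    stripSum 0 g p (n + 1) = (n + 1) * syt p * transE g n p := by
  rw [transE]
  by_cases h : syt p = 0
  · rw [h, mul_zero, zero_mul, stripSum_one_step g hp le_rfl]
    have h1 := sum_syt_add_box hp le_rfl
    rw [h, mul_zero, sum_eq_zero_iff_of_nonneg] at h1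
    · refine sum_eq_zero fun i hi => ?_
      have := h1 i hi
      split_ifs with ha
      · rw [if_pos ha] at this; rw [this, zero_mul]
      · rfl
    · intro i _; split_ifs; exacts [syt_nonneg _, le_rfl]
  · have : (n : ℝ) + 1 ≠ 0 := by positivity
    field_simp

theorem sum_step_eq_transE (g : ℤ → ℝ) {n : ℕ} {p : ℕ →₀ ℕ} (hp : p ∈ parts n) :
    (∑ i ∈ range (n + 1), if Antitone (p + box i) then syt (p + box i) * g ((p i : ℤ) - i)
      else 0) = (n + 1) * syt p * transE g n p := by
  rw [← stripSum_eq_transE g hp, stripSum_one_step g hp le_rfl]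

theorem planch_congr' (n : ℕ) {φ ψ : (ℕ →₀ ℕ) → ℝ}
    (h : ∀ p ∈ parts n, syt p ≠ 0 → φ p = ψ p) : planch n φ = planch n ψ := by
  rw [planch, planch]
  congr 1
  refine sum_congr rfl fun p hp => ?_
  by_cases h0 : syt p = 0
  · simp [h0]
  · rw [h p hp h0]

/-- The tower property: `transE g n` is the conditional mean of `g` at the content of the next box,
given the shape. -/
theorem planch_mul_transE (g : ℤ → ℝ) (n : ℕ) (φ : (ℕ →₀ ℕ) → ℝ) :
    planch n (fun p => φ p * transE g n p)
      = (∑ p ∈ parts n, syt p * ∑ i ∈ range (n + 1), if Antitone (p + box i) then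
          syt (p + box i) * (φ p * g ((p i : ℤ) - i)) else 0) / (n + 1).factorial := by
  rw [planch, Nat.factorial_succ]
  have : ∀ p ∈ parts n, syt p * (∑ i ∈ range (n + 1), if Antitone (p + box i) then
      syt (p + box i) * (φ p * g ((p i : ℤ) - i)) else 0)
      = (n + 1) * (syt p ^ 2 * (φ p * transE g n p)) := by
    intro p hp
    have h := sum_step_eq_transE g hp
    have h2 : (∑ i ∈ range (n + 1), if Antitone (p + box i) then
        syt (p + box i) * (φ p * g ((p i : ℤ) - i)) else 0)
        = φ p * ∑ i ∈ range (n + 1),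
          if Antitone (p + box i) then syt (p + box i) * g ((p i : ℤ) - i) else 0 := by
      rw [mul_sum]; exact sum_congr rfl fun i _ => by split_ifs <;> ring
    rw [h2, h]; ring
  rw [sum_congr rfl this, ← mul_sum]
  push_cast
  have : (n : ℝ) + 1 ≠ 0 := by positivity
  field_simp

theorem planch_transE (g : ℤ → ℝ) (n : ℕ) : planch n (transE g n) = pieriE g n 1 := by
  have := planch_mul_transE g n fun _ => 1
  simp only [one_mul] at this
  rw [pieriE_one_eq, ← this]

theorem transE_sum {ι : Type*} (s : Finset ι) (a : ι → ℝ) (g : ι → ℤ → ℝ) {n : ℕ}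
    {p : ℕ →₀ ℕ} (hp : p ∈ parts n) :
    transE (fun c => ∑ i ∈ s, a i * g i c) n p = ∑ i ∈ s, a i * transE (g i) n p := by
  simp only [transE, stripSum_one_step _ hp le_rfl, ← mul_div_assoc, ← sum_div]
  congr 1
  simp only [mul_sum]
  rw [sum_comm]
  refine sum_congr rfl fun r _ => ?_
  split_ifs
  · exact sum_congr rfl fun i _ => by ring
  · simp

/-- Jensen's inequality for the transition measure; the factor `syt p ^ 2` covers the shapes where
the quotient is a default value. -/
theorem sq_transE_le (g : ℤ → ℝ) {n : ℕ} {p : ℕ →₀ ℕ} (hp : p ∈ parts n) :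
    syt p ^ 2 * transE g n p ^ 2 ≤ syt p ^ 2 * transE (fun c => g c ^ 2) n p := by
  set x : ℝ := (n : ℝ) + 1 with hx
  have hx0 : 0 < x := by positivity
  have h1 := sum_step_eq_transE g hp
  have h2 := sum_step_eq_transE (fun c => g c ^ 2) hp
  have h3 := sum_syt_add_box hp le_rfl
  have hcs : (∑ i ∈ range (n + 1), if Antitone (p + box i) then
        syt (p + box i) * g ((p i : ℤ) - i) else 0) ^ 2
      ≤ (∑ i ∈ range (n + 1), if Antitone (p + box i) then syt (p + box i) else 0)
        * ∑ i ∈ range (n + 1), if Antitone (p + box i) then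
            syt (p + box i) * g ((p i : ℤ) - i) ^ 2 else 0 := by
    refine sum_sq_le_sum_mul_sum_of_sq_le_mul _ ?_ ?_ ?_
    · intro i _; split_ifs; exacts [syt_nonneg _, le_rfl]
    · intro i _; split_ifs; exacts [mul_nonneg (syt_nonneg _) (sq_nonneg _), le_rfl]
    · intro i _; split_ifs; exacts [le_of_eq (by ring), le_of_eq (by ring)]
  rw [h1, h2, h3] at hcs
  have hx2 : 0 < x ^ 2 := by positivity
  refine le_of_mul_le_mul_left ?_ hx2
  calc _ = (x * syt p * transE g n p) ^ 2 := by ring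
    _ ≤ _ := hcs
    _ = _ := by ring

theorem planch_sq_transE_le (g : ℤ → ℝ) (n : ℕ) :
    planch n (fun p => transE g n p ^ 2) ≤ pieriE (fun c => g c ^ 2) n 1 := by
  rw [← planch_transE, planch, planch]
  gcongr 1
  exact sum_le_sum fun p hp => sq_transE_le g hp

theorem pieriE_one_const (a : ℝ) (n : ℕ) : pieriE (fun _ => a) n 1 = a := by
  rw [pieriE_one_eq, ← planch_eq_sum_step n fun _ => a, planch_const]

/-- The center of the `j`-th moment of the transition measure. -/
noncomputable def momCenter (j n : ℕ) : ℝ :=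
  if Even j then (j.factorial : ℝ) / (j / 2 + 1).factorial * n.choose (j / 2) else 0

/-- The center of the `j`-th corner sum. -/
noncomputable def cornerCenter (j n : ℕ) : ℝ :=
  (n + 1) * momCenter j n - n * momCenter j (n - 1)

theorem cornerCenter_two_mul (l n : ℕ) :
    cornerCenter (2 * l) n
      = (l + 1) * ((2 * l).factorial / (l + 1).factorial) * n.choose l := by
  have hdiv : 2 * l / 2 = l := by omega
  have hev : Even (2 * l) := even_two_mul l
  have key : ((n : ℝ) + 1) * n.choose l - n * (n - 1).choose l = (l + 1) * n.choose l := by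
    cases n with
    | zero => cases l <;> simp
    | succ n =>
      have h1 := Nat.add_one_mul_choose_eq (n + 1) l
      have h2 := Nat.add_one_mul_choose_eq n l
      rw [Nat.choose_succ_succ] at h1
      have h1' : ((n : ℝ) + 1 + 1) * (n + 1).choose l
        = ((n + 1).choose l + (n + 1).choose (l + 1)) * (l + 1) := by exact_mod_cast h1
      have h2' : ((n : ℝ) + 1) * n.choose l = (n + 1).choose (l + 1) * (l + 1) := by
        exact_mod_cast h2
      rw [Nat.add_sub_cancel]
      push_cast
      linarith
  rw [cornerCenter, momCenter, momCenter, if_pos hev, if_pos hev, hdiv]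
  linear_combination ((2 * l).factorial / (l + 1).factorial : ℝ) * key

theorem cornerCenter_odd {j : ℕ} (hj : Odd j) (n : ℕ) : cornerCenter j n = 0 := by
  simp [cornerCenter, momCenter, Nat.not_even_iff_odd.2 hj]

theorem sndCoeff_add_two (j : ℕ) : sndCoeff (j + 2) j = (j + 2) * (j + 1) := by
  rw [sndCoeff, show j + 2 - j = 2 by omega, Nat.choose_symm_add, Nat.cast_choose_two]
  push_cast; ring

/-- The reason for the binomial form of `momCenter`: the centers solve exactly the recursion of the
moments in which only the leading coefficient of the second difference is kept. -/
theorem cornerCenter_succ_sub (j n : ℕ) :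
    cornerCenter (j + 2) (n + 1) - cornerCenter (j + 2) n
      = sndCoeff (j + 2) j * momCenter j n := by
  rcases Nat.even_or_odd j with he | ho
  · obtain ⟨l, rfl⟩ := even_iff_two_dvd.1 he
    rw [show 2 * l + 2 = 2 * (l + 1) by ring, cornerCenter_two_mul, cornerCenter_two_mul,
      show 2 * (l + 1) = 2 * l + 2 by ring, sndCoeff_add_two, momCenter, if_pos he,
      show 2 * l / 2 = l by omega, Nat.choose_succ_succ n l, Nat.factorial_succ (2 * l + 1),
      Nat.factorial_succ (2 * l), Nat.factorial_succ (l + 1)]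
    push_cast
    field_simp
    ring
  · rw [cornerCenter_odd (by simpa [Nat.odd_add] using ho),
      cornerCenter_odd (by simpa [Nat.odd_add] using ho), momCenter,
      if_neg (Nat.not_even_iff_odd.2 ho)]
    simp

theorem cornerCenter_zero (j : ℕ) : cornerCenter (j + 2) 0 = 0 := by
  simp [cornerCenter, momCenter]

theorem exists_bound_momCenter (j : ℕ) : ∃ C : ℝ, 0 ≤ C ∧ ∀ n : ℕ,
    |momCenter j n| ≤ C * ((n : ℝ) + 1) ^ (j / 2) := by
  refine ⟨(j.factorial : ℝ) / (j / 2 + 1).factorial, by positivity, fun n => ?_⟩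
  rw [momCenter]
  split_ifs
  · rw [abs_of_nonneg (by positivity)]
    gcongr
    have h1 : (n.choose (j / 2) : ℝ) ≤ (n : ℝ) ^ (j / 2) := by
      exact_mod_cast Nat.choose_le_pow n (j / 2)
    exact h1.trans (pow_le_pow_left₀ (by positivity) (by linarith) _)
  · rw [abs_zero]; positivity

/-- The mean square deviation of the `j`-th moment of the transition measure. -/
noncomputable def momVar (j n : ℕ) : ℝ :=
  planch n fun p => (transE (pw j) n p - momCenter j n) ^ 2

/-- The mean square deviation of the `j`-th corner sum. -/
noncomputable def cornerVar (j n : ℕ) : ℝ :=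
  planch n fun p => (cornerSum (pw j) p - cornerCenter j n) ^ 2

theorem momVar_nonneg (j n : ℕ) : 0 ≤ momVar j n := planch_nonneg n fun _ _ => sq_nonneg _

theorem stripSum_one_rec (g : ℤ → ℝ) {n : ℕ} {p : ℕ →₀ ℕ} (hp : p ∈ parts n) :
    stripSum 0 g p (n + 1)
      = (∑ i ∈ range (n + 1), if 0 < p i then stripSum 0 g (p - box i) n else 0)
        + cornerSum g p * syt p := by
  have := stripSum_succ' g (k := 0) hp
  simpa [stripSum_same _ _ hp] using this

/-- The recursion for the mean square deviation of the moments of the transition measure. -/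
theorem momVar_rec (j n : ℕ) :
    (n + 1) * momVar j n ≤ cornerVar j n + n * momVar j (n - 1) := by
  cases n with
  | zero =>
    have h : momVar j 0 = cornerVar j 0 := by
      rw [momVar, cornerVar]
      refine planch_congr' 0 fun p hp h0 => ?_
      have h1 := stripSum_eq_transE (pw j) hp
      rw [stripSum_one_rec _ hp, eq_zero_of_mem_parts_zero hp] at h1
      rw [eq_zero_of_mem_parts_zero hp]
      simp only [syt_zero, cornerCenter] at h1 ⊢
      simp at h1 ⊢
      rw [h1]
    rw [h]; simp
  | succ n =>
    rw [Nat.add_sub_cancel]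
    set κ := momCenter j (n + 1) with hκ
    set κ' := momCenter j n with hκ'
    set x : ℝ := ((n + 1 : ℕ) : ℝ) with hx
    have hx0 : 0 < x := by positivity
    set m : (ℕ →₀ ℕ) → ℝ := fun q => transE (pw j) n q - κ' with hm
    have hpt : ∀ p ∈ parts (n + 1), (x + 1) * (syt p ^ 2 * (transE (pw j) (n + 1) p - κ) ^ 2)
        ≤ syt p ^ 2 * (cornerSum (pw j) p - cornerCenter j (n + 1)) ^ 2
          + x * (syt p * ∑ i ∈ range (n + 2),
              if 0 < p i ∧ Antitone (p - box i) then syt (p - box i) * m (p - box i) ^ 2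
              else 0) := by
      intro p hp
      set S : ℝ := ∑ i ∈ range (n + 2),
        if 0 < p i ∧ Antitone (p - box i) then syt (p - box i) * m (p - box i) else 0 with hS
      set Q : ℝ := ∑ i ∈ range (n + 2),
        if 0 < p i ∧ Antitone (p - box i) then syt (p - box i) * m (p - box i) ^ 2 else 0 with hQ
      have hF := syt_eq_sum_range hp (show n + 1 ≤ n + 2 by omega)
      have hSQ : S ^ 2 ≤ syt p * Q := by
        rw [hF]
        refine sum_sq_le_sum_mul_sum_of_sq_le_mul _ ?_ ?_ ?_
        · intro i _; split_ifs; exacts [syt_nonneg _, le_rfl]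
        · intro i _; split_ifs; exacts [mul_nonneg (syt_nonneg _) (sq_nonneg _), le_rfl]
        · intro i _; split_ifs; exacts [le_of_eq (by ring), le_of_eq (by ring)]
      -- The deviation at `p` is a mean of the corner deviation, with weight 1, and of the
      -- deviations at the shapes `p - box i`, with total weight `x`. Convexity of the square does
      -- the rest.
      have hlin : (x + 1) * syt p * (transE (pw j) (n + 1) p - κ)
          = syt p * (cornerSum (pw j) p - cornerCenter j (n + 1)) + x * S := by
        have h1 := stripSum_eq_transE (pw j) hp
        rw [stripSum_one_rec _ hp] at h1
        have h2 : (∑ i ∈ range (n + 1 + 1),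
            if 0 < p i then stripSum 0 (pw j) (p - box i) (n + 1) else 0)
            = x * S + x * κ' * syt p := by
          rw [hF, hS, mul_sum, mul_sum, ← sum_add_distrib]
          refine sum_congr rfl fun i _ => ?_
          by_cases hi : 0 < p i
          · by_cases ha : Antitone (p - box i)
            · rw [if_pos hi, if_pos ⟨hi, ha⟩, if_pos ⟨hi, ha⟩,
                stripSum_eq_transE _ (sub_box_mem_parts hp hi ha), hm, hx]
              push_cast; ring
            · rw [if_pos hi, if_neg (fun h => ha h.2), if_neg (fun h => ha h.2),
                stripSum_eq_zero _ _ ha]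
              ring
          · rw [if_neg hi, if_neg (fun h => hi h.1), if_neg (fun h => hi h.1)]; ring
        rw [h2] at h1
        rw [cornerCenter, Nat.add_sub_cancel, ← hκ, ← hκ', ← hx]
        linear_combination -h1
      have hx1 : 0 < x + 1 := by positivity
      refine le_of_mul_le_mul_left ?_ hx1
      set a : ℝ := syt p * (cornerSum (pw j) p - cornerCenter j (n + 1)) with ha
      calc (x + 1) * ((x + 1) * (syt p ^ 2 * (transE (pw j) (n + 1) p - κ) ^ 2))
          = (a + x * S) ^ 2 := by rw [← hlin]; ring
        _ ≤ (x + 1) * (a ^ 2 + x * S ^ 2) := by nlinarith [mul_nonneg hx0.le (sq_nonneg (a - S))]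
        _ ≤ (x + 1) * (a ^ 2 + x * (syt p * Q)) := by gcongr
        _ = _ := by rw [ha]; ring
    have hsum := sum_le_sum hpt
    rw [sum_add_distrib, ← mul_sum, ← mul_sum,
      sum_sum_sub_box n (n + 2) (by omega) fun q => syt q * m q ^ 2] at hsum
    rw [momVar, cornerVar, momVar, planch, planch, planch, Nat.factorial_succ]
    have hf : (0 : ℝ) < n.factorial := by positivity
    push_cast at hx ⊢
    rw [← hx]
    have e : ∑ q ∈ parts n, syt q * (syt q * m q ^ 2)
        = ∑ q ∈ parts n, syt q ^ 2 * (transE (pw j) n q - κ') ^ 2 :=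
      sum_congr rfl fun q _ => by rw [hm]; ring
    rw [e] at hsum
    rw [← hx] at hsum
    have hxf : 0 < x * (n.factorial : ℝ) := by positivity
    rw [← mul_div_assoc, ← mul_div_assoc, div_le_iff₀ hxf]
    refine hsum.trans (le_of_eq ?_)
    field_simp
    ring

theorem momVar_le_of_cornerVar_le {j m : ℕ} {K : ℝ} (hK : 0 ≤ K)
    (h : ∀ n : ℕ, cornerVar j n ≤ K * ((n : ℝ) + 1) ^ m) (n : ℕ) :
    momVar j n ≤ K * ((n : ℝ) + 1) ^ m := by
  induction n with
  | zero =>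
    have h1 := momVar_rec j 0
    have h2 := h 0
    simp only [Nat.cast_zero, zero_add, one_mul, zero_mul, add_zero] at h1 h2 ⊢
    linarith
  | succ n ih =>
    have h1 := momVar_rec j (n + 1)
    rw [Nat.add_sub_cancel] at h1
    have h2 := h (n + 1)
    have hx : (0 : ℝ) < (n + 1 : ℕ) + 1 := by positivity
    refine le_of_mul_le_mul_left (h1.trans ?_) hx
    have h3 : momVar j n ≤ K * (((n + 1 : ℕ) : ℝ) + 1) ^ m :=
      ih.trans (mul_le_mul_of_nonneg_left
        (pow_le_pow_left₀ (by positivity) (by push_cast; linarith) _) hK)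
    calc _ ≤ K * (((n + 1 : ℕ) : ℝ) + 1) ^ m
          + (n + 1 : ℕ) * (K * (((n + 1 : ℕ) : ℝ) + 1) ^ m) := by gcongr
      _ = _ := by ring

theorem cornerSum_add_box (g : ℤ → ℝ) (p : ℕ →₀ ℕ) (i : ℕ) :
    cornerSum g (p + box i) = cornerSum g p + sndDiff g ((p i : ℤ) - i) := by
  rw [cornerSum, cornerSum, contentSum_add_box]; ring

/-- The recursion for the mean square deviation of the corner sums. -/
theorem cornerVar_succ_le (j n : ℕ) (Δ : ℝ)
    (hΔ : cornerCenter j (n + 1) - cornerCenter j n = Δ) :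
    cornerVar j (n + 1) ≤ (1 + 1 / (2 * ((n : ℝ) + 1))) * cornerVar j n
      + 2 * ((n : ℝ) + 1) * planch n (fun p => (transE (sndDiff (pw j)) n p - Δ) ^ 2)
      + pieriE (fun c => (sndDiff (pw j) c - Δ) ^ 2) n 1 := by
  set x : ℝ := (n : ℝ) + 1 with hx
  have hx0 : 0 < x := by positivity
  set d := sndDiff (pw j) with hd
  have h2 : cornerVar j (n + 1) = (∑ p ∈ parts n, syt p * ∑ i ∈ range (n + 1),
      if Antitone (p + box i) then syt (p + box i) *
        (cornerSum (pw j) p - cornerCenter j n + (d ((p i : ℤ) - i) - Δ)) ^ 2 else 0)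
        / (n + 1).factorial := by
    rw [cornerVar, planch_succ]
    congr 1
    refine sum_congr rfl fun p _ => ?_
    congr 1
    refine sum_congr rfl fun i _ => ?_
    rw [cornerSum_add_box, ← hΔ]
    congr 2; ring
  have h3 := planch_eq_sum_step n fun p => (cornerSum (pw j) p - cornerCenter j n) ^ 2
  have h5 := pieriE_one_eq (fun c => (d c - Δ) ^ 2) n
  have h6 : planch n (fun p => 2 * (cornerSum (pw j) p - cornerCenter j n)
      * (transE d n p - Δ))
      = (∑ p ∈ parts n, syt p * ∑ i ∈ range (n + 1), if Antitone (p + box i) then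
          syt (p + box i) * (2 * (cornerSum (pw j) p - cornerCenter j n)
            * (d ((p i : ℤ) - i) - Δ)) else 0) / (n + 1).factorial := by
    have e1 := planch_mul_transE d n fun p => 2 * (cornerSum (pw j) p - cornerCenter j n)
    have e2 := planch_eq_sum_step n fun p =>
      -(2 * (cornerSum (pw j) p - cornerCenter j n) * Δ)
    have e3 := planch_add n (fun p => 2 * (cornerSum (pw j) p - cornerCenter j n) * transE d n p)
      fun p => -(2 * (cornerSum (pw j) p - cornerCenter j n) * Δ)
    rw [e1, e2, ← add_div, ← sum_add_distrib] at e3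
    rw [planch_congr n (ψ := fun p => 2 * (cornerSum (pw j) p - cornerCenter j n) * transE d n p
      + -(2 * (cornerSum (pw j) p - cornerCenter j n) * Δ)) fun p _ => by ring, e3]
    congr 1
    refine sum_congr rfl fun p _ => ?_
    rw [← mul_add, ← sum_add_distrib]
    congr 1
    refine sum_congr rfl fun i _ => ?_
    split_ifs <;> ring
  have h7 : cornerVar j (n + 1) = cornerVar j n
      + planch n (fun p => 2 * (cornerSum (pw j) p - cornerCenter j n) * (transE d n p - Δ))
      + pieriE (fun c => (d c - Δ) ^ 2) n 1 := by
    rw [h2, h5, h6, cornerVar, h3, ← add_div, ← add_div, ← sum_add_distrib, ← sum_add_distrib]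
    congr 1
    refine sum_congr rfl fun p _ => ?_
    rw [← mul_add, ← mul_add, ← sum_add_distrib, ← sum_add_distrib]
    congr 1
    refine sum_congr rfl fun i _ => ?_
    split_ifs <;> ring
  -- The cross term sees the increment only through its conditional mean. The weight `2 * x` in
  -- Young's inequality keeps the loss on the old variance at `1 / (2 * x)`.
  have h8 : planch n (fun p => 2 * (cornerSum (pw j) p - cornerCenter j n) * (transE d n p - Δ))
      ≤ 1 / (2 * x) * cornerVar j n + 2 * x * planch n (fun p => (transE d n p - Δ) ^ 2) := by
    rw [cornerVar, ← planch_mul, ← planch_mul, ← planch_add]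
    refine planch_mono n fun p _ => ?_
    set a := cornerSum (pw j) p - cornerCenter j n
    set b := transE d n p - Δ
    have e : 1 / (2 * x) * a ^ 2 + 2 * x * b ^ 2 - 2 * a * b
        = (a - 2 * x * b) ^ 2 / (2 * x) := by
      field_simp
      ring
    have : 0 ≤ (a - 2 * x * b) ^ 2 / (2 * x) := by positivity
    linarith
  rw [h7]
  linarith

/-- Only degree `i` of the second difference needs concentration. Degree `i + 1` is absent by
parity, and a lower degree `r` is controlled by Jensen and the `2 * r`-th moment, since `r + 1 ≤ i`
leaves room for the factor `n + 1`. -/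
theorem transE_sub_le (i n : ℕ) {Kc Ke : ℕ → ℝ}
    (hKc : momVar i n * ((n : ℝ) + 1) ≤ Kc i * ((n : ℝ) + 1) ^ i)
    (hKe : ∀ r < i, pieriE (pw (2 * r)) n 1 ≤ Ke r * ((n : ℝ) + 1) ^ r)
    (hKe0 : ∀ r < i, 0 ≤ Ke r) :
    ((n : ℝ) + 1) * planch n (fun p =>
        (transE (sndDiff (pw (i + 2))) n p - sndCoeff (i + 2) i * momCenter i n) ^ 2)
      ≤ (i + 2) * (∑ r ∈ range i, sndCoeff (i + 2) r ^ 2 * Ke r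
          + sndCoeff (i + 2) i ^ 2 * Kc i) * ((n : ℝ) + 1) ^ i := by
  set x : ℝ := (n : ℝ) + 1 with hx
  have hx1 : 1 ≤ x := by rw [hx]; linarith [(Nat.cast_nonneg n : (0 : ℝ) ≤ n)]
  have hlast : sndCoeff (i + 2) (i + 1) = 0 :=
    sndCoeff_eq_zero (by rw [show i + 2 - (i + 1) = 1 by omega]; exact odd_one)
  have h1 : planch n (fun p =>
      (transE (sndDiff (pw (i + 2))) n p - sndCoeff (i + 2) i * momCenter i n) ^ 2)
      ≤ (i + 2) * (∑ r ∈ range i, sndCoeff (i + 2) r ^ 2 * planch n (fun p => transE (pw r) n p ^ 2)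
        + sndCoeff (i + 2) i ^ 2 * momVar i n) := by
    have e : (fun p => ((i : ℝ) + 2) * (∑ r ∈ range i, sndCoeff (i + 2) r ^ 2 * transE (pw r) n p ^ 2
        + sndCoeff (i + 2) i ^ 2 * (transE (pw i) n p - momCenter i n) ^ 2)) = fun p =>
          ((i : ℝ) + 2) * ((fun p => ∑ r ∈ range i, sndCoeff (i + 2) r ^ 2 * transE (pw r) n p ^ 2) p
        + (fun p => sndCoeff (i + 2) i ^ 2 * (transE (pw i) n p - momCenter i n) ^ 2) p) := rfl
    have e2 : ((i : ℝ) + 2) * (∑ r ∈ range i,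
          sndCoeff (i + 2) r ^ 2 * planch n (fun p => transE (pw r) n p ^ 2)
        + sndCoeff (i + 2) i ^ 2 * momVar i n)
        = planch n (fun p => ((i : ℝ) + 2) *
          (∑ r ∈ range i, sndCoeff (i + 2) r ^ 2 * transE (pw r) n p ^ 2
            + sndCoeff (i + 2) i ^ 2 * (transE (pw i) n p - momCenter i n) ^ 2)) := by
      rw [e, planch_mul, planch_add, planch_sum, momVar, planch_mul]
      congr 2
      exact sum_congr rfl fun r _ => by rw [planch_mul]
    rw [e2]
    refine planch_mono n fun p hp => ?_
    rw [sndDiff_pw, transE_sum _ _ _ hp, sum_range_succ, sum_range_succ, hlast, zero_mul, add_zero,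
      add_sub_assoc, ← mul_sub]
    have hcs := sq_sum_le_card_mul_sum_sq (s := range (i + 1))
      (f := fun r => if r < i then sndCoeff (i + 2) r * transE (pw r) n p
        else sndCoeff (i + 2) i * (transE (pw i) n p - momCenter i n))
    have e3 : ∀ r ∈ range i, (if r < i then sndCoeff (i + 2) r * transE (pw r) n p
        else sndCoeff (i + 2) i * (transE (pw i) n p - momCenter i n))
        = sndCoeff (i + 2) r * transE (pw r) n p := fun r hr => if_pos (mem_range.1 hr)
    have e4 : ∀ r ∈ range i, (if r < i then sndCoeff (i + 2) r * transE (pw r) n p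
        else sndCoeff (i + 2) i * (transE (pw i) n p - momCenter i n)) ^ 2
        = sndCoeff (i + 2) r ^ 2 * transE (pw r) n p ^ 2 := fun r hr => by
      rw [if_pos (mem_range.1 hr)]; ring
    rw [sum_range_succ, sum_range_succ, sum_congr rfl e3, sum_congr rfl e4,
      if_neg (lt_irrefl i), card_range, mul_pow] at hcs
    refine hcs.trans (mul_le_mul_of_nonneg_right (by push_cast; linarith) ?_)
    exact add_nonneg (sum_nonneg fun r _ => by positivity) (by positivity)
  have h2 : ∀ r ∈ range i, sndCoeff (i + 2) r ^ 2 * planch n (fun p => transE (pw r) n p ^ 2) * x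
      ≤ sndCoeff (i + 2) r ^ 2 * Ke r * x ^ i := by
    intro r hr
    have hr' := mem_range.1 hr
    rw [mul_assoc, mul_assoc]
    refine mul_le_mul_of_nonneg_left ?_ (sq_nonneg _)
    have h3 : planch n (fun p => transE (pw r) n p ^ 2) ≤ Ke r * x ^ r := by
      refine (planch_sq_transE_le _ n).trans (le_trans (le_of_eq ?_) (hKe r hr'))
      congr 1
      funext c
      rw [pw, pw, ← pow_mul, mul_comm]
    calc _ ≤ Ke r * x ^ r * x := mul_le_mul_of_nonneg_right h3 (by positivity)
      _ = Ke r * x ^ (r + 1) := by ring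
      _ ≤ _ := mul_le_mul_of_nonneg_left (pow_le_pow_right₀ hx1 hr') (hKe0 r hr')
  have hx0 : 0 ≤ x := by linarith
  calc _ ≤ x * ((i + 2) * (∑ r ∈ range i,
          sndCoeff (i + 2) r ^ 2 * planch n (fun p => transE (pw r) n p ^ 2)
        + sndCoeff (i + 2) i ^ 2 * momVar i n)) := mul_le_mul_of_nonneg_left h1 hx0
    _ = (i + 2) * (∑ r ∈ range i,
          sndCoeff (i + 2) r ^ 2 * planch n (fun p => transE (pw r) n p ^ 2) * x
        + sndCoeff (i + 2) i ^ 2 * (momVar i n * x)) := by rw [← sum_mul]; ring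
    _ ≤ (i + 2) * (∑ r ∈ range i, sndCoeff (i + 2) r ^ 2 * Ke r * x ^ i
        + sndCoeff (i + 2) i ^ 2 * (Kc i * x ^ i)) := by
      refine mul_le_mul_of_nonneg_left (add_le_add (sum_le_sum h2) ?_) (by positivity)
      exact mul_le_mul_of_nonneg_left hKc (sq_nonneg _)
    _ = _ := by rw [← sum_mul]; ring

theorem pieriE_sq_sndDiff_sub_le (i n : ℕ) {Ke : ℕ → ℝ} {C : ℝ}
    (hKe : ∀ r ≤ i, pieriE (pw (2 * r)) n 1 ≤ Ke r * ((n : ℝ) + 1) ^ r)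
    (hKe0 : ∀ r ≤ i, 0 ≤ Ke r) (hC : |momCenter i n| ≤ C * ((n : ℝ) + 1) ^ (i / 2)) :
    pieriE (fun c => (sndDiff (pw (i + 2)) c - sndCoeff (i + 2) i * momCenter i n) ^ 2) n 1
      ≤ 2 * ((i + 2) * ∑ r ∈ range (i + 1), sndCoeff (i + 2) r ^ 2 * Ke r
          + (sndCoeff (i + 2) i * C) ^ 2) * ((n : ℝ) + 1) ^ i := by
  set x : ℝ := (n : ℝ) + 1 with hx
  have hx1 : 1 ≤ x := by rw [hx]; linarith [(Nat.cast_nonneg n : (0 : ℝ) ≤ n)]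
  set Δ := sndCoeff (i + 2) i * momCenter i n with hΔ
  have hlast : sndCoeff (i + 2) (i + 1) = 0 :=
    sndCoeff_eq_zero (by rw [show i + 2 - (i + 1) = 1 by omega]; exact odd_one)
  have hΔ2 : Δ ^ 2 ≤ (sndCoeff (i + 2) i * C) ^ 2 * x ^ i := by
    have h1 : momCenter i n ^ 2 ≤ C ^ 2 * x ^ i := by
      rw [← sq_abs]
      calc _ ≤ (C * x ^ (i / 2)) ^ 2 := pow_le_pow_left₀ (abs_nonneg _) hC 2
        _ = C ^ 2 * x ^ (i / 2 * 2) := by rw [mul_pow, ← pow_mul]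
        _ ≤ _ := mul_le_mul_of_nonneg_left (pow_le_pow_right₀ hx1 (by omega)) (sq_nonneg _)
    rw [hΔ, mul_pow, mul_pow, mul_assoc]
    exact mul_le_mul_of_nonneg_left h1 (sq_nonneg _)
  have h1 : ∀ c : ℤ, (sndDiff (pw (i + 2)) c - Δ) ^ 2
      ≤ (∑ r ∈ range (i + 1), (2 * (i + 2) * sndCoeff (i + 2) r ^ 2) * pw (2 * r) c)
        + 2 * Δ ^ 2 := by
    intro c
    have h2 : sndDiff (pw (i + 2)) c ^ 2
        ≤ (i + 2) * ∑ r ∈ range (i + 1), sndCoeff (i + 2) r ^ 2 * pw (2 * r) c := by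
      rw [sndDiff_pw]
      simp only
      rw [sum_range_succ, hlast, zero_mul, add_zero]
      refine (sq_sum_le_card_mul_sum_sq (s := range (i + 1))).trans ?_
      have e : ∀ r ∈ range (i + 1), (sndCoeff (i + 2) r * pw r c) ^ 2
          = sndCoeff (i + 2) r ^ 2 * pw (2 * r) c := fun r _ => by
        rw [mul_pow, pw, pw, ← pow_mul, mul_comm r 2]
      rw [sum_congr rfl e, card_range]
      refine mul_le_mul_of_nonneg_right (by push_cast; linarith) (sum_nonneg fun r _ => ?_)
      rw [pw, pow_mul]; positivity
    have e : (∑ r ∈ range (i + 1), (2 * ((i : ℝ) + 2) * sndCoeff (i + 2) r ^ 2) * pw (2 * r) c)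
        = 2 * ((i + 2) * ∑ r ∈ range (i + 1), sndCoeff (i + 2) r ^ 2 * pw (2 * r) c) := by
      rw [mul_sum, mul_sum]; exact sum_congr rfl fun r _ => by ring
    rw [e]
    nlinarith [sq_nonneg (sndDiff (pw (i + 2)) c + Δ)]
  refine (pieriE_one_mono h1 n).trans ?_
  rw [pieriE_add, pieriE_sum, pieriE_one_const]
  have h3 : ∀ r ∈ range (i + 1),
      2 * ((i : ℝ) + 2) * sndCoeff (i + 2) r ^ 2 * pieriE (pw (2 * r)) n 1
        ≤ 2 * (i + 2) * sndCoeff (i + 2) r ^ 2 * (Ke r * x ^ i) := by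
    intro r hr
    have hr' : r ≤ i := Nat.lt_succ_iff.1 (mem_range.1 hr)
    refine mul_le_mul_of_nonneg_left ((hKe r hr').trans ?_) (by positivity)
    exact mul_le_mul_of_nonneg_left (pow_le_pow_right₀ hx1 hr') (hKe0 r hr')
  refine (add_le_add (sum_le_sum h3) (mul_le_mul_of_nonneg_left hΔ2 zero_le_two)).trans
    (le_of_eq ?_)
  have e : ∑ r ∈ range (i + 1), 2 * ((i : ℝ) + 2) * sndCoeff (i + 2) r ^ 2 * (Ke r * x ^ i)
      = 2 * (i + 2) * (∑ r ∈ range (i + 1), sndCoeff (i + 2) r ^ 2 * Ke r) * x ^ i := by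
    rw [mul_sum, sum_mul]; exact sum_congr rfl fun r _ => by ring
  rw [e]; ring

theorem cornerVar_eq_zero {j : ℕ} (hj : j < 2) (n : ℕ) : cornerVar j n = 0 := by
  have h : ∀ p : ℕ →₀ ℕ, cornerSum (pw j) p = cornerCenter j n := by
    intro p
    have hs : sndDiff (pw j) = fun _ => 0 := by
      rw [sndDiff_pw]
      funext c
      refine sum_eq_zero fun i hi => ?_
      have := mem_range.1 hi
      rw [sndCoeff_eq_zero (by rw [show j - i = 1 by omega]; exact odd_one), zero_mul]
    rw [cornerSum, hs]
    have : contentSum (fun _ => 0) p = 0 := by simp [contentSum, Finsupp.sum]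
    rw [this, add_zero]
    interval_cases j
    · simp [cornerCenter, momCenter, pw]
    · rw [cornerCenter_odd odd_one]; simp [pw]
  rw [cornerVar, planch_congr n (ψ := fun _ => 0) fun p _ => by rw [h p, sub_self]; simp,
    planch_const]

/-- Concentration of the moments of the transition measure under the Plancherel measure. -/
theorem exists_momVar_le (j : ℕ) : ∃ K : ℝ, 0 ≤ K ∧ ∀ n : ℕ,
    momVar j n * ((n : ℝ) + 1) ≤ K * ((n : ℝ) + 1) ^ j := by
  induction j using Nat.strong_induction_on with
  | _ j ih =>
  rcases lt_or_ge j 2 with hj | hj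
  -- In degree below two the corner sum is constant. The factor `n + 1` on the left of the claim
  -- stands for an exponent `j - 1` on the right, which would be truncated at `j = 0`.
  · refine ⟨0, le_rfl, fun n => ?_⟩
    have := momVar_le_of_cornerVar_le (j := j) (m := 0) le_rfl
      (fun n => by rw [cornerVar_eq_zero hj]; simp) n
    have h0 : momVar j n = 0 := le_antisymm (by simpa using this) (momVar_nonneg j n)
    rw [h0]; simp
  · obtain ⟨i, rfl⟩ := Nat.exists_eq_add_of_le' hj
    obtain ⟨K, hK0, hK⟩ := ih i (by omega)
    choose Ke hKe0 hKe using fun r : ℕ => exists_bound_one (2 * r)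
    obtain ⟨C, hC0, hC⟩ := exists_bound_momCenter i
    have hKe' : ∀ r n : ℕ, pieriE (pw (2 * r)) n 1 ≤ Ke r * ((n : ℝ) + 1) ^ r := fun r n => by
      have := (le_abs_self _).trans (hKe r n).1
      rwa [show 2 * r / 2 = r by omega] at this
    set C₁ : ℝ := (i + 2) * (∑ r ∈ range i, sndCoeff (i + 2) r ^ 2 * Ke r
          + sndCoeff (i + 2) i ^ 2 * K) with hC₁
    set C₂ : ℝ := 2 * ((i + 2) * ∑ r ∈ range (i + 1), sndCoeff (i + 2) r ^ 2 * Ke r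
          + (sndCoeff (i + 2) i * C) ^ 2) with hC₂
    have hC₁0 : 0 ≤ C₁ := mul_nonneg (by positivity) (add_nonneg
      (sum_nonneg fun r _ => mul_nonneg (sq_nonneg _) (hKe0 r)) (mul_nonneg (sq_nonneg _) hK0))
    have hC₂0 : 0 ≤ C₂ := mul_nonneg zero_le_two (add_nonneg (mul_nonneg (by positivity)
      (sum_nonneg fun r _ => mul_nonneg (sq_nonneg _) (hKe0 r))) (sq_nonneg _))
    -- The constant balances the recursion: the factor `1 + 1 / (2 * x)` adds half of it, the two
    -- error terms add the other half `2 * C₁ + C₂`, each times `x ^ i`, and passing from `x` to `x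
    -- + 1` provides exactly one full multiple.
    have hV : ∀ n : ℕ, cornerVar (i + 2) n ≤ 2 * (2 * C₁ + C₂) * ((n : ℝ) + 1) ^ (i + 1) := by
      intro n
      induction n with
      | zero =>
        have : cornerVar (i + 2) 0 = 0 := by
          rw [cornerVar, planch_zero, cornerCenter_zero, cornerSum, contentSum_zero]
          simp [pw]
        rw [this]; positivity
      | succ n ihn =>
        set x : ℝ := (n : ℝ) + 1 with hx
        have hx0 : 0 < x := by positivity
        have h1 := cornerVar_succ_le (i + 2) n _ (cornerCenter_succ_sub i n)
        have h2 := transE_sub_le i n (Kc := fun _ => K) (Ke := Ke) (hK n)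
          (fun r _ => hKe' r n) (fun r _ => hKe0 r)
        have h3 := pieriE_sq_sndDiff_sub_le i n (Ke := Ke) (fun r _ => hKe' r n)
          (fun r _ => hKe0 r) (hC n)
        rw [← hC₁] at h2
        rw [← hC₂] at h3
        have h4 : (1 + 1 / (2 * x)) * cornerVar (i + 2) n
            ≤ (1 + 1 / (2 * x)) * (2 * (2 * C₁ + C₂) * x ^ (i + 1)) :=
          mul_le_mul_of_nonneg_left ihn (by positivity)
        have h5 : (1 + 1 / (2 * x)) * (2 * (2 * C₁ + C₂) * x ^ (i + 1))
            = 2 * (2 * C₁ + C₂) * x ^ (i + 1) + (2 * C₁ + C₂) * x ^ i := by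
          field_simp
          ring
        have h6 : (x + 1) * x ^ i ≤ (x + 1) ^ (i + 1) := by
          rw [pow_succ, mul_comm]
          exact mul_le_mul_of_nonneg_right (pow_le_pow_left₀ hx0.le (by linarith) _) (by positivity)
        push_cast
        rw [← hx]
        calc _ ≤ 2 * (2 * C₁ + C₂) * x ^ (i + 1) + (2 * C₁ + C₂) * x ^ i
              + 2 * (C₁ * x ^ i) + C₂ * x ^ i := by linarith
          _ = 2 * (2 * C₁ + C₂) * ((x + 1) * x ^ i) := by ring
          _ ≤ _ := mul_le_mul_of_nonneg_left h6 (by positivity)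
    refine ⟨2 * (2 * C₁ + C₂), by positivity, fun n => ?_⟩
    have := momVar_le_of_cornerVar_le (by positivity) hV n
    calc _ ≤ 2 * (2 * C₁ + C₂) * ((n : ℝ) + 1) ^ (i + 1) * ((n : ℝ) + 1) :=
          mul_le_mul_of_nonneg_right this (by positivity)
      _ = _ := by ring

end Concentration

end PieriGrowth

namespace PieriGrowth

/-! ### Row insertion: bumping lemmas and injectivity -/

section Insertion

open scoped Classical
open Finset

variable {α : Type*}

/-- The row lengths of a tableau. -/
noncomputable def tabShape (T : List (List α)) : ℕ →₀ ℕ :=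
  Finsupp.onFinset (range T.length) (fun i => (T.getD i []).length) fun i hi => by
    by_contra hc
    rw [mem_range, not_lt] at hc
    exact hi (by rw [List.getD_eq_default _ _ hc]; rfl)

theorem tabShape_apply (T : List (List α)) (i : ℕ) : tabShape T i = (T.getD i []).length := rfl

theorem tabShape_nil : tabShape ([] : List (List α)) = 0 := by ext i; simp [tabShape_apply]

theorem tabShape_cons_zero (r : List α) (T : List (List α)) : tabShape (r :: T) 0 = r.length := by
  simp [tabShape_apply]

theorem tabShape_cons_succ (r : List α) (T : List (List α)) (i : ℕ) :
    tabShape (r :: T) (i + 1) = tabShape T i := by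
  simp [tabShape_apply]

variable [LinearOrder α]

/-- The index of the row in which the insertion of `x` into a tableau creates a box. -/
def bumpRow (x : α) : List (List α) → ℕ
  | [] => 0
  | r :: rs =>
      match (rowInsert x r).2 with
      | none => 0
      | some y => bumpRow y rs + 1

theorem rowInsert_perm (x : α) (r : List α) :
    ((rowInsert x r).1 ++ (rowInsert x r).2.toList).Perm (x :: r) := by
  induction r with
  | nil => simp [rowInsert]
  | cons a r ih =>
    by_cases h : x < a
    · simp only [rowInsert, h, if_true, Option.toList_some, List.cons_append]
      refine List.Perm.cons _ ?_
      exact List.perm_append_singleton a r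
    · simp only [rowInsert, h, if_false, List.cons_append]
      exact (ih.cons a).trans (List.Perm.swap x a r)

theorem length_rowInsert_none {x : α} {r : List α} (h : (rowInsert x r).2 = none) :
    (rowInsert x r).1.length = r.length + 1 := by
  have := (rowInsert_perm x r).length_eq
  simpa [h] using this

theorem length_rowInsert_some {x y : α} {r : List α} (h : (rowInsert x r).2 = some y) :
    (rowInsert x r).1.length = r.length := by
  have := (rowInsert_perm x r).length_eq
  simpa [h] using this

theorem tabShape_tableauInsert (x : α) (T : List (List α)) :
    tabShape (tableauInsert x T) = tabShape T + box (bumpRow x T) := by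
  induction T generalizing x with
  | nil =>
    ext i
    cases i with
    | zero => simp [tableauInsert, bumpRow, tabShape_apply]
    | succ i => simp [tableauInsert, bumpRow, tabShape_apply]
  | cons r T ih =>
    ext i
    cases h : (rowInsert x r).2 with
    | none =>
      simp only [tableauInsert, bumpRow, h]
      cases i with
      | zero => rw [add_box_self, tabShape_cons_zero, tabShape_cons_zero, length_rowInsert_none h]
      | succ i => rw [add_box_of_ne _ (by omega), tabShape_cons_succ, tabShape_cons_succ]
    | some y =>
      simp only [tableauInsert, bumpRow, h]
      cases i with
      | zero =>
        rw [add_box_of_ne _ (by omega), tabShape_cons_zero, tabShape_cons_zero,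
          length_rowInsert_some h]
      | succ i =>
        rw [tabShape_cons_succ, ih]
        by_cases hi : bumpRow y T = i
        · subst hi
          rw [add_box_self, add_box_self, tabShape_cons_succ]
        · rw [add_box_of_ne _ hi, add_box_of_ne _ (by omega), tabShape_cons_succ]

/-- A tableau without empty rows whose rows are weakly increasing. -/
def GoodTab (T : List (List α)) : Prop := ∀ r ∈ T, r ≠ [] ∧ r.Pairwise (· ≤ ·)

theorem mem_rowInsert {x b : α} {r : List α} (h : b ∈ (rowInsert x r).1) : b = x ∨ b ∈ r := by
  have := (rowInsert_perm x r).mem_iff (a := b)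
  simpa using this.1 (List.mem_append_left _ h)

theorem mem_of_bump {x y : α} {r : List α} (h : (rowInsert x r).2 = some y) : y ∈ r := by
  induction r with
  | nil => simp [rowInsert] at h
  | cons a r ih =>
    by_cases hx : x < a
    · simp only [rowInsert, hx, if_true, Option.some.injEq] at h
      simp [h]
    · simp only [rowInsert, hx, if_false] at h
      exact List.mem_cons_of_mem _ (ih h)

theorem pairwise_rowInsert (x : α) {r : List α} (h : r.Pairwise (· ≤ ·)) :
    (rowInsert x r).1.Pairwise (· ≤ ·) := by
  induction r with
  | nil => simp [rowInsert]
  | cons a r ih =>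
    rw [List.pairwise_cons] at h
    by_cases hx : x < a
    · simp only [rowInsert, hx, if_true]
      exact List.pairwise_cons.2 ⟨fun b hb => hx.le.trans (h.1 b hb), h.2⟩
    · simp only [rowInsert, hx, if_false]
      refine List.pairwise_cons.2 ⟨fun b hb => ?_, ih h.2⟩
      rcases mem_rowInsert hb with rfl | hb
      · exact not_lt.1 hx
      · exact h.1 b hb

theorem rowInsert_ne_nil (x : α) (r : List α) : (rowInsert x r).1 ≠ [] := by
  cases r with
  | nil => simp [rowInsert]
  | cons a r => by_cases hx : x < a <;> simp [rowInsert, hx]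

theorem GoodTab.tableauInsert {T : List (List α)} (h : GoodTab T) (x : α) :
    GoodTab (tableauInsert x T) := by
  induction T generalizing x with
  | nil => intro r hr; simp only [PieriGrowth.tableauInsert, List.mem_singleton] at hr; simp [hr]
  | cons r T ih =>
    have hT : GoodTab T := fun s hs => h s (List.mem_cons_of_mem _ hs)
    have hr := h r List.mem_cons_self
    cases hy : (rowInsert x r).2 with
    | none =>
      simp only [PieriGrowth.tableauInsert, hy]
      intro s hs
      rcases List.mem_cons.1 hs with rfl | hs
      · exact ⟨rowInsert_ne_nil x r, pairwise_rowInsert x hr.2⟩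
      · exact hT s hs
    | some y =>
      simp only [PieriGrowth.tableauInsert, hy]
      intro s hs
      rcases List.mem_cons.1 hs with rfl | hs
      · exact ⟨rowInsert_ne_nil x r, pairwise_rowInsert x hr.2⟩
      · exact ih hT y s hs

/-- Three insertions are compared: `x`, then `z` after `x`, and `z` alone. What `z` does alone is
always what `x` does or what `z` does after `x`, and this alternative propagates down the rows. -/
theorem rowInsert_asc {x z : α} (hxz : x ≤ z) {r : List α} (hr : r.Pairwise (· ≤ ·)) :
    ((rowInsert x r).2 = none ∧ (rowInsert z (rowInsert x r).1).2 = none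
        ∧ (rowInsert z r).2 = none) ∨
    ∃ y₁, (rowInsert x r).2 = some y₁ ∧
      (((rowInsert z (rowInsert x r).1).2 = none ∧
        ((rowInsert z r).2 = none ∨ (rowInsert z r).2 = some y₁)) ∨
      ∃ y₂, (rowInsert z (rowInsert x r).1).2 = some y₂ ∧ y₁ ≤ y₂ ∧
        ((rowInsert z r).2 = some y₁ ∨ (rowInsert z r).2 = some y₂)) := by
  induction r with
  | nil => left; simp [rowInsert, not_lt.2 hxz]
  | cons a r ih =>
    rw [List.pairwise_cons] at hr
    by_cases hx : x < a
    · right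
      refine ⟨a, by simp [rowInsert, hx], ?_⟩
      simp only [rowInsert, hx, if_true, not_lt.2 hxz, if_false]
      cases h2 : (rowInsert z r).2 with
      | none =>
        left
        refine ⟨rfl, ?_⟩
        by_cases hz : z < a <;> simp [hz]
      | some y₂ =>
        right
        refine ⟨y₂, rfl, hr.1 _ (mem_of_bump h2), ?_⟩
        by_cases hz : z < a <;> simp [hz]
    · have hz : ¬ z < a := fun h => hx (hxz.trans_lt h)
      simp only [rowInsert, hx, hz, if_false]
      exact ih hr.2

theorem rowInsert_desc {x z : α} (hzx : z < x) (r : List α) :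
    ((rowInsert x r).2 = none ∧ ∃ y₂, (rowInsert z (rowInsert x r).1).2 = some y₂ ∧
        ((rowInsert z r).2 = none ∨ (rowInsert z r).2 = some y₂)) ∨
    ∃ y₁ y₂, (rowInsert x r).2 = some y₁ ∧ (rowInsert z (rowInsert x r).1).2 = some y₂ ∧
      y₂ < y₁ ∧ ((rowInsert z r).2 = some y₁ ∨ (rowInsert z r).2 = some y₂) := by
  induction r with
  | nil => left; simp [rowInsert, hzx]
  | cons a r ih =>
    by_cases hz : z < a
    · by_cases hx : x < a
      · right
        exact ⟨a, x, by simp [rowInsert, hx], by simp [rowInsert, hx, hzx], hx,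
          by simp [rowInsert, hz]⟩
      · simp only [rowInsert, hx, hz, if_false, if_true]
        cases h1 : (rowInsert x r).2 with
        | none => left; exact ⟨rfl, a, rfl, Or.inr rfl⟩
        | some y₁ =>
          right
          exact ⟨y₁, a, rfl, rfl, (not_lt.1 hx).trans_lt (lt_of_bump h1), Or.inr rfl⟩
    · have hx : ¬ x < a := fun h => hz (hzx.trans h)
      simp only [rowInsert, hx, hz, if_false]
      exact ih

theorem bumpRow_none {x : α} {r : List α} {T : List (List α)} (h : (rowInsert x r).2 = none) :
    bumpRow x (r :: T) = 0 := by simp [bumpRow, h]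

theorem bumpRow_some {x y : α} {r : List α} {T : List (List α)} (h : (rowInsert x r).2 = some y) :
    bumpRow x (r :: T) = bumpRow y T + 1 := by simp [bumpRow, h]

theorem tableauInsert_none {x : α} {r : List α} {T : List (List α)}
    (h : (rowInsert x r).2 = none) : tableauInsert x (r :: T) = (rowInsert x r).1 :: T := by
  simp [tableauInsert, h]

theorem tableauInsert_some {x y : α} {r : List α} {T : List (List α)}
    (h : (rowInsert x r).2 = some y) :
    tableauInsert x (r :: T) = (rowInsert x r).1 :: tableauInsert y T := by
  simp [tableauInsert, h]

/-- Row bumping lemma, increasing case. -/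
theorem bumpRow_asc {x z : α} (hxz : x ≤ z) {T : List (List α)} (hT : GoodTab T) :
    bumpRow z (tableauInsert x T) ≤ bumpRow x T ∧
      (bumpRow z T = bumpRow x T ∨ bumpRow z T = bumpRow z (tableauInsert x T)) := by
  induction T generalizing x z with
  | nil =>
    have h : (rowInsert z [x]).2 = none := by simp [rowInsert, not_lt.2 hxz]
    simp [bumpRow, tableauInsert, bumpRow_none h]
  | cons r T ih =>
    have hT' : GoodTab T := fun s hs => hT s (List.mem_cons_of_mem _ hs)
    rcases rowInsert_asc hxz (hT r List.mem_cons_self).2 with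
      ⟨h1, h2, h3⟩ | ⟨y₁, h1, ⟨h2, h3⟩ | ⟨y₂, h2, hy, h3⟩⟩
    · rw [tableauInsert_none h1, bumpRow_none h1, bumpRow_none h2, bumpRow_none h3]; simp
    · rw [tableauInsert_some h1, bumpRow_some h1, bumpRow_none h2]
      refine ⟨by omega, ?_⟩
      rcases h3 with h3 | h3
      · right; rw [bumpRow_none h3]
      · left; rw [bumpRow_some h3]
    · rw [tableauInsert_some h1, bumpRow_some h1, bumpRow_some h2]
      obtain ⟨i1, i2⟩ := ih hy hT'
      refine ⟨by omega, ?_⟩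
      -- If `z` alone bumps the entry that `x` bumps, it follows the route of `x` to the end;
      -- otherwise the next row faces the same comparison with `y₁` and `y₂`.
      rcases h3 with h3 | h3
      · left; rw [bumpRow_some h3]
      · rw [bumpRow_some h3]; omega

/-- Row bumping lemma, decreasing case. -/
theorem bumpRow_desc {x z : α} (hzx : z < x) (T : List (List α)) :
    bumpRow x T < bumpRow z (tableauInsert x T) ∧
      (bumpRow z T = bumpRow x T ∨ bumpRow z T = bumpRow z (tableauInsert x T)) := by
  induction T generalizing x z with
  | nil =>
    have h : (rowInsert z [x]).2 = some x := by simp [rowInsert, hzx]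
    simp [bumpRow, tableauInsert, bumpRow_some h]
  | cons r T ih =>
    rcases rowInsert_desc hzx r with ⟨h1, y₂, h2, h3⟩ | ⟨y₁, y₂, h1, h2, hy, h3⟩
    · rw [tableauInsert_none h1, bumpRow_none h1, bumpRow_some h2]
      refine ⟨by omega, ?_⟩
      rcases h3 with h3 | h3
      · left; rw [bumpRow_none h3]
      · right; rw [bumpRow_some h3]
    · rw [tableauInsert_some h1, bumpRow_some h1, bumpRow_some h2]
      obtain ⟨i1, i2⟩ := ih hy
      refine ⟨by omega, ?_⟩
      rcases h3 with h3 | h3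
      · left; rw [bumpRow_some h3]
      · rw [bumpRow_some h3]; omega

theorem rowInsert_eq_append {x : α} {r : List α} (h : (rowInsert x r).2 = none) :
    (rowInsert x r).1 = r ++ [x] := by
  induction r with
  | nil => simp [rowInsert]
  | cons a r ih =>
    by_cases hx : x < a
    · simp [rowInsert, hx] at h
    · simp only [rowInsert, hx, if_false] at h ⊢
      rw [ih h, List.cons_append]

theorem mem_rowInsert_self (x : α) (r : List α) : x ∈ (rowInsert x r).1 := by
  induction r with
  | nil => simp [rowInsert]
  | cons a r ih =>
    by_cases hx : x < a
    · simp [rowInsert, hx]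
    · simp only [rowInsert, hx, if_false]; exact List.mem_cons_of_mem _ ih

/-- Reverse bumping: in a sorted row the inserted letter is the last entry smaller than the bumped
one. The two mixed cases would put a letter smaller than `y` to the right of the place of `y`. -/
theorem rowInsert_injective {x x' y : α} {r r' : List α} (hr : r.Pairwise (· ≤ ·))
    (hr' : r'.Pairwise (· ≤ ·)) (h : (rowInsert x r).2 = some y) (h' : (rowInsert x' r').2 = some y)
    (he : (rowInsert x r).1 = (rowInsert x' r').1) : x = x' ∧ r = r' := by
  induction r generalizing r' with
  | nil => simp [rowInsert] at h
  | cons a r ih =>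
    cases r' with
    | nil => simp [rowInsert] at h'
    | cons a' r' =>
      rw [List.pairwise_cons] at hr hr'
      by_cases hx : x < a <;> by_cases hx' : x' < a'
      · simp only [rowInsert, hx, hx', if_true, Option.some.injEq, List.cons.injEq] at h h' he
        obtain ⟨rfl, rfl⟩ := he
        exact ⟨rfl, by rw [h, h']⟩
      · exfalso
        simp only [rowInsert, hx, hx', if_true, if_false, Option.some.injEq,
          List.cons.injEq] at h h' he
        have h1 : x' ∈ r := he.2 ▸ mem_rowInsert_self x' r'
        have h2 := hr.1 _ h1
        rw [h] at h2
        exact (lt_of_bump h').not_ge h2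
      · exfalso
        simp only [rowInsert, hx, hx', if_true, if_false, Option.some.injEq,
          List.cons.injEq] at h h' he
        have h1 : x ∈ r' := he.2 ▸ mem_rowInsert_self x r
        have h2 := hr'.1 _ h1
        rw [h'] at h2
        exact (lt_of_bump h).not_ge h2
      · simp only [rowInsert, hx, hx', if_false, List.cons.injEq] at h h' he
        obtain ⟨h1, h2⟩ := ih hr.2 hr'.2 h h' he.2
        exact ⟨h1, by rw [he.1, h2]⟩

/-- Reverse insertion is well defined. -/
theorem tableauInsert_injective {x x' : α} {T T' : List (List α)} (hT : GoodTab T)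
    (hT' : GoodTab T') (hs : tabShape T = tabShape T')
    (he : tableauInsert x T = tableauInsert x' T') : x = x' ∧ T = T' := by
  induction T generalizing x x' T' with
  | nil =>
    cases T' with
    | nil => simpa [tableauInsert] using he
    | cons r' T' =>
      exfalso
      have := DFunLike.congr_fun hs 0
      rw [tabShape_nil, tabShape_cons_zero] at this
      exact (hT' r' List.mem_cons_self).1 (List.length_eq_zero_iff.1 this.symm)
  | cons r T ih =>
    cases T' with
    | nil =>
      exfalso
      have := DFunLike.congr_fun hs 0
      rw [tabShape_nil, tabShape_cons_zero] at this
      exact (hT r List.mem_cons_self).1 (List.length_eq_zero_iff.1 this)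
    | cons r' T' =>
      have hT1 : GoodTab T := fun s hs => hT s (List.mem_cons_of_mem _ hs)
      have hT1' : GoodTab T' := fun s hs => hT' s (List.mem_cons_of_mem _ hs)
      have hr := (hT r List.mem_cons_self).2
      have hr' := (hT' r' List.mem_cons_self).2
      -- The first rows have equal lengths before and after, and a row grows exactly when nothing is
      -- bumped; so both insertions bump or neither does.
      have hlen : r.length = r'.length := by
        have := DFunLike.congr_fun hs 0
        rwa [tabShape_cons_zero, tabShape_cons_zero] at this
      have hs1 : tabShape T = tabShape T' := by
        ext i
        have := DFunLike.congr_fun hs (i + 1)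
        rwa [tabShape_cons_succ, tabShape_cons_succ] at this
      cases h : (rowInsert x r).2 with
      | none =>
        cases h' : (rowInsert x' r').2 with
        | none =>
          rw [tableauInsert_none h, tableauInsert_none h', rowInsert_eq_append h,
            rowInsert_eq_append h', List.cons.injEq] at he
          have := List.append_inj he.1 hlen
          simp only [List.cons.injEq, and_true] at this
          exact ⟨this.2, by rw [this.1, he.2]⟩
        | some y' =>
          exfalso
          rw [tableauInsert_none h, tableauInsert_some h', List.cons.injEq] at he
          have := congrArg List.length he.1
          rw [length_rowInsert_none h, length_rowInsert_some h'] at this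
          omega
      | some y =>
        cases h' : (rowInsert x' r').2 with
        | none =>
          exfalso
          rw [tableauInsert_some h, tableauInsert_none h', List.cons.injEq] at he
          have := congrArg List.length he.1
          rw [length_rowInsert_some h, length_rowInsert_none h'] at this
          omega
        | some y' =>
          rw [tableauInsert_some h, tableauInsert_some h', List.cons.injEq] at he
          obtain ⟨hy, hTT⟩ := ih hT1 hT1' hs1 he.2
          subst hy
          obtain ⟨h1, h2⟩ := rowInsert_injective hr hr' h h' he.1
          exact ⟨h1, by rw [h2, hTT]⟩

/-- The insertion tableau of a word read from right to left. -/
def revTab (l : List α) : List (List α) := l.foldr tableauInsert []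

theorem revTab_cons (x : α) (l : List α) : revTab (x :: l) = tableauInsert x (revTab l) := rfl

theorem insertionTableau_eq (l : List α) : insertionTableau l = revTab l.reverse := by
  rw [insertionTableau, revTab, List.foldr_reverse]

/-- The rows of the boxes created by the successive insertions, the last one first. -/
def revRec : List α → List ℕ
  | [] => []
  | x :: l => bumpRow x (revTab l) :: revRec l

/-- The row lengths of the shape obtained by adding boxes in the given rows. -/
noncomputable def endShape (r : List ℕ) : ℕ →₀ ℕ := (r.map box).sum

theorem endShape_nil : endShape [] = 0 := rfl

theorem endShape_cons (i : ℕ) (r : List ℕ) : endShape (i :: r) = endShape r + box i := by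
  simp [endShape, add_comm]

theorem endShape_append (r s : List ℕ) : endShape (r ++ s) = endShape r + endShape s := by
  simp [endShape]

theorem endShape_apply (r : List ℕ) (i : ℕ) : endShape r i = r.count i := by
  induction r with
  | nil => simp [endShape_nil]
  | cons j r ih =>
    by_cases h : j = i
    · subst h; rw [endShape_cons, add_box_self, ih, List.count_cons_self]
    · rw [endShape_cons, add_box_of_ne _ h, ih, List.count_cons_of_ne h]

theorem degree_endShape (r : List ℕ) : (endShape r).degree = r.length := by
  induction r with
  | nil => simp [endShape_nil]
  | cons i r ih => rw [endShape_cons, degree_add_box, ih, List.length_cons]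

theorem goodTab_revTab (l : List α) : GoodTab (revTab l) := by
  induction l with
  | nil => intro r hr; simp [revTab] at hr
  | cons x l ih => exact ih.tableauInsert x

theorem tabShape_revTab (l : List α) : tabShape (revTab l) = endShape (revRec l) := by
  induction l with
  | nil => exact tabShape_nil
  | cons x l ih => rw [revTab_cons, tabShape_tableauInsert, ih, revRec, endShape_cons]

theorem length_revRec (l : List α) : (revRec l).length = l.length := by
  induction l with
  | nil => rfl
  | cons x l ih => simp [revRec, ih]

/-- A word is determined by its insertion tableau and by its recording sequence. -/
theorem eq_of_revTab_eq {l l' : List α} (h : revTab l = revTab l') (hr : revRec l = revRec l') :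
    l = l' := by
  induction l generalizing l' with
  | nil =>
    cases l' with
    | nil => rfl
    | cons x' l' => simp [revRec] at hr
  | cons x l ih =>
    cases l' with
    | nil => simp [revRec] at hr
    | cons x' l' =>
      rw [revRec, revRec, List.cons.injEq] at hr
      obtain ⟨h1, h2⟩ := tableauInsert_injective (goodTab_revTab l) (goodTab_revTab l')
        (by rw [tabShape_revTab, tabShape_revTab, hr.2]) h
      rw [h1, ih h2 hr.2]

theorem isChain_revTab (l : List α) : List.IsChain Below (revTab l) := by
  have := isChain_insertionTableau l.reverse
  rwa [insertionTableau_eq, List.reverse_reverse] at this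

theorem below_getD {T : List (List α)} (h : List.IsChain Below T) (i : ℕ) :
    Below (T.getD i []) (T.getD (i + 1) []) := by
  induction T generalizing i with
  | nil => simpa using Below.nil _
  | cons r T ih =>
    cases T with
    | nil => simpa using Below.nil _
    | cons s T =>
      rw [List.isChain_cons_cons] at h
      cases i with
      | zero => simpa using h.1
      | succ i => simpa using ih h.2 i

theorem antitone_tabShape_revTab (l : List α) : Antitone (tabShape (revTab l)) :=
  antitone_nat_of_succ_le fun i => (below_getD (isChain_revTab l) i).length_le

end Insertion

end PieriGrowth

namespace PieriGrowth

/-! ### Yamanouchi words as codes of standard tableaux -/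

section Codes

open scoped Classical
open Finset

/-- Yamanouchi words: adding boxes in the given rows, starting from the last one, goes through
partitions only. -/
def IsYam : List ℕ → Prop
  | [] => True
  | i :: r => IsYam r ∧ Antitone (endShape (i :: r))

/-- The Yamanouchi words of length `n`. -/
noncomputable def yams : ℕ → Finset (List ℕ)
  | 0 => {[]}
  | n + 1 => ((yams n ×ˢ range (n + 1)).filter fun x => Antitone (endShape (x.2 :: x.1))).image
      fun x => x.2 :: x.1

theorem mem_yams {n : ℕ} {r : List ℕ} : r ∈ yams n ↔ r.length = n ∧ IsYam r := by
  induction n generalizing r with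
  | zero =>
    rw [yams, mem_singleton, List.length_eq_zero_iff]
    constructor
    · rintro rfl; exact ⟨rfl, trivial⟩
    · exact fun h => h.1
  | succ n ih =>
    rw [yams, mem_image]
    constructor
    · rintro ⟨⟨s, i⟩, hx, rfl⟩
      rw [mem_filter, mem_product, ih] at hx
      exact ⟨by simp [hx.1.1.1], hx.1.1.2, hx.2⟩
    · rintro ⟨hl, hy⟩
      cases r with
      | nil => simp at hl
      | cons i s =>
        refine ⟨(s, i), ?_, rfl⟩
        rw [mem_filter, mem_product, ih]
        refine ⟨⟨⟨by simpa using hl, hy.1⟩, ?_⟩, hy.2⟩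
        have := lt_degree_of_pos (i := i) hy.2 (by rw [endShape_cons, add_box_self]; omega)
        rw [degree_endShape, hl] at this
        exact mem_range.2 this

theorem sum_yams_succ (n : ℕ) (f : List ℕ → ℝ) :
    ∑ r ∈ yams (n + 1), f r = ∑ r ∈ yams n, ∑ i ∈ range (n + 1),
      if Antitone (endShape r + box i) then f (i :: r) else 0 := by
  rw [yams, sum_image, sum_filter, sum_product]
  · simp only [endShape_cons]
  · rintro ⟨r, i⟩ _ ⟨s, j⟩ _ h
    simp only [List.cons.injEq] at h
    simp [h.1, h.2]

/-- Yamanouchi words are growth histories of diagrams, that is, standard tableaux; both sides obey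
the same one-box recursion. -/
theorem sum_yams (n : ℕ) (φ : (ℕ →₀ ℕ) → ℝ) :
    ∑ r ∈ yams n, φ (endShape r) = ∑ p ∈ parts n, syt p * φ p := by
  induction n generalizing φ with
  | zero => simp [yams, parts_zero, syt_zero, endShape_nil]
  | succ n ih =>
    rw [sum_yams_succ, sum_syt_mul n (n + 1) le_rfl, ← ih]
    simp only [endShape_cons]

theorem endShape_mem_parts {n : ℕ} {r : List ℕ} (hr : r ∈ yams n) : endShape r ∈ parts n := by
  rw [mem_yams] at hr
  rw [mem_parts, degree_endShape]
  refine ⟨?_, hr.1⟩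
  cases r with
  | nil => rw [endShape_nil]; exact fun _ _ _ => le_rfl
  | cons i r => exact hr.2.2

theorem card_yams (p : ℕ →₀ ℕ) {n : ℕ} (hp : p ∈ parts n) :
    (#{r ∈ yams n | endShape r = p} : ℝ) = syt p := by
  have := sum_yams n fun q => if q = p then 1 else 0
  rw [sum_boole] at this
  rw [this]
  simp [hp]

variable {α : Type*} [LinearOrder α]

theorem isYam_revRec (l : List α) : IsYam (revRec l) := by
  induction l with
  | nil => trivial
  | cons x l ih =>
    refine ⟨ih, ?_⟩
    have := antitone_tabShape_revTab (x :: l)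
    rwa [tabShape_revTab] at this

theorem revRec_mem_yams (l : List α) : revRec l ∈ yams l.length :=
  mem_yams.2 ⟨length_revRec l, isYam_revRec l⟩

theorem flatten_tableauInsert (x : α) (T : List (List α)) :
    (tableauInsert x T).flatten.Perm (x :: T.flatten) := by
  induction T generalizing x with
  | nil => simp [tableauInsert]
  | cons r T ih =>
    have hp := rowInsert_perm x r
    cases h : (rowInsert x r).2 with
    | none =>
      rw [h] at hp
      rw [tableauInsert_none h, List.flatten_cons, List.flatten_cons]
      simpa using hp.append_right T.flatten
    | some y =>
      rw [h] at hp
      rw [tableauInsert_some h, List.flatten_cons, List.flatten_cons]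
      refine ((ih y).append_left _).trans ?_
      have := hp.append_right T.flatten
      simpa using this

theorem flatten_revTab (l : List α) : (revTab l).flatten.Perm l := by
  induction l with
  | nil => simp [revTab]
  | cons x l ih => exact (flatten_tableauInsert x _).trans (ih.cons x)

/-- The index of the row that contains `x`. -/
noncomputable def rowIdx (T : List (List α)) (x : α) : ℕ := T.findIdx fun r => x ∈ r

theorem rowIdx_eq_iff {T : List (List α)} (hT : T.flatten.Nodup) {x : α} (hx : x ∈ T.flatten)
    (i : ℕ) : rowIdx T x = i ↔ x ∈ T.getD i [] := by
  induction T generalizing i with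
  | nil => simp at hx
  | cons r T ih =>
    rw [List.flatten_cons, List.nodup_append] at hT
    rw [List.flatten_cons, List.mem_append] at hx
    by_cases hr : x ∈ r
    · have h0 : rowIdx (r :: T) x = 0 := by simp [rowIdx, List.findIdx_cons, hr]
      rw [h0]
      cases i with
      | zero => simpa using hr
      | succ i =>
        simp only [List.getD_cons_succ]
        constructor
        · intro h; omega
        · intro h
          exfalso
          have hi : i < T.length := by
            by_contra hc
            rw [List.getD_eq_default _ _ (not_lt.1 hc)] at h
            simp at h
          rw [List.getD_eq_getElem _ _ hi] at h
          exact hT.2.2 x hr x (List.mem_flatten.2 ⟨_, List.getElem_mem hi, h⟩) rfl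
    · have h0 : rowIdx (r :: T) x = rowIdx T x + 1 := by simp [rowIdx, List.findIdx_cons, hr]
      rw [h0]
      cases i with
      | zero => simpa using hr
      | succ i =>
        simp only [List.getD_cons_succ, Nat.add_right_cancel_iff]
        exact ih hT.2.1 (hx.resolve_left hr) i

theorem getD_subset_flatten {α : Type*} (T : List (List α)) (i : ℕ) {x : α} (h : x ∈ T.getD i []) :
    x ∈ T.flatten := by
  have hi : i < T.length := by
    by_contra hc
    rw [List.getD_eq_default _ _ (not_lt.1 hc)] at h
    simp at h
  rw [List.getD_eq_getElem _ _ hi] at h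
  exact List.mem_flatten.2 ⟨_, List.getElem_mem hi, h⟩

theorem nodup_getD {α : Type*} {T : List (List α)} (hT : T.flatten.Nodup) (i : ℕ) : (T.getD i []).Nodup := by
  by_cases hi : i < T.length
  · rw [List.getD_eq_getElem _ _ hi]
    exact (List.nodup_flatten.1 hT).1 _ (List.getElem_mem hi)
  · rw [List.getD_eq_default _ _ (not_lt.1 hi)]; simp

theorem count_map_rowIdx {T : List (List α)} (hT : T.flatten.Nodup) {L : List α} (hL : L.Nodup)
    (hLT : ∀ x ∈ L, x ∈ T.flatten) (i : ℕ) :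
    (L.map (rowIdx T)).count i = (T.getD i []).countP fun x => x ∈ L := by
  rw [List.count, List.countP_map, List.countP_eq_length_filter, List.countP_eq_length_filter]
  refine List.Perm.length_eq ((List.perm_ext_iff_of_nodup (hL.filter _)
    ((nodup_getD hT i).filter _)).2 fun x => ?_)
  simp only [List.mem_filter, Function.comp_apply, beq_iff_eq, decide_eq_true_eq]
  constructor
  · rintro ⟨h1, h2⟩; exact ⟨(rowIdx_eq_iff hT (hLT x h1) i).1 h2, h1⟩
  · rintro ⟨h1, h2⟩; exact ⟨h2, (rowIdx_eq_iff hT (hLT x h2) i).2 h1⟩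

theorem Below.countP_le {r s : List α} (h : Below r s) (p : α → Bool)
    (hp : ∀ a ∈ r, ∀ b ∈ s, a < b → p b → p a) : s.countP p ≤ r.countP p := by
  induction h with
  | nil r => simp
  | @cons a b r s hab h ih =>
    have := ih fun a ha b hb => hp a (List.mem_cons_of_mem _ ha) b (List.mem_cons_of_mem _ hb)
    have h2 := hp a List.mem_cons_self b List.mem_cons_self hab
    rw [List.countP_cons, List.countP_cons]
    split_ifs with h3 h4
    · omega
    · exact absurd (h2 h3) h4
    · omega
    · omega

/-- A suffix of the decreasing list of letters is a set of smallest letters, and by column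
strictness the cells of such a set form a Young diagram. So the list of rows of the letters encodes
the insertion tableau as a Yamanouchi word. -/
theorem isYam_map_rowIdx {T : List (List α)} (hT : T.flatten.Nodup) (hc : List.IsChain Below T)
    {S : List α} (hS : S.Pairwise (· > ·)) (hST : ∀ x, x ∈ S ↔ x ∈ T.flatten) {L : List α}
    (hL : L <:+ S) : IsYam (L.map (rowIdx T)) := by
  induction L with
  | nil => trivial
  | cons x L ih =>
    refine ⟨ih ((List.suffix_cons x L).trans hL), ?_⟩
    have hnd : (x :: L).Nodup := ((hS.sublist hL.sublist).imp fun h => ne_of_gt h)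
    obtain ⟨K, hK⟩ := hL
    have hdown : ∀ a ∈ T.flatten, ∀ b ∈ x :: L, a < b → a ∈ x :: L := by
      intro a ha b hb hab
      rw [← hST, ← hK, List.mem_append] at ha
      refine ha.resolve_left fun haK => ?_
      rw [← hK, List.pairwise_append] at hS
      exact (hS.2.2 a haK b hb).not_gt hab
    refine antitone_nat_of_succ_le fun i => ?_
    rw [← List.map_cons, endShape_apply, endShape_apply,
      count_map_rowIdx hT hnd (fun y hy => (hST y).1 (hK ▸ List.mem_append_right _ hy)),
      count_map_rowIdx hT hnd (fun y hy => (hST y).1 (hK ▸ List.mem_append_right _ hy))]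
    refine (below_getD hc i).countP_le _ fun a ha b hb hab hbL => ?_
    simp only [decide_eq_true_eq] at hbL ⊢
    exact hdown a (getD_subset_flatten T i ha) b hbL hab

theorem endShape_map_rowIdx {T : List (List α)} (hT : T.flatten.Nodup) {S : List α}
    (hS : S.Nodup) (hST : ∀ x, x ∈ S ↔ x ∈ T.flatten) :
    endShape (S.map (rowIdx T)) = tabShape T := by
  ext i
  rw [endShape_apply, count_map_rowIdx hT hS fun x hx => (hST x).1 hx, tabShape_apply,
    List.countP_eq_length]
  intro x hx
  simpa [hST] using getD_subset_flatten T i hx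

/-- The code fixes the set of letters of every row, and a sorted row is determined by its letters.
The absence of empty rows makes the numbers of rows agree. -/
theorem eq_of_map_rowIdx_eq {T T' : List (List α)} (hT : T.flatten.Nodup) (hT' : T'.flatten.Nodup)
    (hg : GoodTab T) (hg' : GoodTab T') {S : List α} (hST : ∀ x, x ∈ S ↔ x ∈ T.flatten)
    (hST' : ∀ x, x ∈ S ↔ x ∈ T'.flatten) (h : S.map (rowIdx T) = S.map (rowIdx T')) :
    T = T' := by
  have hrow : ∀ i, T.getD i [] = T'.getD i [] := by
    intro i
    have key : ∀ {T : List (List α)}, GoodTab T → (T.getD i []).Pairwise (· ≤ ·) := by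
      intro T hg
      by_cases hi : i < T.length
      · rw [List.getD_eq_getElem _ _ hi]; exact (hg _ (List.getElem_mem hi)).2
      · rw [List.getD_eq_default _ _ (not_lt.1 hi)]; simp
    refine List.Perm.eq_of_pairwise (le := (· ≤ ·)) (fun a b _ _ h1 h2 => le_antisymm h1 h2)
      (key hg) (key hg') ?_
    refine (List.perm_ext_iff_of_nodup (nodup_getD hT i) (nodup_getD hT' i)).2 fun x => ?_
    have aux : ∀ x ∈ S, rowIdx T x = rowIdx T' x := by
      intro x hx
      exact List.map_inj_left.1 h x hx
    constructor
    · intro hx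
      have h1 := getD_subset_flatten T i hx
      have h2 := (hST x).2 h1
      rw [← rowIdx_eq_iff hT' ((hST' x).1 h2), ← aux x h2, rowIdx_eq_iff hT h1]
      exact hx
    · intro hx
      have h1 := getD_subset_flatten T' i hx
      have h2 := (hST' x).2 h1
      rw [← rowIdx_eq_iff hT ((hST x).1 h2), aux x h2, rowIdx_eq_iff hT' h1]
      exact hx
  have hlen : ∀ {T T' : List (List α)}, GoodTab T → (∀ i, T.getD i [] = T'.getD i []) →
      T.length ≤ T'.length := by
    intro T T' hg h
    by_contra hc
    rw [not_le] at hc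
    have := h T'.length
    rw [List.getD_eq_default T' _ le_rfl, List.getD_eq_getElem _ _ hc] at this
    exact (hg _ (List.getElem_mem hc)).1 this
  have hl := le_antisymm (hlen hg hrow) (hlen hg' fun i => (hrow i).symm)
  refine List.ext_getElem hl fun i h1 h2 => ?_
  have := hrow i
  rwa [List.getD_eq_getElem _ _ h1, List.getD_eq_getElem _ _ h2] at this

end Codes

/-! ### The law of the recording sequence of a random permutation -/

section Law

open scoped Classical
open Finset

variable {α : Type*} [LinearOrder α] {ι : Type*} [Fintype ι] [DecidableEq ι]

theorem length_eq_card {e : List ι} (he : e.Nodup) (hu : ∀ i, i ∈ e) :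
    e.length = Fintype.card ι := by
  rw [← List.toFinset_card_of_nodup he, ← card_univ]
  congr 1
  ext i; simp [hu]

/-- For a fixed recording sequence a permutation is determined by its insertion tableau, hence by
the Yamanouchi word that encodes it, whose end shape is prescribed. -/
theorem card_revRec_le {e : List ι} (he : e.Nodup) (hu : ∀ i, i ∈ e) {a : ι → α}
    (ha : Function.Injective a) {r : List ℕ} (hr : r ∈ yams e.length) :
    (#{σ : Equiv.Perm ι | revRec (e.map (a ∘ σ)) = r} : ℝ) ≤ syt (endShape r) := by
  rw [← card_yams _ (endShape_mem_parts hr), Nat.cast_le]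
  set S : List α := (univ.image a).sort (· ≥ ·) with hS
  have hmem : ∀ x, x ∈ S ↔ ∃ i, a i = x := fun x => by simp [hS]
  have hSp : S.Pairwise (· > ·) := by
    have h1 : S.Pairwise (· ≥ ·) := Finset.pairwise_sort _ _
    have h2 : S.Nodup := Finset.sort_nodup _ _
    exact (h1.and h2).imp fun h => lt_of_le_of_ne h.1 h.2.symm
  have hSn : S.Nodup := Finset.sort_nodup _ _
  have hfl : ∀ σ : Equiv.Perm ι, (revTab (e.map (a ∘ σ))).flatten.Nodup := fun σ =>
    (flatten_revTab _).nodup_iff.2 (he.map (ha.comp σ.injective))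
  have hfm : ∀ (σ : Equiv.Perm ι) x, x ∈ S ↔ x ∈ (revTab (e.map (a ∘ σ))).flatten := by
    intro σ x
    rw [(flatten_revTab _).mem_iff, hmem, List.mem_map]
    constructor
    · rintro ⟨i, rfl⟩; exact ⟨σ.symm i, hu _, by simp⟩
    · rintro ⟨i, _, rfl⟩; exact ⟨σ i, rfl⟩
  have hlen : S.length = e.length := by
    rw [hS, Finset.length_sort, card_image_of_injective _ ha, card_univ, length_eq_card he hu]
  refine card_le_card_of_injOn (fun σ => S.map (rowIdx (revTab (e.map (a ∘ σ))))) ?_ ?_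
  · intro σ hσ
    simp only [coe_filter, mem_univ, true_and, Set.mem_ofPred_eq] at hσ ⊢
    refine ⟨mem_yams.2 ⟨by simpa using hlen, ?_⟩, ?_⟩
    · exact isYam_map_rowIdx (hfl σ) (isChain_revTab _) hSp (hfm σ) List.suffix_rfl
    · rw [endShape_map_rowIdx (hfl σ) hSn (hfm σ), tabShape_revTab, hσ]
  · intro σ hσ τ hτ h
    simp only [coe_filter, mem_univ, true_and, Set.mem_ofPred_eq] at hσ hτ
    have h1 := eq_of_map_rowIdx_eq (hfl σ) (hfl τ) (goodTab_revTab _) (goodTab_revTab _)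
      (hfm σ) (hfm τ) h
    have h2 := eq_of_revTab_eq h1 (hσ.trans hτ.symm)
    ext i
    exact ha (List.map_inj_left.1 h2 i (hu i))

/-- Surjectivity by counting: the upper bounds add up to the sum of `syt ^ 2`, which is the number
of permutations, so each of them is attained. -/
theorem card_revRec {e : List ι} (he : e.Nodup) (hu : ∀ i, i ∈ e) {a : ι → α}
    (ha : Function.Injective a) {r : List ℕ} (hr : r ∈ yams e.length) :
    (#{σ : Equiv.Perm ι | revRec (e.map (a ∘ σ)) = r} : ℝ) = syt (endShape r) := by
  have hle := fun r hr => card_revRec_le he hu ha (r := r) hr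
  refine (sum_eq_sum_iff_of_le hle).1 ?_ r hr
  rw [sum_yams e.length syt]
  have : ∑ p ∈ parts e.length, syt p * syt p = e.length.factorial := by
    rw [← sum_syt_sq]; exact sum_congr rfl fun p _ => (sq _).symm
  rw [this, ← Nat.cast_sum, ← card_eq_sum_card_fiberwise (s := univ)]
  · rw [card_univ, Fintype.card_perm, length_eq_card he hu]
  · intro σ _
    have := revRec_mem_yams (e.map (a ∘ σ))
    rwa [List.length_map] at this

/-- The joint law of the recording sequence of a random permutation. -/
theorem sum_revRec {e : List ι} (he : e.Nodup) (hu : ∀ i, i ∈ e) {a : ι → α}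
    (ha : Function.Injective a) (φ : List ℕ → ℝ) :
    ∑ σ : Equiv.Perm ι, φ (revRec (e.map (a ∘ σ)))
      = ∑ r ∈ yams e.length, syt (endShape r) * φ r := by
  have hm : ∀ σ ∈ (univ : Finset (Equiv.Perm ι)),
      revRec (e.map (a ∘ σ)) ∈ yams e.length := fun σ _ => by
    have := revRec_mem_yams (e.map (a ∘ σ))
    rwa [List.length_map] at this
  rw [← sum_fiberwise_of_maps_to hm]
  refine sum_congr rfl fun r hr => ?_
  rw [← card_revRec he hu ha hr, ← nsmul_eq_mul, ← sum_const]
  refine sum_congr rfl fun σ hσ => ?_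
  rw [(mem_filter.1 hσ).2]

end Law

end PieriGrowth

namespace PieriGrowth

/-! ### Words with a sorted tail -/

section SortedTail

open scoped Classical
open Finset BigOperators

variable {α : Type*} [LinearOrder α]

/-- The list runs backwards in time, so the rows weakly decrease as boxes are added. When a box
enters row `j + 1`, row `j` has not received any box yet, so its old length still bounds row `j +
1`. -/
theorem hor_of_isYam_append {t r : List ℕ} (ht : t.Pairwise (· ≤ ·)) (hy : IsYam (t ++ r)) :
    Hor (endShape r) (endShape (t ++ r)) := by
  induction t with
  | nil =>
    refine hor_self ?_
    exact (mem_parts.1 (endShape_mem_parts (mem_yams.2 ⟨rfl, hy⟩))).1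
  | cons i t ih =>
    rw [List.pairwise_cons] at ht
    have h := ih ht.2 hy.1
    have ha : Antitone (endShape (i :: (t ++ r))) := hy.2
    intro j
    simp only [List.cons_append, endShape_cons] at ha ⊢
    refine ⟨(h j).1.trans (by simp), ?_⟩
    by_cases hj : i = j + 1
    · subst hj
      refine (ha (Nat.le_succ j)).trans ?_
      rw [add_box_of_ne _ (by omega), endShape_append, Finsupp.add_apply, endShape_apply t,
        List.count_eq_zero_of_not_mem fun hm => by have := ht.1 _ hm; omega]
      simp
    · rw [add_box_of_ne _ hj]; exact (h j).2

theorem revRec_append (t p : List α) : ∃ s, revRec (t ++ p) = s ++ revRec p ∧ s.length = t.length ∧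
    (t.Pairwise (· ≥ ·) → s.Pairwise (· ≤ ·)) := by
  induction t with
  | nil => exact ⟨[], rfl, rfl, fun _ => List.Pairwise.nil⟩
  | cons z t ih =>
    obtain ⟨s, h1, h2, h3⟩ := ih
    refine ⟨bumpRow z (revTab (t ++ p)) :: s, by rw [List.cons_append, revRec, h1]; rfl,
      by simp [h2], fun h => ?_⟩
    rw [List.pairwise_cons] at h
    have hs := h3 h.2
    rw [List.pairwise_cons]
    refine ⟨?_, hs⟩
    cases t with
    | nil =>
      rw [List.length_nil, List.length_eq_zero_iff] at h2
      simp [h2]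
    | cons x t =>
      cases s with
      | nil => simp
      | cons i s =>
        rw [List.cons_append, revRec, List.cons_append, List.cons.injEq] at h1
        have hb := (bumpRow_asc (h.1 x List.mem_cons_self) (goodTab_revTab (t ++ p))).1
        rw [h1.1] at hb
        rw [List.pairwise_cons] at hs
        intro b hbm
        rcases List.mem_cons.1 hbm with rfl | hbm
        · exact hb
        · exact hb.trans (hs.1 b hbm)

variable {ι : Type*} [Fintype ι] [DecidableEq ι]

/-- A word without repeated letters has exactly one decreasing rearrangement. -/
theorem card_perm_sorted {e : List ι} (he : e.Nodup) (hu : ∀ i, i ∈ e) {a : ι → α}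
    (ha : Function.Injective a) :
    #{σ : Equiv.Perm ι | (e.map (a ∘ σ)).Pairwise (· ≥ ·)} = 1 := by
  rw [card_eq_one]
  have hinj : Function.Injective fun σ : Equiv.Perm ι =>
      (⟨e.map (a ∘ σ), by
        rw [List.mem_toFinset, List.mem_permutations]
        have : e.map (a ∘ σ) = (e.map σ).map a := by rw [List.map_map]
        rw [this]
        refine List.Perm.map a ((List.perm_ext_iff_of_nodup (he.map σ.injective) he).2 fun i => ?_)
        simp only [List.mem_map, hu, true_and, iff_true]
        exact ⟨σ.symm i, by simp⟩⟩ : {L // L ∈ (e.map a).permutations.toFinset}) := by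
    intro σ τ h
    have h2 : e.map (a ∘ σ) = e.map (a ∘ τ) := by simpa using h
    ext i
    exact ha (List.map_inj_left.1 h2 i (hu i))
  -- An injection between sets of equal cardinality: every rearrangement of the word comes from a
  -- permutation, in particular the sorted one.
  have hbij := (Fintype.bijective_iff_injective_and_card _).2 ⟨hinj, by
    rw [Fintype.card_perm, Fintype.card_coe, List.toFinset_card_of_nodup
      ((List.nodup_permutations _ (he.map ha))), List.length_permutations, List.length_map,
      length_eq_card he hu]⟩
  set S := (e.map a).mergeSort (fun x y => decide (x ≥ y)) with hS
  have hSs : S.Pairwise (· ≥ ·) := by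
    have := List.pairwise_mergeSort (le := fun x y : α => decide (x ≥ y))
      (fun a b c h1 h2 => by simp only [decide_eq_true_eq] at *; exact h2.trans h1)
      (fun a b => by simp only [Bool.or_eq_true, decide_eq_true_eq]; exact le_total b a) (e.map a)
    exact this.imp fun h => by simpa using h
  obtain ⟨σ, hσ⟩ := hbij.2 ⟨S, by
    rw [List.mem_toFinset, List.mem_permutations]; exact List.mergeSort_perm _ _⟩
  have hσ' : e.map (a ∘ σ) = S := by simpa using congrArg Subtype.val hσ
  refine ⟨σ, ?_⟩
  ext τ
  simp only [mem_filter, mem_univ, true_and, mem_singleton]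
  constructor
  · intro h
    have h1 := (hbij.1.eq_iff (a := τ) (b := σ)).1 ?_
    · exact h1
    · apply Subtype.ext
      change e.map (a ∘ τ) = e.map (a ∘ σ)
      rw [hσ']
      refine List.Perm.eq_of_pairwise (le := (· ≥ ·)) (fun a b _ _ h1 h2 => le_antisymm h2 h1)
        h hSs ?_
      refine List.Perm.trans ?_ (List.mergeSort_perm _ _).symm
      have : e.map (a ∘ τ) = (e.map τ).map a := by rw [List.map_map]
      rw [this]
      refine List.Perm.map a ((List.perm_ext_iff_of_nodup (he.map τ.injective) he).2 fun i => ?_)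
      simp only [List.mem_map, hu, true_and, iff_true]
      exact ⟨τ.symm i, by simp⟩
  · rintro rfl; rw [hσ']; exact hSs

/-- Right translation preserves the uniform law on permutations. The inner average amounts to
conditioning on everything except the order of the letters at the places in `p`. -/
theorem expect_perm_subtype (p : ι → Prop) [DecidablePred p]
    [Fintype {i // p i}] (Φ : Equiv.Perm ι → ℝ) :
    𝔼 σ, Φ σ = 𝔼 σ, 𝔼 τ : Equiv.Perm {i // p i}, Φ (σ * Equiv.Perm.ofSubtype τ) := by
  rw [expect_comm]
  have : ∀ τ : Equiv.Perm {i // p i}, 𝔼 σ, Φ (σ * Equiv.Perm.ofSubtype τ) = 𝔼 σ, Φ σ := fun τ =>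
    Fintype.expect_equiv (Equiv.mulRight (Equiv.Perm.ofSubtype τ)) _ _ fun σ => rfl
  simp [this]

theorem map_attach_ofSubtype {α ι : Type*} [DecidableEq ι] (e : List ι) (v : ι → α) (τ : Equiv.Perm {i // i ∈ e}) :
    e.map (v ∘ Equiv.Perm.ofSubtype τ) = e.attach.map ((fun i => v i.1) ∘ τ) := by
  generalize hπ : Equiv.Perm.ofSubtype τ = π
  conv_lhs => rw [← List.attach_map_subtype_val e, List.map_map]
  refine List.map_congr_left fun i _ => ?_
  simp [← hπ, Equiv.Perm.ofSubtype_apply_coe]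

/-- Reduces statements about a word on some of the places to words that use all places: given the
letters elsewhere, the subword is a uniform arrangement of its own letters. -/
theorem expect_subword {α : Type*} {e : List ι} {a : ι → α} (ha : Function.Injective a) (F : List α → ℝ)
    {K : ℝ} (h : ∀ b : {i // i ∈ e} → α, Function.Injective b →
      𝔼 τ : Equiv.Perm {i // i ∈ e}, F (e.attach.map (b ∘ τ)) = K) :
    𝔼 σ : Equiv.Perm ι, F (e.map (a ∘ σ)) = K := by
  rw [expect_perm_subtype fun i => i ∈ e]
  have : ∀ (σ : Equiv.Perm ι) (τ : Equiv.Perm {i // i ∈ e}),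
      F (e.map (a ∘ (σ * Equiv.Perm.ofSubtype τ : Equiv.Perm ι)))
        = F (e.attach.map ((fun i => (a ∘ σ) i.1) ∘ τ)) := fun σ τ => by
    rw [← map_attach_ofSubtype]; rfl
  have h2 : ∀ σ : Equiv.Perm ι, 𝔼 τ : Equiv.Perm {i // i ∈ e},
      F (e.map (a ∘ (σ * Equiv.Perm.ofSubtype τ : Equiv.Perm ι))) = K := fun σ => by
    simp only [this]
    exact h _ ((ha.comp σ.injective).comp Subtype.val_injective)
  simp only [h2]
  exact expect_const univ_nonempty K

/-- Of the `t.length!` arrangements of the letters on `t` exactly one is sorted, and `Φ` does not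
see the arrangement. -/
theorem expect_sorted {t : List ι} (ht : t.Nodup) {a : ι → α} (ha : Function.Injective a)
    (Φ : Equiv.Perm ι → ℝ)
    (hΦ : ∀ σ (τ : Equiv.Perm {i // i ∈ t}), Φ (σ * Equiv.Perm.ofSubtype τ) = Φ σ) :
    𝔼 σ : Equiv.Perm ι, (if (t.map (a ∘ σ)).Pairwise (· ≥ ·) then Φ σ else 0)
      = (𝔼 σ, Φ σ) / t.length.factorial := by
  rw [expect_perm_subtype fun i => i ∈ t, expect_div]
  refine expect_congr rfl fun σ _ => ?_
  have h1 : ∀ τ : Equiv.Perm {i // i ∈ t},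
      (if (t.map (a ∘ (σ * Equiv.Perm.ofSubtype τ : Equiv.Perm ι))).Pairwise (· ≥ ·)
        then Φ (σ * Equiv.Perm.ofSubtype τ) else 0)
      = Φ σ * if (t.attach.map ((fun i => (a ∘ σ) i.1) ∘ τ)).Pairwise (· ≥ ·) then 1 else 0 :=
    fun τ => by
      rw [hΦ, ← map_attach_ofSubtype, mul_ite, mul_one, mul_zero]; rfl
  simp only [h1]
  have h2 := card_perm_sorted (List.nodup_attach.2 ht) (fun i => List.mem_attach t i)
    (a := fun i => (a ∘ σ) i.1) ((ha.comp σ.injective).comp Subtype.val_injective)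
  rw [← mul_expect, Fintype.expect_eq_sum_div_card, sum_boole, h2, Fintype.card_perm,
    ← length_eq_card (List.nodup_attach.2 ht) (fun i => List.mem_attach t i), List.length_attach]
  simp [div_eq_mul_inv]

end SortedTail

/-! ### The joint law of the two shapes -/

section PieriLaw

open scoped Classical
open Finset BigOperators

variable {α : Type*} [LinearOrder α]

theorem endShape_injOn_sorted {s s' : List ℕ} (h : s.Pairwise (· ≤ ·)) (h' : s'.Pairwise (· ≤ ·))
    (he : endShape s = endShape s') : s = s' := by
  refine List.Perm.eq_of_pairwise (le := (· ≤ ·)) (fun a b _ _ h1 h2 => le_antisymm h1 h2) h h' ?_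
  rw [List.perm_iff_count]
  intro i
  rw [← endShape_apply, ← endShape_apply, he]

variable {ι : Type*} [Fintype ι] [DecidableEq ι]

/-- The recording sequence of `p` is one of `syt lam` words. The rows of the other boxes are sorted
and their numbers are given by `gam - lam`, so they are determined; the full recording sequence then
belongs to `syt gam` permutations. -/
theorem card_pieri_le {t p : List ι} (he : (t ++ p).Nodup) (hu : ∀ i, i ∈ t ++ p) {a : ι → α}
    (ha : Function.Injective a) {lam gam : ℕ →₀ ℕ} (hl : lam ∈ parts p.length) :
    (#{σ : Equiv.Perm ι | (t.map (a ∘ σ)).Pairwise (· ≥ ·) ∧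
        tabShape (revTab (p.map (a ∘ σ))) = lam ∧
        tabShape (revTab ((t ++ p).map (a ∘ σ))) = gam} : ℝ)
      ≤ if Hor lam gam then syt lam * syt gam else 0 := by
  set S : Finset (Equiv.Perm ι) := {σ : Equiv.Perm ι | (t.map (a ∘ σ)).Pairwise (· ≥ ·) ∧
        tabShape (revTab (p.map (a ∘ σ))) = lam ∧
        tabShape (revTab ((t ++ p).map (a ∘ σ))) = gam} with hS
  have key : ∀ σ ∈ S, ∃ s, revRec ((t ++ p).map (a ∘ σ)) = s ++ revRec (p.map (a ∘ σ)) ∧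
      s.Pairwise (· ≤ ·) ∧ endShape s + lam = gam ∧ endShape (revRec (p.map (a ∘ σ))) = lam := by
    intro σ hσ
    simp only [hS, mem_filter, mem_univ, true_and] at hσ
    obtain ⟨h1, h2, h3⟩ := hσ
    obtain ⟨s, h4, -, h5⟩ := revRec_append (t.map (a ∘ σ)) (p.map (a ∘ σ))
    rw [← List.map_append] at h4
    refine ⟨s, h4, h5 h1, ?_, ?_⟩
    · rw [tabShape_revTab] at h2 h3
      rw [← h3, h4, endShape_append, h2]
    · rw [← h2, tabShape_revTab]
  split_ifs with hH
  · have hm : ∀ σ ∈ S, revRec (p.map (a ∘ σ)) ∈ {r ∈ yams p.length | endShape r = lam} := by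
      intro σ hσ
      obtain ⟨s, -, -, -, h⟩ := key σ hσ
      rw [mem_filter]
      refine ⟨?_, h⟩
      have := revRec_mem_yams (p.map (a ∘ σ))
      rwa [List.length_map] at this
    rw [card_eq_sum_card_fiberwise hm, Nat.cast_sum, ← card_yams lam hl, ← nsmul_eq_mul]
    refine sum_le_card_nsmul _ _ _ fun r hr => ?_
    rcases (S.filter fun σ : Equiv.Perm ι => revRec (p.map (a ∘ σ)) = r).eq_empty_or_nonempty with h0 | ⟨σ₀, h0⟩
    · rw [h0]; simpa using syt_nonneg gam
    · rw [mem_filter] at h0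
      obtain ⟨s₀, h1, h2, h3, h4⟩ := key σ₀ h0.1
      have hr0 := revRec_mem_yams ((t ++ p).map (a ∘ σ₀))
      rw [List.length_map] at hr0
      have hg : endShape (revRec ((t ++ p).map (a ∘ σ₀))) = gam := by
        rw [h1, endShape_append, h4, h3]
      rw [← hg, ← card_revRec he hu ha hr0, Nat.cast_le]
      refine card_le_card fun σ hσ => ?_
      rw [mem_filter] at hσ
      obtain ⟨s, g1, g2, g3, g4⟩ := key σ hσ.1
      rw [mem_filter]
      refine ⟨mem_univ _, ?_⟩
      have : s = s₀ := endShape_injOn_sorted g2 h2 (add_right_cancel (g3.trans h3.symm))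
      rw [g1, h1, hσ.2, h0.2, this]
  · rw [← Nat.cast_zero, Nat.cast_le, Nat.le_zero, card_eq_zero]
    refine eq_empty_of_forall_notMem fun σ hσ => hH ?_
    obtain ⟨s, g1, g2, g3, g4⟩ := key σ hσ
    have hy := isYam_revRec ((t ++ p).map (a ∘ σ))
    rw [g1] at hy
    have := hor_of_isYam_append g2 hy
    rwa [endShape_append, g4, g3] at this

theorem sum_pieri_weights (n k : ℕ) :
    ∑ lam ∈ parts n, ∑ gam ∈ parts (n + k), (if Hor lam gam then syt lam * syt gam else 0)
      = ((n + k).factorial : ℝ) / k.factorial := by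
  have h1 : ∀ lam ∈ parts n, ∑ gam ∈ parts (n + k),
      (if Hor lam gam then syt lam * syt gam else 0) = (n + k).choose k * syt lam ^ 2 := by
    intro lam hl
    have := stripSum_one n k hl
    rw [stripSum] at this
    rw [sq, ← mul_assoc, ← this, sum_mul]
    refine sum_congr rfl fun gam _ => ?_
    have hc : ∀ p, contentSum (fun _ => (0 : ℝ)) p = 0 := fun p => by simp [contentSum]
    split_ifs <;> simp [hc, mul_comm]
  rw [sum_congr rfl h1, ← mul_sum, sum_syt_sq, eq_div_iff (by positivity)]
  have := Nat.add_choose_mul_factorial_mul_factorial n k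
  exact_mod_cast this

theorem card_sorted {t : List ι} (ht : t.Nodup) {a : ι → α} (ha : Function.Injective a) :
    (#{σ : Equiv.Perm ι | (t.map (a ∘ σ)).Pairwise (· ≥ ·)} : ℝ)
      = (Fintype.card ι).factorial / t.length.factorial := by
  have := expect_sorted ht ha (fun _ => 1) fun _ _ => rfl
  rw [Fintype.expect_eq_sum_div_card, sum_boole, Fintype.card_perm, expect_const univ_nonempty,
    div_eq_div_iff (by positivity) (by positivity)] at this
  rw [eq_div_iff (by positivity), this, one_mul]

/-- Counting again: the bounds add up to `(n + k)! / k!`, the number of permutations with a sorted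
tail. -/
theorem card_pieri {t p : List ι} (he : (t ++ p).Nodup) (hu : ∀ i, i ∈ t ++ p) {a : ι → α}
    (ha : Function.Injective a) {lam gam : ℕ →₀ ℕ} (hl : lam ∈ parts p.length)
    (hg : gam ∈ parts (p.length + t.length)) :
    (#{σ : Equiv.Perm ι | (t.map (a ∘ σ)).Pairwise (· ≥ ·) ∧
        tabShape (revTab (p.map (a ∘ σ))) = lam ∧
        tabShape (revTab ((t ++ p).map (a ∘ σ))) = gam} : ℝ)
      = if Hor lam gam then syt lam * syt gam else 0 := by
  have hle := fun (x : (ℕ →₀ ℕ) × (ℕ →₀ ℕ))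
    (hx : x ∈ parts p.length ×ˢ parts (p.length + t.length)) =>
    card_pieri_le he hu ha (gam := x.2) (mem_product.1 hx).1
  refine (sum_eq_sum_iff_of_le hle).1 ?_ (lam, gam) (mem_product.2 ⟨hl, hg⟩)
  rw [sum_product' (f := fun x y => if Hor x y then syt x * syt y else 0), sum_pieri_weights,
    ← Nat.cast_sum]
  have h1 := card_sorted (List.nodup_append.1 he).1 ha
  rw [← length_eq_card he hu, List.length_append, add_comm t.length] at h1
  rw [← h1, card_eq_sum_card_fiberwise
    (f := fun σ : Equiv.Perm ι => (tabShape (revTab (p.map (a ∘ σ))),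
      tabShape (revTab ((t ++ p).map (a ∘ σ)))))
    (t := parts p.length ×ˢ parts (p.length + t.length))]
  · congr 1
    refine sum_congr rfl fun x _ => ?_
    congr 1
    ext σ
    simp [Prod.ext_iff]
  · intro σ _
    have h1 := endShape_mem_parts (revRec_mem_yams (p.map (a ∘ σ)))
    have h2 := endShape_mem_parts (revRec_mem_yams ((t ++ p).map (a ∘ σ)))
    rw [← tabShape_revTab, List.length_map] at h1 h2
    rw [List.length_append, add_comm] at h2
    exact mem_coe.2 (mem_product.2 ⟨h1, h2⟩)

theorem expect_pieri_of_complete {t p : List ι} (he : (t ++ p).Nodup) (hu : ∀ i, i ∈ t ++ p)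
    {a : ι → α} (ha : Function.Injective a) (g : ℤ → ℝ) :
    𝔼 σ : Equiv.Perm ι, (if (t.map (a ∘ σ)).Pairwise (· ≥ ·) then
      contentSum g (tabShape (revTab ((t ++ p).map (a ∘ σ))))
        - contentSum g (tabShape (revTab (p.map (a ∘ σ)))) else 0)
      = pieriE g p.length t.length / t.length.factorial := by
  have hm : ∀ σ ∈ ({σ : Equiv.Perm ι | (t.map (a ∘ σ)).Pairwise (· ≥ ·)} : Finset _),
      (tabShape (revTab (p.map (a ∘ σ))), tabShape (revTab ((t ++ p).map (a ∘ σ))))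
        ∈ parts p.length ×ˢ parts (p.length + t.length) := by
    intro σ _
    have h1 := endShape_mem_parts (revRec_mem_yams (p.map (a ∘ σ)))
    have h2 := endShape_mem_parts (revRec_mem_yams ((t ++ p).map (a ∘ σ)))
    rw [← tabShape_revTab, List.length_map] at h1 h2
    rw [List.length_append, add_comm] at h2
    exact mem_product.2 ⟨h1, h2⟩
  have hcard : Fintype.card ι = p.length + t.length := by
    rw [← length_eq_card he hu, List.length_append, add_comm]
  rw [Fintype.expect_eq_sum_div_card, ← sum_filter, ← sum_fiberwise_of_maps_to hm, sum_product,
    Fintype.card_perm, hcard, pieriE, pieriSum]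
  have : ∀ lam ∈ parts p.length, ∀ gam ∈ parts (p.length + t.length),
      (∑ σ ∈ ({σ : Equiv.Perm ι | (t.map (a ∘ σ)).Pairwise (· ≥ ·)} : Finset _).filter
        (fun σ : Equiv.Perm ι => (tabShape (revTab (p.map (a ∘ σ))),
          tabShape (revTab ((t ++ p).map (a ∘ σ)))) = (lam, gam)),
        (contentSum g (tabShape (revTab ((t ++ p).map (a ∘ σ))))
          - contentSum g (tabShape (revTab (p.map (a ∘ σ))))))
      = syt lam * (syt gam * if Hor lam gam then 0 + contentSum g gam - contentSum g lam else 0) := by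
    intro lam hl gam hg
    have h1 := card_pieri he hu ha hl hg
    have h2 : ∀ σ ∈ ({σ : Equiv.Perm ι | (t.map (a ∘ σ)).Pairwise (· ≥ ·)} : Finset _).filter
        (fun σ : Equiv.Perm ι => (tabShape (revTab (p.map (a ∘ σ))), tabShape (revTab ((t ++ p).map (a ∘ σ))))
          = (lam, gam)), contentSum g (tabShape (revTab ((t ++ p).map (a ∘ σ))))
          - contentSum g (tabShape (revTab (p.map (a ∘ σ)))) = contentSum g gam - contentSum g lam := by
      intro σ hσ
      have := (mem_filter.1 hσ).2
      rw [Prod.mk.injEq] at this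
      rw [this.1, this.2]
    rw [sum_congr rfl h2, sum_const, filter_filter, nsmul_eq_mul]
    simp only [Prod.mk.injEq]
    rw [h1]
    split_ifs <;> ring
  rw [sum_congr rfl fun lam hl => sum_congr rfl fun gam hg => this lam hl gam hg]
  simp only [stripSum, mul_sum]
  rw [sum_div, sum_div]
  refine sum_congr rfl fun lam _ => ?_
  rw [sum_div, sum_div]
  refine sum_congr rfl fun gam _ => ?_
  field_simp

/-- The expected content sum of the Pieri growth of a random word. -/
theorem expect_pieri {t p : List ι} (he : (t ++ p).Nodup) {a : ι → α} (ha : Function.Injective a)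
    (g : ℤ → ℝ) :
    𝔼 σ : Equiv.Perm ι, (if (t.map (a ∘ σ)).Pairwise (· ≥ ·) then
      contentSum g (tabShape (revTab ((t ++ p).map (a ∘ σ))))
        - contentSum g (tabShape (revTab (p.map (a ∘ σ)))) else 0)
      = pieriE g p.length t.length / t.length.factorial := by
  have := expect_subword (e := t ++ p) ha (fun l =>
    if (l.take t.length).Pairwise (· ≥ ·) then contentSum g (tabShape (revTab l))
        - contentSum g (tabShape (revTab (l.drop t.length))) else 0)
    (K := pieriE g p.length t.length / t.length.factorial) ?_
  · rw [← this]
    refine expect_congr rfl fun σ _ => ?_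
    rw [List.map_append, List.take_left' (by simp), List.drop_left' (by simp)]
  · intro b hb
    have h1 : (t ++ p).attach.take t.length ++ (t ++ p).attach.drop t.length = (t ++ p).attach :=
      List.take_append_drop _ _
    have h2 := expect_pieri_of_complete (t := (t ++ p).attach.take t.length)
      (p := (t ++ p).attach.drop t.length) (by rw [h1]; exact List.nodup_attach.2 he)
      (by rw [h1]; exact fun i => List.mem_attach _ i) hb g
    rw [h1] at h2
    have h3 : ((t ++ p).attach.take t.length).length = t.length := by simp
    have h4 : ((t ++ p).attach.drop t.length).length = p.length := by simp
    rw [h3, h4] at h2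
    rw [← h2]
    refine expect_congr rfl fun σ _ => ?_
    rw [List.map_take, List.map_drop]

/-- The joint law of the recording sequence of a random word. -/
theorem expect_revRec {e : List ι} (he : e.Nodup) {a : ι → α} (ha : Function.Injective a)
    (φ : List ℕ → ℝ) :
    𝔼 σ : Equiv.Perm ι, φ (revRec (e.map (a ∘ σ)))
      = (∑ r ∈ yams e.length, syt (endShape r) * φ r) / e.length.factorial := by
  refine expect_subword ha (fun l => φ (revRec l)) fun b hb => ?_
  have h := sum_revRec (List.nodup_attach.2 he) (fun i => List.mem_attach e i) hb φ
  rw [Fintype.expect_eq_sum_div_card, h, Fintype.card_perm,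
    ← length_eq_card (List.nodup_attach.2 he) (fun i => List.mem_attach e i), List.length_attach]

end PieriLaw

end PieriGrowth

namespace PieriGrowth

/-! ### Contents of new boxes: joint and separate insertions -/

section Contents

open scoped Classical
open Finset BigOperators

variable {α : Type*} [LinearOrder α]

/-- The content of the box created by the insertion of `x` after the word `l`
(read from right to left). -/
noncomputable def newContent (x : α) (l : List α) : ℤ :=
  (tabShape (revTab l) (bumpRow x (revTab l)) : ℤ) - bumpRow x (revTab l)

/-- The content of the last box of a recording sequence. -/
noncomputable def headContent : List ℕ → ℤ
  | [] => 0
  | i :: r => (endShape r i : ℤ) - i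

theorem newContent_eq (x : α) (l : List α) : newContent x l = headContent (revRec (x :: l)) := by
  rw [newContent, revRec, headContent, tabShape_revTab]

theorem contentSum_revTab_cons (g : ℤ → ℝ) (x : α) (l : List α) :
    contentSum g (tabShape (revTab (x :: l)))
      = contentSum g (tabShape (revTab l)) + g (newContent x l) := by
  rw [revTab_cons, tabShape_tableauInsert, contentSum_add_box, newContent]

/-- The row bumping lemma in terms of contents: since row lengths weakly decrease, the end of a
higher row has a larger content. If both boxes fall into the same row, the first has just lengthened
it. -/
theorem newContent_asc {x z : α} (h : x ≤ z) (l : List α) :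
    newContent z l ≤ newContent z (x :: l) ∧
      (newContent z l = newContent x l ∨ newContent z l = newContent z (x :: l)) := by
  obtain ⟨h1, h2⟩ := bumpRow_asc h (goodTab_revTab l)
  have ha := antitone_tabShape_revTab l
  simp only [newContent, revTab_cons, tabShape_tableauInsert]
  by_cases he : bumpRow x (revTab l) = bumpRow z (tableauInsert x (revTab l))
  · rw [← he, add_box_self]
    have h3 : bumpRow z (revTab l) = bumpRow x (revTab l) := by
      rcases h2 with h2 | h2
      · exact h2
      · rw [h2, he]
    rw [h3]
    exact ⟨by push_cast; omega, Or.inl rfl⟩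
  · rw [add_box_of_ne _ he]
    rcases h2 with h2 | h2
    · rw [h2]
      have := ha h1
      exact ⟨by omega, Or.inl rfl⟩
    · rw [h2]; exact ⟨le_rfl, Or.inr rfl⟩

theorem newContent_desc {x z : α} (h : z < x) (l : List α) :
    newContent z (x :: l) ≤ newContent z l ∧
      (newContent z l = newContent x l ∨ newContent z l = newContent z (x :: l)) := by
  obtain ⟨h1, h2⟩ := bumpRow_desc h (revTab l)
  have ha := antitone_tabShape_revTab l
  simp only [newContent, revTab_cons, tabShape_tableauInsert]
  rw [add_box_of_ne _ (by omega)]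
  rcases h2 with h2 | h2
  · rw [h2]
    have := ha h1.le
    exact ⟨by omega, Or.inl rfl⟩
  · rw [h2]; exact ⟨le_rfl, Or.inr rfl⟩

theorem newContent_le_append {z : α} {t : List α} (ht : ∀ x ∈ t, x ≤ z) (p : List α) :
    newContent z p ≤ newContent z (t ++ p) := by
  induction t with
  | nil => exact le_rfl
  | cons x t ih =>
    exact (ih fun y hy => ht y (List.mem_cons_of_mem _ hy)).trans
      (newContent_asc (ht x List.mem_cons_self) _).1

/-- The boxes of the Pieri growth dominate those created by separate insertions. -/
theorem abs_contentSum_sub_le {f G : ℤ → ℝ} (hfG : ∀ y z, y ≤ z → |f z - f y| ≤ G z - G y)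
    {t : List α} (ht : t.Pairwise (· ≥ ·)) (p : List α) :
    |contentSum f (tabShape (revTab (t ++ p))) - contentSum f (tabShape (revTab p))
        - (t.map fun x => f (newContent x p)).sum|
      ≤ contentSum G (tabShape (revTab (t ++ p))) - contentSum G (tabShape (revTab p))
        - (t.map fun x => G (newContent x p)).sum := by
  induction t with
  | nil => simp
  | cons z t ih =>
    rw [List.pairwise_cons] at ht
    have h1 := ih ht.2
    -- Every letter inserted before `z` is at most `z`, hence moves the box of `z` weakly towards
    -- larger contents; the error in `f` is paid by the increment of `G`.
    have h2 := hfG _ _ (newContent_le_append (z := z) (t := t) (fun x hx => ht.1 x hx) p)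
    rw [List.cons_append, contentSum_revTab_cons, contentSum_revTab_cons, List.map_cons,
      List.sum_cons, List.map_cons, List.sum_cons]
    rw [abs_le] at h1 h2 ⊢
    constructor <;> linarith [h1.1, h1.2, h2.1, h2.2]

variable {ι : Type*} [Fintype ι] [DecidableEq ι]

theorem expect_newContent {x : ι} {p : List ι} (he : (x :: p).Nodup) {a : ι → α}
    (ha : Function.Injective a) (g : ℤ → ℝ) :
    𝔼 σ : Equiv.Perm ι, g (newContent (a (σ x)) (p.map (a ∘ σ))) = pieriE g p.length 1 := by
  have := expect_pieri (t := [x]) (p := p) he ha g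
  simp only [List.length_singleton, Nat.factorial_one, Nat.cast_one, div_one] at this
  rw [← this]
  refine expect_congr rfl fun σ _ => ?_
  rw [if_pos (by simp)]
  simp only [List.cons_append, List.nil_append, List.map_cons]
  rw [contentSum_revTab_cons]
  simp

theorem map_ofSubtype_of_disjoint {α ι : Type*} [DecidableEq ι] {t p : List ι} (h : t.Disjoint p) (v : ι → α)
    (τ : Equiv.Perm {i // i ∈ t}) : p.map (v ∘ Equiv.Perm.ofSubtype τ) = p.map v := by
  refine List.map_congr_left fun i hi => ?_
  rw [Function.comp_apply, Equiv.Perm.ofSubtype_apply_of_not_mem τ fun hit => h hit hi]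

theorem map_ofSubtype_perm {ι : Type*} [DecidableEq ι] {t : List ι} (ht : t.Nodup) (τ : Equiv.Perm {i // i ∈ t}) :
    (t.map (Equiv.Perm.ofSubtype τ)).Perm t := by
  refine (List.perm_ext_iff_of_nodup (ht.map (Equiv.injective _)) ht).2 fun i => ?_
  rw [List.mem_map]
  constructor
  · rintro ⟨j, hj, rfl⟩
    rw [Equiv.Perm.ofSubtype_apply_of_mem τ hj]
    exact (τ ⟨j, hj⟩).2
  · intro hi
    exact ⟨(τ.symm ⟨i, hi⟩).1, (τ.symm ⟨i, hi⟩).2, by simp [Equiv.Perm.ofSubtype_apply_coe]⟩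

/-- Separate insertions do not interact, so the order of the tail is irrelevant; this is the
invariance that `expect_sorted` asks for. -/
theorem sum_newContent_mul_ofSubtype {ι : Type*} [DecidableEq ι] {t p : List ι} (he : (t ++ p).Nodup) (a : ι → α)
    (g : ℤ → ℝ) (σ : Equiv.Perm ι) (τ : Equiv.Perm {i // i ∈ t}) :
    (t.map fun x => g (newContent (a ((σ * Equiv.Perm.ofSubtype τ : Equiv.Perm ι) x))
      (p.map (a ∘ (σ * Equiv.Perm.ofSubtype τ : Equiv.Perm ι))))).sum
    = (t.map fun x => g (newContent (a (σ x)) (p.map (a ∘ σ)))).sum := by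
  have h1 : p.map (a ∘ (σ * Equiv.Perm.ofSubtype τ : Equiv.Perm ι)) = p.map (a ∘ σ) :=
    map_ofSubtype_of_disjoint (List.disjoint_of_nodup_append he) (a ∘ σ) τ
  rw [h1]
  have h2 := ((map_ofSubtype_perm (List.nodup_append.1 he).1 τ).map
    fun x => g (newContent (a (σ x)) (p.map (a ∘ σ)))).sum_eq
  rw [List.map_map] at h2
  exact h2

theorem expect_sum_newContent {t p : List ι} (he : (t ++ p).Nodup) {a : ι → α}
    (ha : Function.Injective a) (g : ℤ → ℝ) :
    𝔼 σ : Equiv.Perm ι, (t.map fun x => g (newContent (a (σ x)) (p.map (a ∘ σ)))).sum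
      = t.length * pieriE g p.length 1 := by
  have h : ∀ s : List ι, (∀ x ∈ s, x ∈ t) →
      𝔼 σ : Equiv.Perm ι, (s.map fun x => g (newContent (a (σ x)) (p.map (a ∘ σ)))).sum
      = s.length * pieriE g p.length 1 := by
    intro s
    induction s with
    | nil => simp
    | cons x s ih =>
      intro hs
      simp only [List.map_cons, List.sum_cons]
      rw [expect_add_distrib, ih fun y hy => hs y (List.mem_cons_of_mem _ hy),
        expect_newContent _ ha]
      · push_cast [List.length_cons]; ring
      · rw [List.nodup_append] at he
        exact List.nodup_cons.2 ⟨fun hx => he.2.2 x (hs x List.mem_cons_self) x hx rfl, he.2.1⟩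
  exact h t fun _ hx => hx

theorem expect_pieri_sub {t p : List ι} (he : (t ++ p).Nodup) {a : ι → α}
    (ha : Function.Injective a) (g : ℤ → ℝ) :
    𝔼 σ : Equiv.Perm ι, (if (t.map (a ∘ σ)).Pairwise (· ≥ ·) then
      contentSum g (tabShape (revTab ((t ++ p).map (a ∘ σ))))
        - contentSum g (tabShape (revTab (p.map (a ∘ σ))))
        - (t.map fun x => g (newContent (a (σ x)) (p.map (a ∘ σ)))).sum else 0)
      = (pieriE g p.length t.length - t.length * pieriE g p.length 1) / t.length.factorial := by
  have h1 := expect_pieri he ha g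
  have h2 := expect_sorted (List.nodup_append.1 he).1 ha
    (fun σ => (t.map fun x => g (newContent (a (σ x)) (p.map (a ∘ σ)))).sum)
    (sum_newContent_mul_ofSubtype he a g)
  rw [expect_sum_newContent he ha] at h2
  rw [sub_div, ← h1, ← h2, ← expect_sub_distrib]
  refine expect_congr rfl fun σ _ => ?_
  split_ifs <;> simp

/-- The effect of the interaction between two insertions. -/
theorem expect_abs_sub_newContent {x z : ι} {p : List ι} (he : (z :: x :: p).Nodup) {a : ι → α}
    (ha : Function.Injective a) {G : ℤ → ℝ} (hG : Monotone G) :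
    𝔼 σ : Equiv.Perm ι, |G (newContent (a (σ z)) ((x :: p).map (a ∘ σ)))
        - G (newContent (a (σ z)) (p.map (a ∘ σ)))|
      = pieriE G p.length 2 - pieriE G p.length 1 - pieriE G (p.length + 1) 1 := by
  have hzp : (z :: p).Nodup := by
    simp only [List.nodup_cons, List.mem_cons, not_or] at he ⊢
    exact ⟨he.1.2, he.2.2⟩
  have h1 := expect_pieri_sub (t := [z, x]) (p := p) he ha G
  have h2 := expect_newContent he ha G
  have h3 := expect_newContent hzp ha G
  -- The difference is nonnegative if the letter of `x` is at most that of `z` and nonpositive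
  -- otherwise. So its modulus is twice its sorted part, which is a Pieri growth by two boxes, minus
  -- the signed difference.
  have h4 : ∀ σ : Equiv.Perm ι, |G (newContent (a (σ z)) ((x :: p).map (a ∘ σ)))
        - G (newContent (a (σ z)) (p.map (a ∘ σ)))|
      = 2 * (if ([z, x].map (a ∘ σ)).Pairwise (· ≥ ·) then
        contentSum G (tabShape (revTab (([z, x] ++ p).map (a ∘ σ))))
        - contentSum G (tabShape (revTab (p.map (a ∘ σ))))
        - ([z, x].map fun x => G (newContent (a (σ x)) (p.map (a ∘ σ)))).sum else 0)
        - (G (newContent (a (σ z)) ((x :: p).map (a ∘ σ)))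
          - G (newContent (a (σ z)) (p.map (a ∘ σ)))) := by
    intro σ
    simp only [List.map_cons, List.map_nil, List.cons_append, List.nil_append,
      List.pairwise_cons, List.mem_singleton, forall_eq, List.not_mem_nil, IsEmpty.forall_iff,
      implies_true, List.Pairwise.nil, and_true, contentSum_revTab_cons, List.sum_cons,
      List.sum_nil, Function.comp_apply]
    split_ifs with h
    · rw [abs_of_nonneg (sub_nonneg.2 (hG (newContent_asc h _).1))]
      ring
    · rw [abs_of_nonpos (sub_nonpos.2 (hG (newContent_desc (not_le.1 h) _).1))]
      ring
  simp only [h4]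
  rw [expect_sub_distrib, expect_sub_distrib, ← mul_expect, h1, h2, h3]
  simp
  ring

theorem expect_tabShape {e : List ι} (he : e.Nodup) {a : ι → α} (ha : Function.Injective a)
    (φ : (ℕ →₀ ℕ) → ℝ) :
    𝔼 σ : Equiv.Perm ι, φ (tabShape (revTab (e.map (a ∘ σ)))) = planch e.length φ := by
  simp only [tabShape_revTab]
  rw [expect_revRec he ha fun r => φ (endShape r), sum_yams e.length fun p => syt p * φ p, planch]
  simp only [sq, mul_assoc]

/-- The conditional law of the next box given the whole recording sequence is the transition measure
of the current shape. The factor `ψ` may therefore depend on the content of an earlier box. -/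
theorem expect_mul_newContent {z : ι} {e : List ι} (he : (z :: e).Nodup) {a : ι → α}
    (ha : Function.Injective a) (ψ : List ℕ → ℝ) (g : ℤ → ℝ) :
    𝔼 σ : Equiv.Perm ι, ψ (revRec (e.map (a ∘ σ))) * g (newContent (a (σ z)) (e.map (a ∘ σ)))
      = 𝔼 σ : Equiv.Perm ι, ψ (revRec (e.map (a ∘ σ)))
          * transE g e.length (tabShape (revTab (e.map (a ∘ σ)))) := by
  have h1 := expect_revRec he ha fun r => ψ r.tail * g (headContent r)
  have h2 := expect_revRec (List.nodup_cons.1 he).2 ha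
    fun r => ψ r * transE g e.length (endShape r)
  simp only [tabShape_revTab]
  rw [h2]
  have h3 : ∀ σ : Equiv.Perm ι,
      ψ (revRec (e.map (a ∘ σ))) * g (newContent (a (σ z)) (e.map (a ∘ σ)))
      = ψ (revRec ((z :: e).map (a ∘ σ))).tail * g (headContent (revRec ((z :: e).map (a ∘ σ)))) := by
    intro σ
    rw [newContent_eq, List.map_cons, Function.comp_apply]
    rfl
  simp only [h3]
  rw [h1, List.length_cons, sum_yams_succ, Nat.factorial_succ, Nat.cast_mul, ← div_div]
  congr 1
  rw [sum_div]
  refine sum_congr rfl fun r hr => ?_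
  have h5 := sum_step_eq_transE g (endShape_mem_parts hr)
  have h6 : (∑ i ∈ range (e.length + 1), if Antitone (endShape r + box i) then
      syt (endShape (i :: r)) * (ψ (i :: r).tail * g (headContent (i :: r))) else 0)
      = ψ r * ∑ i ∈ range (e.length + 1), if Antitone (endShape r + box i) then
      syt (endShape r + box i) * g ((endShape r i : ℤ) - i) else 0 := by
    rw [mul_sum]
    refine sum_congr rfl fun i _ => ?_
    rw [mul_ite, mul_zero, endShape_cons, List.tail_cons, headContent]
    split_ifs <;> ring
  rw [h6, h5]
  push_cast
  field_simp

end Contents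

end PieriGrowth

namespace PieriGrowth

/-! ### An odd increasing polynomial that dominates increments of powers -/

section Domination

open scoped Classical
open Finset BigOperators

theorem pow_mul_pow_le_add {a b : ℝ} (ha : 0 ≤ a) (hb : 0 ≤ b) (p q : ℕ) :
    a ^ p * b ^ q ≤ a ^ (p + q) + b ^ (p + q) := by
  rcases le_total a b with h | h
  · calc a ^ p * b ^ q ≤ b ^ p * b ^ q := by gcongr
      _ = b ^ (p + q) := (pow_add _ _ _).symm
      _ ≤ _ := le_add_of_nonneg_left (by positivity)
  · calc a ^ p * b ^ q ≤ a ^ p * a ^ q := by gcongr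
      _ = a ^ (p + q) := (pow_add _ _ _).symm
      _ ≤ _ := le_add_of_nonneg_right (by positivity)

/-- For equal signs the monotonicity of the even power suffices, even without the factor 2; for
opposite signs `z - y` is at most twice the larger modulus. -/
theorem sub_mul_max_pow_le (J : ℕ) {y z : ℝ} (h : y ≤ z) :
    (z - y) * max |z| |y| ^ (2 * J) ≤ 2 * (z ^ (2 * J + 1) - y ^ (2 * J + 1)) := by
  have aux : ∀ {y z : ℝ}, 0 ≤ y → y ≤ z →
      (z - y) * z ^ (2 * J) ≤ z ^ (2 * J + 1) - y ^ (2 * J + 1) := by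
    intro y z hy h
    have : y ^ (2 * J) * y ≤ z ^ (2 * J) * y := by gcongr
    rw [pow_succ, pow_succ]
    nlinarith
  have hodd : Odd (2 * J + 1) := ⟨J, rfl⟩
  rcases le_total 0 y with hy | hy
  · rw [abs_of_nonneg hy, abs_of_nonneg (hy.trans h), max_eq_left h]
    have h0 : y ^ (2 * J + 1) ≤ z ^ (2 * J + 1) := by gcongr
    linarith [aux hy h]
  · rcases le_total z 0 with hz | hz
    · rw [abs_of_nonpos hy, abs_of_nonpos hz, max_eq_right (by linarith)]
      have h1 := aux (neg_nonneg.2 hz) (neg_le_neg h)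
      rw [hodd.neg_pow, hodd.neg_pow] at h1
      have h0 : y ^ (2 * J + 1) ≤ z ^ (2 * J + 1) := hodd.pow_le_pow.2 h
      linarith
    · rw [abs_of_nonpos hy, abs_of_nonneg hz]
      have h2 : y ^ (2 * J + 1) = -(-y) ^ (2 * J + 1) := by rw [hodd.neg_pow, neg_neg]
      have hy' : 0 ≤ -y := by linarith
      rw [h2, show z - y = z + -y by ring]
      generalize -y = w at hy' ⊢
      rcases le_total z w with hw | hw
      · rw [max_eq_right hw, pow_succ w]
        have : z * w ^ (2 * J) ≤ w * w ^ (2 * J) := by gcongr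
        have h5 : 0 ≤ z ^ (2 * J + 1) := by positivity
        linarith
      · rw [max_eq_left hw, pow_succ z]
        have : w * z ^ (2 * J) ≤ z * z ^ (2 * J) := by gcongr
        have h5 : 0 ≤ w ^ (2 * J + 1) := by positivity
        linarith

/-- The mean value bound leaves the weight `w` times a power `J - 1` of the larger modulus; the
hypothesis trades this product for two powers whose products with `z - y` are controlled by the
increments of the two terms of `domFun`. -/
theorem abs_pow_sub_pow_mul_le {J : ℕ} {s w y z : ℝ} (hs : 0 ≤ s) (h : y ≤ z) (hw : 0 ≤ w)
    (hJw : max |z| |y| ^ (J - 1) * w ≤ max |z| |y| ^ (2 * J) + s ^ (2 * J)) :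
    w * |z ^ J - y ^ J| ≤ 2 * J * ((z ^ (2 * J + 1) + s ^ (2 * J) * z)
      - (y ^ (2 * J + 1) + s ^ (2 * J) * y)) := by
  have h1 := abs_pow_sub_pow_le z y J
  have h2 := sub_mul_max_pow_le J h
  rw [abs_of_nonneg (sub_nonneg.2 h)] at h1
  have hzy := sub_nonneg.2 h
  calc w * |z ^ J - y ^ J| ≤ w * ((z - y) * J * max |z| |y| ^ (J - 1)) := by gcongr
    _ = J * ((z - y) * (max |z| |y| ^ (J - 1) * w)) := by ring
    _ ≤ J * ((z - y) * (max |z| |y| ^ (2 * J) + s ^ (2 * J))) := by gcongr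
    _ ≤ J * (2 * ((z ^ (2 * J + 1) + s ^ (2 * J) * z) - (y ^ (2 * J + 1) + s ^ (2 * J) * y))) := by
      have : 0 ≤ (z - y) * s ^ (2 * J) := by positivity
      refine mul_le_mul_of_nonneg_left ?_ (Nat.cast_nonneg J)
      linarith
    _ = _ := by ring

/-- An increasing function that dominates the increments of powers. -/
noncomputable def domFun (J n : ℕ) (c : ℤ) : ℝ := pw (2 * J + 1) c + (n : ℝ) ^ J * pw 1 c

theorem sqrt_pow_two_mul (n J : ℕ) : √(n : ℝ) ^ (2 * J) = (n : ℝ) ^ J := by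
  rw [pow_mul, Real.sq_sqrt (Nat.cast_nonneg n)]

theorem domFun_eq (J n : ℕ) (c : ℤ) :
    domFun J n c = (c : ℝ) ^ (2 * J + 1) + √(n : ℝ) ^ (2 * J) * c := by
  rw [domFun, pw, pw, sqrt_pow_two_mul, pow_one]

theorem domFun_monotone (J n : ℕ) : Monotone (domFun J n) := by
  intro y z h
  have h' : (y : ℝ) ≤ z := by exact_mod_cast h
  have hodd : Odd (2 * J + 1) := ⟨J, rfl⟩
  have := hodd.pow_le_pow.2 h'
  rw [domFun_eq, domFun_eq]
  gcongr

theorem sqrt_pow_mul_abs_pw_sub_le {J n : ℕ} (hJ : 1 ≤ J) {y z : ℤ} (h : y ≤ z) :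
    √(n : ℝ) ^ (J + 1) * |pw J z - pw J y| ≤ 2 * J * (domFun J n z - domFun J n y) := by
  rw [domFun_eq, domFun_eq]
  refine abs_pow_sub_pow_mul_le (by positivity) (by exact_mod_cast h) (by positivity) ?_
  have := pow_mul_pow_le_add (a := max |(z : ℝ)| |(y : ℝ)|) (b := √(n : ℝ))
    (le_max_of_le_left (abs_nonneg _)) (by positivity) (J - 1) (J + 1)
  rwa [show J - 1 + (J + 1) = 2 * J by omega] at this

theorem sqrt_mul_pow_abs_pw_sub_le {J n : ℕ} (hJ : 1 ≤ J) {y z : ℤ} (h : y ≤ z) :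
    √(n : ℝ) * max |(z : ℝ)| |(y : ℝ)| ^ J * |pw J z - pw J y|
      ≤ 2 * J * (domFun J n z - domFun J n y) := by
  rw [domFun_eq, domFun_eq]
  have hM : 0 ≤ max |(z : ℝ)| |(y : ℝ)| := le_max_of_le_left (abs_nonneg _)
  refine abs_pow_sub_pow_mul_le (by positivity) (by exact_mod_cast h) (by positivity) ?_
  have := pow_mul_pow_le_add hM (Real.sqrt_nonneg (n : ℝ)) (2 * J - 1) 1
  rw [show 2 * J - 1 + 1 = 2 * J by omega, pow_one] at this
  calc _ = max |(z : ℝ)| |(y : ℝ)| ^ (2 * J - 1) * √(n : ℝ) := by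
        rw [show 2 * J - 1 = (J - 1) + J by omega, pow_add]; ring
    _ ≤ _ := this

/-- Bounds the error made in a covariance. If `y = z` there is none; if `x = y`, the first factor is
also bounded through the larger of `|y|` and `|z|`, so that the product is still dominated. -/
theorem sqrt_mul_abs_pw_sub_le {J n : ℕ} (hJ : 1 ≤ J) {A : ℝ} (hA : 0 ≤ A) {x y z : ℤ} {m : ℝ}
    (hm : |m| ≤ A * √(n : ℝ) ^ J) (hx : x = y ∨ y = z) :
    √(n : ℝ) * (|pw J x - m| * |pw J y - pw J z|)
      ≤ 2 * J * (1 + A) * |domFun J n z - domFun J n y| := by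
  rcases hx with rfl | rfl
  swap
  · simp
  have key : ∀ {y z : ℤ}, y ≤ z → ∀ u : ℤ, |(u : ℝ)| ≤ max |(z : ℝ)| |(y : ℝ)| →
      √(n : ℝ) * (|pw J u - m| * |pw J z - pw J y|)
        ≤ 2 * J * (1 + A) * (domFun J n z - domFun J n y) := by
    intro y z h u hu
    have h1 := sqrt_mul_pow_abs_pw_sub_le (n := n) hJ h
    have h2 := sqrt_pow_mul_abs_pw_sub_le (n := n) hJ h
    have h3 : |pw J u - m| ≤ max |(z : ℝ)| |(y : ℝ)| ^ J + A * √(n : ℝ) ^ J := by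
      refine (abs_sub _ _).trans (add_le_add ?_ hm)
      rw [pw, abs_pow]
      gcongr
    calc √(n : ℝ) * (|pw J u - m| * |pw J z - pw J y|)
        ≤ √(n : ℝ) * ((max |(z : ℝ)| |(y : ℝ)| ^ J + A * √(n : ℝ) ^ J) * |pw J z - pw J y|) := by
          gcongr
      _ = √(n : ℝ) * max |(z : ℝ)| |(y : ℝ)| ^ J * |pw J z - pw J y|
          + A * (√(n : ℝ) ^ (J + 1) * |pw J z - pw J y|) := by ring
      _ ≤ 2 * J * (domFun J n z - domFun J n y)
          + A * (2 * J * (domFun J n z - domFun J n y)) := by gcongr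
      _ = _ := by ring
  rcases le_total x z with h | h
  · have := key h x (le_max_right _ _)
    rw [abs_of_nonneg (sub_nonneg.2 (domFun_monotone J n h)), abs_sub_comm (pw J x) (pw J z)]
    exact this
  · have := key h x (le_max_left _ _)
    rw [abs_of_nonpos (sub_nonpos.2 (domFun_monotone J n h)), neg_sub]
    exact this

theorem pieriE_domFun (J n m k : ℕ) : pieriE (domFun J n) m k
    = pieriE (pw (2 * J + 1)) m k + (n : ℝ) ^ J * pieriE (pw 1) m k := by
  rw [← pieriE_mul, ← pieriE_add]
  rfl

/-- `domFun` is an odd polynomial, so a single insertion does not see it. This turns every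
comparison below into a bound by `pieriE (domFun J n) n k` alone. -/
theorem pieriE_domFun_one (J n m : ℕ) : pieriE (domFun J n) m 1 = 0 := by
  rw [pieriE_domFun, (pieriE_one_odd _ ⟨J, rfl⟩ m).1, (pieriE_one_odd 1 ⟨0, rfl⟩ m).1]
  simp

theorem exists_pieriE_domFun_le (J : ℕ) : ∃ C : ℝ, 0 ≤ C ∧ ∀ n k : ℕ,
    pieriE (domFun J n) n k ≤ C * (k ^ 2 * ((n : ℝ) + k ^ 2) ^ J) := by
  obtain ⟨C₁, h1, hC₁⟩ := exists_bound_pieriE J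
  obtain ⟨C₀, h0, hC₀⟩ := exists_bound_pieriE 0
  refine ⟨C₁ + C₀, by positivity, fun n k => ?_⟩
  have e1 := le_of_abs_le (hC₁ n k).2
  have e0 := le_of_abs_le (hC₀ n k).2
  rw [pieriE_domFun]
  simp only [mul_zero, zero_add, pow_zero, mul_one] at e0
  have e2 : (n : ℝ) ^ J * pieriE (pw 1) n k ≤ ((n : ℝ) + k ^ 2) ^ J * (C₀ * k ^ 2) := by
    calc (n : ℝ) ^ J * pieriE (pw 1) n k ≤ (n : ℝ) ^ J * (C₀ * k ^ 2) := by gcongr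
      _ ≤ _ := by gcongr; exact le_add_of_nonneg_right (by positivity)
  linarith

theorem exists_sq_momCenter_le (J : ℕ) : ∃ A : ℝ, 0 ≤ A ∧ ∀ n : ℕ, 1 ≤ n →
    |momCenter J n| ≤ A * √(n : ℝ) ^ J := by
  obtain ⟨C, h0, hC⟩ := exists_bound_momCenter J
  refine ⟨C * 2 ^ J, by positivity, fun n hn => ?_⟩
  have hs : 1 ≤ √(n : ℝ) := Real.one_le_sqrt.2 (by exact_mod_cast hn)
  calc |momCenter J n| ≤ C * ((n : ℝ) + 1) ^ (J / 2) := hC n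
    _ ≤ C * (2 * √(n : ℝ) ^ 2) ^ (J / 2) := by
        gcongr
        rw [Real.sq_sqrt (by positivity)]
        have : (1 : ℝ) ≤ n := by exact_mod_cast hn
        linarith
    _ = C * (2 ^ (J / 2) * √(n : ℝ) ^ (2 * (J / 2))) := by rw [mul_pow, pow_mul]
    _ ≤ C * (2 ^ J * √(n : ℝ) ^ J) := by
        have h1 : J / 2 ≤ J := Nat.div_le_self _ _
        have h2 : 2 * (J / 2) ≤ J := Nat.mul_div_le _ _
        have h3 : (2 : ℝ) ^ (J / 2) ≤ 2 ^ J := pow_le_pow_right₀ (by norm_num) h1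
        have h4 := pow_le_pow_right₀ hs h2
        gcongr
    _ = _ := by ring

theorem exists_momCenter_succ_sub_le {J : ℕ} (hJ : 1 ≤ J) : ∃ A : ℝ, 0 ≤ A ∧ ∀ n : ℕ, 1 ≤ n →
    (n : ℝ) * (momCenter J (n + 1) - momCenter J n) ^ 2 ≤ A * (n : ℝ) ^ J := by
  refine ⟨((J.factorial : ℝ) / (J / 2 + 1).factorial) ^ 2, by positivity, fun n hn => ?_⟩
  have hn' : (1 : ℝ) ≤ n := by exact_mod_cast hn
  rw [momCenter, momCenter]
  split_ifs with he
  · obtain ⟨l, rfl⟩ : ∃ l, J = 2 * (l + 1) := by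
      obtain ⟨r, hr⟩ := he
      exact ⟨r - 1, by omega⟩
    rw [show 2 * (l + 1) / 2 = l + 1 by omega, Nat.choose_succ_succ]
    generalize ((2 * (l + 1)).factorial : ℝ) / (l + 1 + 1).factorial = c
    have hch : (n.choose l : ℝ) ≤ (n : ℝ) ^ l := by exact_mod_cast Nat.choose_le_pow n l
    have h1 : c * ((n.choose l + n.choose (l + 1) : ℕ) : ℝ) - c * n.choose (l + 1)
        = c * n.choose l := by push_cast; ring
    rw [h1, mul_pow]
    calc (n : ℝ) * (c ^ 2 * (n.choose l : ℝ) ^ 2) ≤ n * (c ^ 2 * ((n : ℝ) ^ l) ^ 2) := by gcongr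
      _ = c ^ 2 * (n : ℝ) ^ (2 * l + 1) := by ring
      _ ≤ _ := by
        gcongr
        omega
  · simp; positivity

end Domination

/-! ### Second moment estimate and concentration for random permutations -/

section SecondMoment

open scoped Classical
open Finset BigOperators

/-- The off-diagonal bound gains a factor `√n`. The content of `z` inserted alone is replaced by its
content after `x`, at the cost of an increment of `domFun`; conditioning on the recording sequence
of `x :: p` then replaces it by a transition moment, whose mean square deviation has order `n ^ (J -
1)`. -/
theorem exists_newContent_bounds {J : ℕ} (hJ : 1 ≤ J) : ∃ C : ℝ, 0 ≤ C ∧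
    ∀ (α : Type) [LinearOrder α] (ι : Type) [Fintype ι] [DecidableEq ι] (a : ι → α)
      (p : List ι), Function.Injective a → 1 ≤ p.length →
    (∀ x, (x :: p).Nodup → 𝔼 σ : Equiv.Perm ι,
      (pw J (newContent (a (σ x)) (p.map (a ∘ σ))) - momCenter J p.length) ^ 2
        ≤ C * (p.length : ℝ) ^ J) ∧
    ∀ x z, (z :: x :: p).Nodup → √(p.length : ℝ) * 𝔼 σ : Equiv.Perm ι,
      (pw J (newContent (a (σ x)) (p.map (a ∘ σ))) - momCenter J p.length)
        * (pw J (newContent (a (σ z)) (p.map (a ∘ σ))) - momCenter J p.length)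
        ≤ C * (p.length : ℝ) ^ J := by
  obtain ⟨A, hA0, hA⟩ := exists_sq_momCenter_le J
  obtain ⟨B, hB0, hB⟩ := exists_momCenter_succ_sub_le hJ
  obtain ⟨C₁, hC₁0, hC₁⟩ := exists_bound_pieriE J
  obtain ⟨D, hD0, hD⟩ := exists_pieriE_domFun_le J
  obtain ⟨K, hK0, hK⟩ := exists_momVar_le J
  set E : ℝ := 2 * (C₁ * 2 ^ J) + 2 * A ^ 2 with hE
  set F : ℝ := 2 * (K * 3 ^ J) + 2 * B with hF
  set H : ℝ := 2 * J * (1 + A) * (D * (4 * 5 ^ J)) with hH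
  have hE0 : 0 ≤ E := by positivity
  have hF0 : 0 ≤ F := by positivity
  have hH0 : 0 ≤ H := by positivity
  refine ⟨E + F + H, by positivity, ?_⟩
  intro α _ ι _ _ a p ha hp
  set n := p.length with hn
  set m := momCenter J n with hm
  have hn1 : (1 : ℝ) ≤ n := by exact_mod_cast hp
  have hnJ : 0 ≤ (n : ℝ) ^ J := by positivity
  have hm2 : m ^ 2 ≤ A ^ 2 * (n : ℝ) ^ J := by
    have h1 := hA n hp
    calc m ^ 2 = |m| ^ 2 := (sq_abs m).symm
      _ ≤ (A * √(n : ℝ) ^ J) ^ 2 := by gcongr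
      _ = A ^ 2 * √(n : ℝ) ^ (2 * J) := by ring
      _ = _ := by rw [sqrt_pow_two_mul]
  have hdiag : ∀ x, (x :: p).Nodup → 𝔼 σ : Equiv.Perm ι,
      (pw J (newContent (a (σ x)) (p.map (a ∘ σ))) - m) ^ 2 ≤ E * (n : ℝ) ^ J := by
    intro x hx
    have h1 : 𝔼 σ : Equiv.Perm ι, (pw J (newContent (a (σ x)) (p.map (a ∘ σ))) - m) ^ 2
        ≤ 𝔼 σ : Equiv.Perm ι, (2 * pw (2 * J) (newContent (a (σ x)) (p.map (a ∘ σ)))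
          + 2 * m ^ 2) := by
      refine expect_le_expect fun σ _ => ?_
      rw [pw, pw, pow_mul']
      nlinarith [sq_nonneg ((newContent (a (σ x)) (p.map (a ∘ σ)) : ℝ) ^ J + m)]
    rw [expect_add_distrib, expect_const univ_nonempty, ← mul_expect,
      expect_newContent hx ha] at h1
    have h2 := le_of_abs_le (hC₁ n 1).1
    simp only [Nat.cast_one, one_pow, one_mul] at h2
    have h3 : ((n : ℝ) + 1) ^ J ≤ 2 ^ J * (n : ℝ) ^ J := by
      rw [← mul_pow]; gcongr; linarith
    have h4 : C₁ * ((n : ℝ) + 1) ^ J ≤ C₁ * (2 ^ J * (n : ℝ) ^ J) := by gcongr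
    rw [hE]
    linarith
  refine ⟨fun x hx => (hdiag x hx).trans ?_, ?_⟩
  · gcongr; linarith
  intro x z he
  have hxp : (x :: p).Nodup := (List.nodup_cons.1 he).2
  set s := √(n : ℝ) with hs
  have hs2 : s ^ 2 = n := Real.sq_sqrt (by positivity)
  -- abbreviations for the three contents
  let X : Equiv.Perm ι → ℤ := fun σ => newContent (a (σ x)) (p.map (a ∘ σ))
  let Y : Equiv.Perm ι → ℤ := fun σ => newContent (a (σ z)) (p.map (a ∘ σ))
  let Z : Equiv.Perm ι → ℤ := fun σ => newContent (a (σ z)) ((x :: p).map (a ∘ σ))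
  let V : Equiv.Perm ι → ℝ := fun σ =>
    transE (pw J) (n + 1) (tabShape (revTab ((x :: p).map (a ∘ σ)))) - m
  have hXYZ : ∀ σ, X σ = Y σ ∨ Y σ = Z σ := by
    intro σ
    rcases le_or_gt (a (σ x)) (a (σ z)) with h | h
    · exact (newContent_asc h (p.map (a ∘ σ))).2.imp Eq.symm id
    · exact (newContent_desc h (p.map (a ∘ σ))).2.imp Eq.symm id
  have hV : (n : ℝ) * 𝔼 σ, V σ ^ 2 ≤ F * (n : ℝ) ^ J := by
    have h1 := expect_tabShape hxp ha fun q => (transE (pw J) (n + 1) q - m) ^ 2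
    rw [h1, List.length_cons, ← hn]
    have h2 : planch (n + 1) (fun q => (transE (pw J) (n + 1) q - m) ^ 2)
        ≤ planch (n + 1) (fun q => 2 * (transE (pw J) (n + 1) q - momCenter J (n + 1)) ^ 2
          + 2 * (momCenter J (n + 1) - m) ^ 2) := by
      refine planch_mono _ fun q _ => ?_
      nlinarith [sq_nonneg ((transE (pw J) (n + 1) q - momCenter J (n + 1))
        - (momCenter J (n + 1) - m))]
    rw [planch_add, planch_mul, planch_const] at h2
    change _ ≤ 2 * momVar J (n + 1) + _ at h2
    have h3 := hK (n + 1)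
    have h4 := hB n hp
    have h5 : (n : ℝ) * momVar J (n + 1) ≤ momVar J (n + 1) * (((n + 1 : ℕ) : ℝ) + 1) := by
      rw [mul_comm]
      have := momVar_nonneg J (n + 1)
      gcongr
      push_cast; linarith
    have h6 : K * (((n + 1 : ℕ) : ℝ) + 1) ^ J ≤ K * (3 ^ J * (n : ℝ) ^ J) := by
      rw [← mul_pow]
      gcongr
      push_cast; linarith
    calc (n : ℝ) * planch (n + 1) (fun q => (transE (pw J) (n + 1) q - m) ^ 2)
        ≤ n * (2 * momVar J (n + 1) + 2 * (momCenter J (n + 1) - m) ^ 2) := by gcongr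
      _ = 2 * (n * momVar J (n + 1)) + 2 * (n * (momCenter J (n + 1) - m) ^ 2) := by ring
      _ ≤ 2 * (K * (3 ^ J * (n : ℝ) ^ J)) + 2 * (B * (n : ℝ) ^ J) := by linarith
      _ = _ := by rw [hF]; ring
  have hXZ : 𝔼 σ, (pw J (X σ) - m) * (pw J (Z σ) - m) = 𝔼 σ, (pw J (X σ) - m) * V σ := by
    have h1 := expect_mul_newContent he ha (fun r => pw J (headContent r) - m) (pw J)
    have h2 : ∀ σ : Equiv.Perm ι, headContent (revRec ((x :: p).map (a ∘ σ))) = X σ := fun σ => by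
      rw [List.map_cons, ← newContent_eq]; rfl
    simp only [h2, List.length_cons, ← hn] at h1
    have h3 : ∀ W : Equiv.Perm ι → ℝ, 𝔼 σ, (pw J (X σ) - m) * (W σ - m)
        = 𝔼 σ, (pw J (X σ) - m) * W σ - 𝔼 σ, (pw J (X σ) - m) * m := fun W => by
      rw [← expect_sub_distrib]
      exact expect_congr rfl fun σ _ => mul_sub _ _ _
    rw [h3 fun σ => pw J (Z σ)]
    exact (congrArg (· - 𝔼 σ, (pw J (X σ) - m) * m) h1).trans (h3 _).symm
  have hG : 𝔼 σ, |domFun J n (Z σ) - domFun J n (Y σ)| ≤ D * (4 * 5 ^ J) * (n : ℝ) ^ J := by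
    have h1 := expect_abs_sub_newContent he ha (domFun_monotone J n)
    rw [pieriE_domFun_one, pieriE_domFun_one, sub_zero, sub_zero] at h1
    rw [h1]
    refine (hD n 2).trans ?_
    have : ((n : ℝ) + (2 : ℕ) ^ 2) ^ J ≤ 5 ^ J * (n : ℝ) ^ J := by
      rw [← mul_pow]; gcongr; push_cast; linarith
    calc D * (((2 : ℕ) : ℝ) ^ 2 * ((n : ℝ) + ((2 : ℕ) : ℝ) ^ 2) ^ J)
        ≤ D * (((2 : ℕ) : ℝ) ^ 2 * (5 ^ J * (n : ℝ) ^ J)) := by gcongr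
      _ = _ := by push_cast; ring
  have hpt : ∀ σ, s * ((pw J (X σ) - m) * (pw J (Y σ) - m))
      ≤ s * ((pw J (X σ) - m) * (pw J (Z σ) - m))
        + 2 * J * (1 + A) * |domFun J n (Z σ) - domFun J n (Y σ)| := by
    intro σ
    have h1 := sqrt_mul_abs_pw_sub_le hJ hA0 (hA n hp) (hXYZ σ)
    rw [← abs_mul] at h1
    have h2 := mul_le_mul_of_nonneg_left
      (le_abs_self ((pw J (X σ) - m) * (pw J (Y σ) - pw J (Z σ)))) (Real.sqrt_nonneg (n : ℝ))
    have h3 := h2.trans h1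
    rw [← hs] at h3
    nlinarith [h3]
  -- The factor `s` balances the two squares, which have orders `n ^ J` and `n ^ (J - 1)`.
  have hUV : s * 𝔼 σ, (pw J (X σ) - m) * V σ ≤ (E + F) * (n : ℝ) ^ J := by
    rw [mul_expect]
    have h1 : 𝔼 σ, s * ((pw J (X σ) - m) * V σ) ≤ 𝔼 σ, ((pw J (X σ) - m) ^ 2 + n * V σ ^ 2) := by
      refine expect_le_expect fun σ _ => ?_
      rw [← hs2]
      nlinarith [sq_nonneg ((pw J (X σ) - m) - s * V σ), sq_nonneg (pw J (X σ) - m),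
        sq_nonneg (s * V σ)]
    have := hdiag x hxp
    refine h1.trans ?_
    rw [expect_add_distrib, ← mul_expect, add_mul]
    exact add_le_add this hV
  calc s * 𝔼 σ, (pw J (X σ) - m) * (pw J (Y σ) - m)
      ≤ s * 𝔼 σ, (pw J (X σ) - m) * (pw J (Z σ) - m)
        + 2 * J * (1 + A) * 𝔼 σ, |domFun J n (Z σ) - domFun J n (Y σ)| := by
        rw [mul_expect, mul_expect, mul_expect, ← expect_add_distrib]
        exact expect_le_expect fun σ _ => hpt σ
    _ ≤ (E + F) * (n : ℝ) ^ J + 2 * J * (1 + A) * (D * (4 * 5 ^ J) * (n : ℝ) ^ J) := by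
        rw [hXZ]; gcongr
    _ = _ := by rw [hH]; ring

theorem expect_sq_sum_le {κ Ω : Type*} [Fintype Ω] (t : Finset κ) (f : κ → Ω → ℝ) {A B : ℝ}
    (hA : ∀ x ∈ t, 𝔼 ω, f x ω ^ 2 ≤ A) (hB : ∀ x ∈ t, ∀ z ∈ t, x ≠ z → 𝔼 ω, f x ω * f z ω ≤ B)
    (hB0 : 0 ≤ B) :
    𝔼 ω, (∑ x ∈ t, f x ω) ^ 2 ≤ #t * A + #t ^ 2 * B := by
  have h1 : 𝔼 ω, (∑ x ∈ t, f x ω) ^ 2 = ∑ x ∈ t, ∑ z ∈ t, 𝔼 ω, f x ω * f z ω := by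
    simp only [sq, sum_mul_sum]
    rw [expect_sum_comm]
    exact sum_congr rfl fun x _ => expect_sum_comm _ _ _
  rw [h1]
  have h2 : ∀ x ∈ t, ∑ z ∈ t, 𝔼 ω, f x ω * f z ω ≤ A + #t * B := by
    intro x hx
    rw [← add_sum_erase t _ hx]
    refine add_le_add ?_ ?_
    · simpa only [sq] using hA x hx
    · calc ∑ z ∈ t.erase x, 𝔼 ω, f x ω * f z ω ≤ #(t.erase x) • B :=
            sum_le_card_nsmul _ _ _ fun z hz =>
              hB x hx z (mem_of_mem_erase hz) (ne_of_mem_erase hz).symm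
        _ ≤ #t * B := by
            rw [nsmul_eq_mul]
            gcongr
            exact erase_subset _ _
  calc _ ≤ #t • (A + #t * B) := sum_le_card_nsmul _ _ _ h2
    _ = _ := by rw [nsmul_eq_mul]; ring

/-- Concentration of the moments of the Pieri growth of a random permutation. -/
theorem exists_moment_deviation_le {J : ℕ} (hJ : 1 ≤ J) {δ : ℝ} (hδ : 0 < δ) :
    ∃ C : ℝ, 0 ≤ C ∧
    ∀ (α : Type) [LinearOrder α] (ι : Type) [Fintype ι] [DecidableEq ι] (a : ι → α)
      (t p : List ι), Function.Injective a → (t ++ p).Nodup → 1 ≤ p.length → 1 ≤ t.length →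
      t.length ^ 2 ≤ p.length →
    𝔼 σ : Equiv.Perm ι, (if (t.map (a ∘ σ)).Pairwise (· ≥ ·) ∧
        δ * √(p.length : ℝ) ^ J * t.length <
          |contentSum (pw J) (tabShape (revTab ((t ++ p).map (a ∘ σ))))
            - contentSum (pw J) (tabShape (revTab (p.map (a ∘ σ))))
            - t.length * momCenter J p.length| then (1 : ℝ) else 0)
      ≤ C * (1 / t.length + t.length / √(p.length : ℝ)) / t.length.factorial := by
  obtain ⟨C₁, hC₁0, hC₁⟩ := exists_newContent_bounds hJ
  obtain ⟨D, hD0, hD⟩ := exists_pieriE_domFun_le J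
  refine ⟨2 / δ * (2 * J * D * 2 ^ J) + 4 / δ ^ 2 * C₁, by positivity, ?_⟩
  intro α _ ι _ _ a t p ha he hp ht hkn
  obtain ⟨hdiag, hpair⟩ := hC₁ α ι a p ha hp
  set n := p.length with hn
  set k := t.length with hk
  set m := momCenter J n with hm
  set s := √(n : ℝ) with hs
  have hn1 : (1 : ℝ) ≤ n := by exact_mod_cast hp
  have hk1 : (1 : ℝ) ≤ k := by exact_mod_cast ht
  have hkn' : (k : ℝ) ^ 2 ≤ n := by exact_mod_cast hkn
  have hs2 : s ^ 2 = n := Real.sq_sqrt (by positivity)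
  have hs1 : 1 ≤ s := Real.one_le_sqrt.2 hn1
  have hs0 : 0 < s := by linarith
  have hsJ : s ^ (2 * J) = (n : ℝ) ^ J := sqrt_pow_two_mul n J
  have hks : (k : ℝ) ≤ s := Real.le_sqrt_of_sq_le hkn'
  obtain ⟨htn, hpn, hdis⟩ := List.nodup_append.1 he
  let ψ : Equiv.Perm ι → ℝ := fun σ => contentSum (pw J) (tabShape (revTab ((t ++ p).map (a ∘ σ))))
            - contentSum (pw J) (tabShape (revTab (p.map (a ∘ σ))))
  let Ψ : (ℤ → ℝ) → Equiv.Perm ι → ℝ := fun g σ =>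
    (t.map fun x => g (newContent (a (σ x)) (p.map (a ∘ σ)))).sum
  let S : Equiv.Perm ι → Prop := fun σ => (t.map (a ∘ σ)).Pairwise (· ≥ ·)
  -- comparison with separate insertions
  have h1 : 𝔼 σ, (if S σ then |ψ σ - Ψ (pw J) σ| else 0)
      ≤ 2 * J / s ^ (J + 1) * (D * (k ^ 2 * ((n : ℝ) + k ^ 2) ^ J) / k.factorial) := by
    have h2 := expect_pieri_sub he ha (domFun J n)
    rw [pieriE_domFun_one, mul_zero, sub_zero] at h2
    have h3 : pieriE (domFun J n) p.length t.length / (t.length.factorial : ℝ)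
      ≤ D * (k ^ 2 * ((n : ℝ) + k ^ 2) ^ J) / k.factorial := by
      gcongr
      exact hD n k
    rw [← h2] at h3
    refine le_trans ?_ (mul_le_mul_of_nonneg_left h3 (by positivity))
    rw [mul_expect]
    refine expect_le_expect fun σ _ => ?_
    by_cases hσ : S σ
    · rw [if_pos hσ, if_pos hσ]
      have h4 := abs_contentSum_sub_le (f := fun c => s ^ (J + 1) * pw J c)
        (G := fun c => 2 * J * domFun J n c) (fun y z hyz => by
          rw [← mul_sub, ← mul_sub, abs_mul, abs_of_nonneg (by positivity)]
          exact sqrt_pow_mul_abs_pw_sub_le hJ hyz) hσ (p.map (a ∘ σ))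
      rw [← List.map_append] at h4
      simp only [contentSum_mul_fun, List.sum_map_mul_left, ← mul_sub, abs_mul] at h4
      rw [abs_of_nonneg (by positivity : 0 ≤ s ^ (J + 1))] at h4
      simp only [List.map_map] at h4
      rw [div_mul_eq_mul_div, le_div_iff₀ (by positivity), mul_comm]
      exact h4
    · rw [if_neg hσ, if_neg hσ, mul_zero]
  -- The sum over separate insertions ignores the order of the tail, so the sorting condition
  -- factors out as `1 / k!`.
  have h2 : 𝔼 σ, (if S σ then (Ψ (pw J) σ - k * m) ^ 2 else 0)
      ≤ (k * (C₁ * (n : ℝ) ^ J) + k ^ 2 * (C₁ * (n : ℝ) ^ J / s)) / k.factorial := by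
    rw [expect_sorted htn ha (fun σ => (Ψ (pw J) σ - k * m) ^ 2) fun σ τ => by
      simp only [Ψ]; rw [sum_newContent_mul_ofSubtype he a (pw J) σ τ]]
    gcongr
    have h3 : ∀ σ, Ψ (pw J) σ - k * m
        = ∑ x ∈ t.toFinset, (pw J (newContent (a (σ x)) (p.map (a ∘ σ))) - m) := by
      intro σ
      rw [sum_sub_distrib, sum_const, List.toFinset_card_of_nodup htn, nsmul_eq_mul,
        List.sum_toFinset _ htn]
    simp only [h3]
    have h4 := expect_sq_sum_le t.toFinset
      (fun x (σ : Equiv.Perm ι) => pw J (newContent (a (σ x)) (p.map (a ∘ σ))) - m)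
      (A := C₁ * (n : ℝ) ^ J) (B := C₁ * (n : ℝ) ^ J / s)
      (fun x hx => hdiag x (List.nodup_cons.2 ⟨fun h => hdis x (List.mem_toFinset.1 hx) x h rfl, hpn⟩))
      (fun x hx z hz hxz => by
        rw [le_div_iff₀ hs0, mul_comm]
        refine hpair x z (List.nodup_cons.2 ⟨?_, List.nodup_cons.2
          ⟨fun h => hdis x (List.mem_toFinset.1 hx) x h rfl, hpn⟩⟩)
        rw [List.mem_cons, not_or]
        exact ⟨hxz.symm, fun h => hdis z (List.mem_toFinset.1 hz) z h rfl⟩)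
      (by positivity)
    rwa [List.toFinset_card_of_nodup htn] at h4
  -- Either the discrepancy from separate insertions or the fluctuation of their sum is at least
  -- half the threshold: Markov's inequality for the former, Chebyshev's for the latter.
  have hpt : ∀ σ : Equiv.Perm ι, (if S σ ∧ δ * s ^ J * k < |ψ σ - k * m| then (1 : ℝ) else 0)
      ≤ 2 / (δ * s ^ J * k) * (if S σ then |ψ σ - Ψ (pw J) σ| else 0)
        + 4 / (δ * s ^ J * k) ^ 2 * (if S σ then (Ψ (pw J) σ - k * m) ^ 2 else 0) := by
    intro σ
    set b := δ * s ^ J * k with hb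
    have hb0 : 0 < b := by positivity
    by_cases hσ : S σ
    · rw [if_pos hσ, if_pos hσ]
      split_ifs with h
      · have h3 : |ψ σ - k * m| ≤ |ψ σ - Ψ (pw J) σ| + |Ψ (pw J) σ - k * m| := abs_sub_le _ _ _
        have h4 := h.2.trans_le h3
        rw [← sq_abs (Ψ (pw J) σ - k * m)]
        rcases le_or_gt (b / 2) |ψ σ - Ψ (pw J) σ| with h5 | h5
        · have h6 : 1 ≤ 2 / b * |ψ σ - Ψ (pw J) σ| := by
            rw [div_mul_eq_mul_div, le_div_iff₀ hb0]; linarith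
          exact h6.trans (le_add_of_nonneg_right (by positivity))
        · have h6 : b / 2 ≤ |Ψ (pw J) σ - k * m| := by linarith
          have h7 : 1 ≤ 4 / b ^ 2 * |Ψ (pw J) σ - k * m| ^ 2 := by
            rw [div_mul_eq_mul_div, le_div_iff₀ (by positivity)]
            have := pow_le_pow_left₀ (by positivity) h6 2
            linarith
          exact h7.trans (le_add_of_nonneg_left (by positivity))
      · positivity
    · rw [if_neg (fun h => hσ h.1), if_neg hσ, if_neg hσ]; simp
  refine (expect_le_expect fun σ _ => hpt σ).trans ?_
  rw [expect_add_distrib, ← mul_expect, ← mul_expect]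
  have hnk : ((n : ℝ) + k ^ 2) ^ J ≤ 2 ^ J * s ^ (2 * J) := by
    rw [hsJ, ← mul_pow]; gcongr; linarith
  calc _ ≤ 2 / (δ * s ^ J * k) * (2 * J / s ^ (J + 1) * (D * (k ^ 2 * (2 ^ J * s ^ (2 * J)))
          / k.factorial))
        + 4 / (δ * s ^ J * k) ^ 2 * ((k * (C₁ * s ^ (2 * J)) + k ^ 2 * (C₁ * s ^ (2 * J) / s))
          / k.factorial) := by
        rw [← hsJ] at h2
        refine add_le_add (mul_le_mul_of_nonneg_left (h1.trans ?_) (by positivity))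
          (mul_le_mul_of_nonneg_left h2 (by positivity))
        gcongr
    _ = (2 / δ * (2 * J * D * 2 ^ J) * (k / s) + 4 / δ ^ 2 * C₁ * (1 / k + 1 / s))
          / k.factorial := by
        rw [show 2 * J = J + J by ring, pow_add, pow_succ]
        field_simp
        ring
    _ ≤ _ := by
        gcongr
        have h5 : 1 / s ≤ k / s := by gcongr
        have h6 : 0 ≤ 1 / (k : ℝ) := by positivity
        have h7 : 0 ≤ 2 / δ * (2 * J * D * 2 ^ J) := by positivity
        have h8 : 0 ≤ 4 / δ ^ 2 * C₁ := by positivity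
        nlinarith [mul_le_mul_of_nonneg_left h5 h8, mul_nonneg h7 h6]

end SecondMoment

end PieriGrowth

namespace PieriGrowth

/-! ### Young diagrams from row lengths, and invariance under increasing relabelling -/

section Shapes

open scoped Classical
open Finset

variable {α β : Type*} [LinearOrder α] [LinearOrder β]

theorem rowInsert_map {f : α → β} (hf : StrictMono f) (x : α) (r : List α) :
    rowInsert (f x) (r.map f) = ((rowInsert x r).1.map f, (rowInsert x r).2.map f) := by
  induction r with
  | nil => simp [rowInsert]
  | cons a r ih =>
    by_cases h : x < a
    · simp [rowInsert, h, hf.lt_iff_lt]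
    · simp [rowInsert, h, hf.lt_iff_lt, ih]

theorem tableauInsert_map {f : α → β} (hf : StrictMono f) (x : α) (T : List (List α)) :
    tableauInsert (f x) (T.map (List.map f)) = (tableauInsert x T).map (List.map f) := by
  induction T generalizing x with
  | nil => simp [tableauInsert]
  | cons r T ih =>
    have h1 := rowInsert_map hf x r
    cases h : (rowInsert x r).2 with
    | none =>
      have h2 : (rowInsert (f x) (r.map f)).2 = none := by rw [h1, h]; rfl
      rw [List.map_cons, tableauInsert_none h, tableauInsert_none h2, h1, List.map_cons]
    | some y =>
      have h2 : (rowInsert (f x) (r.map f)).2 = some (f y) := by rw [h1, h]; rfl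
      rw [List.map_cons, tableauInsert_some h, tableauInsert_some h2, h1, List.map_cons, ih]

theorem revTab_map {f : α → β} (hf : StrictMono f) (l : List α) :
    revTab (l.map f) = (revTab l).map (List.map f) := by
  induction l with
  | nil => rfl
  | cons x l ih => rw [List.map_cons, revTab_cons, ih, tableauInsert_map hf, revTab_cons]

/-- The RSK shape depends only on the relative order of the letters. -/
theorem tabShape_revTab_map {f : α → β} (hf : StrictMono f) (l : List α) :
    tabShape (revTab (l.map f)) = tabShape (revTab l) := by
  rw [revTab_map hf]
  ext i
  rw [tabShape_apply, tabShape_apply, ← List.map_nil (f := f), List.getD_map, List.length_map]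

theorem mem_rskShape (l : List α) (c : ℕ × ℕ) :
    c ∈ (rskShape l).cells ↔ c.2 < tabShape (revTab l.reverse) c.1 := by
  rw [YoungDiagram.mem_cells, rskShape, YoungDiagram.mem_ofRowLens, tabShape_apply,
    insertionTableau_eq]
  by_cases h : c.1 < (revTab l.reverse).length
  · rw [List.getD_eq_getElem _ _ h]
    simp [h]
  · rw [List.getD_eq_default _ _ (not_lt.1 h)]
    simp [h]

theorem sum_rskShape (g : ℤ → ℝ) (l : List α) :
    ∑ c ∈ (rskShape l).cells, g (uCoord c) = contentSum g (tabShape (revTab l.reverse)) := by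
  have h : (rskShape l).cells = (tabShape (revTab l.reverse)).support.biUnion fun i =>
      (range (tabShape (revTab l.reverse) i)).image fun j => (i, j) := by
    ext ⟨i, j⟩
    rw [mem_rskShape]
    simp only [mem_biUnion, Finsupp.mem_support_iff, mem_image, mem_range, Prod.mk.injEq]
    constructor
    · intro h; exact ⟨i, by omega, j, h, rfl, rfl⟩
    · rintro ⟨i', _, j', h, rfl, rfl⟩; exact h
  rw [h, sum_biUnion, contentSum, Finsupp.sum]
  · refine sum_congr rfl fun i _ => ?_
    rw [sum_image fun a _ b _ hab => (Prod.mk.injEq _ _ _ _ ▸ hab).2]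
    rfl
  · intro i _ i' _ hne
    rw [Function.onFun, disjoint_left]
    rintro ⟨a, b⟩ h1 h2
    simp only [mem_image, mem_range, Prod.mk.injEq] at h1 h2
    obtain ⟨_, _, rfl, _⟩ := h1
    obtain ⟨_, _, rfl, _⟩ := h2
    exact hne rfl

theorem tabShape_revTab_le_append (t p : List α) :
    tabShape (revTab p) ≤ tabShape (revTab (t ++ p)) := by
  rw [tabShape_revTab, tabShape_revTab]
  obtain ⟨s, h, -, -⟩ := revRec_append t p
  rw [h, endShape_append]
  exact le_add_of_nonneg_left zero_le

theorem rskShape_subset (l l' : List α) : (rskShape l).cells ⊆ (rskShape (l ++ l')).cells := by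
  intro c hc
  rw [mem_rskShape] at hc ⊢
  rw [List.reverse_append]
  exact hc.trans_le (tabShape_revTab_le_append _ _ _)

theorem sum_rskShape_sdiff (g : ℤ → ℝ) (l l' : List α) :
    ∑ c ∈ (rskShape (l ++ l')).cells \ (rskShape l).cells, g (uCoord c)
      = contentSum g (tabShape (revTab (l'.reverse ++ l.reverse)))
        - contentSum g (tabShape (revTab l.reverse)) := by
  rw [sum_sdiff_eq_sub (rskShape_subset l l'), sum_rskShape, sum_rskShape, List.reverse_append]

theorem contentSum_one (p : ℕ →₀ ℕ) : contentSum (fun _ => 1) p = p.degree := by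
  simp [contentSum, Finsupp.sum, Finsupp.degree_apply]

theorem card_rskShape_sdiff (l l' : List α) :
    #((rskShape (l ++ l')).cells \ (rskShape l).cells) = l'.length := by
  have h := sum_rskShape_sdiff (fun _ => 1) l l'
  rw [contentSum_one, contentSum_one, tabShape_revTab, tabShape_revTab, degree_endShape,
    degree_endShape, length_revRec, length_revRec] at h
  simp only [sum_const, nsmul_eq_mul, mul_one, List.length_append, List.length_reverse] at h
  push_cast at h
  rw [add_sub_cancel_right] at h
  exact_mod_cast h

end Shapes

/-! ### From uniform random letters to random permutations -/

section Uniform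

open scoped Classical
open Finset BigOperators MeasureTheory ProbabilityTheory

instance isProbabilityMeasure_unit : IsProbabilityMeasure ((volume : Measure ℝ).restrict
    (Set.Icc 0 1)) := ⟨by simp⟩

/-- The law of a family of independent uniform variables on `[0, 1]`. -/
noncomputable def unifLaw (ι : Type*) [Fintype ι] : Measure (ι → ℝ) :=
  Measure.pi fun _ => (volume : Measure ℝ).restrict (Set.Icc 0 1)

instance isProbabilityMeasure_unifLaw (ι : Type*) [Fintype ι] :
    IsProbabilityMeasure (unifLaw ι) := by
  unfold unifLaw; infer_instance

theorem measurePreserving_comp_equiv {ι κ : Type*} [Fintype ι] [Fintype κ] (e : κ ≃ ι) :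
    MeasurePreserving (fun v : ι → ℝ => v ∘ e) (unifLaw ι) (unifLaw κ) :=
  measurePreserving_arrowCongr' (fun _ => (volume : Measure ℝ).restrict (Set.Icc 0 1))
    (fun _ => (volume : Measure ℝ).restrict (Set.Icc 0 1)) e.symm (MeasurableEquiv.refl ℝ)
    fun _ => MeasurePreserving.id _

theorem measurableSet_strictMono (m : ℕ) : MeasurableSet {v : Fin m → ℝ | StrictMono v} := by
  have : {v : Fin m → ℝ | StrictMono v} = ⋂ i, ⋂ j, ⋂ (_ : i < j), {v | v i < v j} := by
    ext v; simp [StrictMono]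
  rw [this]
  exact MeasurableSet.iInter fun i => MeasurableSet.iInter fun j => MeasurableSet.iInter fun _ =>
    measurableSet_lt (measurable_pi_apply i) (measurable_pi_apply j)

theorem unifLaw_strictMono_comp {ι : Type*} [Fintype ι] {m : ℕ} (e : Fin m ≃ ι) :
    unifLaw ι {v | StrictMono (v ∘ e)} = unifLaw (Fin m) {v | StrictMono v} :=
  (measurePreserving_comp_equiv e).measure_preimage (measurableSet_strictMono m).nullMeasurableSet

/-- The `m!` possible orders of the letters are equiprobable and disjoint events. With weak
inequalities they cover everything, which gives the opposite bound in the next lemma. -/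
theorem factorial_mul_unifLaw_strictMono_le (m : ℕ) :
    (m.factorial : ENNReal) * unifLaw (Fin m) {v | StrictMono v} ≤ 1 := by
  have h1 : ∑ σ : Equiv.Perm (Fin m), unifLaw (Fin m) {v | StrictMono (v ∘ σ)}
      = (m.factorial : ENNReal) * unifLaw (Fin m) {v | StrictMono v} := by
    rw [sum_congr rfl fun σ _ => unifLaw_strictMono_comp σ, sum_const, card_univ,
      Fintype.card_perm, Fintype.card_fin, nsmul_eq_mul]
  rw [← h1, ← measure_biUnion_finset]
  · exact prob_le_one
  · intro σ _ τ _ hne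
    rw [Function.onFun, Set.disjoint_left]
    intro v h1 h2
    apply hne
    have h1' : StrictMono (v ∘ σ) := h1
    have h2' : StrictMono (v ∘ τ) := h2
    have h3 := Tuple.unique_monotone h1'.monotone h2'.monotone
    have hv : Function.Injective v := by
      have := h1'.injective.comp σ.symm.injective
      rwa [Function.comp_assoc, Equiv.self_comp_symm, Function.comp_id] at this
    ext i
    rw [hv (congrFun h3 i)]
  · intro σ _
    exact (measurePreserving_comp_equiv σ).measurable (measurableSet_strictMono m)

theorem one_le_factorial_mul_unifLaw_monotone (m : ℕ) :
    1 ≤ (m.factorial : ENNReal) * unifLaw (Fin m) {v | Monotone v} := by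
  have h2 : ∀ σ : Equiv.Perm (Fin m), unifLaw (Fin m) {v | Monotone (v ∘ σ)}
      = unifLaw (Fin m) {v | Monotone v} := fun σ =>
    (measurePreserving_comp_equiv σ).measure_preimage
      isClosed_monotone.measurableSet.nullMeasurableSet
  have h1 : ∑ σ : Equiv.Perm (Fin m), unifLaw (Fin m) {v | Monotone (v ∘ σ)}
      = (m.factorial : ENNReal) * unifLaw (Fin m) {v | Monotone v} := by
    rw [sum_congr rfl fun σ _ => h2 σ, sum_const, card_univ,
      Fintype.card_perm, Fintype.card_fin, nsmul_eq_mul]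
  rw [← h1, ← measure_univ (μ := unifLaw (Fin m))]
  refine le_trans (measure_mono fun v _ => ?_)
    (measure_biUnion_finset_le univ fun σ : Equiv.Perm (Fin m) => {v | Monotone (v ∘ σ)})
  simp only [Set.mem_iUnion]
  exact ⟨Tuple.sort v, mem_univ _, Tuple.monotone_sort v⟩

/-- Ties lie in finitely many proper hyperplanes. -/
theorem unifLaw_not_injective (ι : Type*) [Fintype ι] :
    unifLaw ι {v | ¬ Function.Injective v} = 0 := by
  have h1 : {v : ι → ℝ | ¬ Function.Injective v} ⊆ ⋃ i, ⋃ j, ⋃ (_ : i ≠ j), {v | v i = v j} := by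
    intro v hv
    simp only [Function.Injective, not_forall] at hv
    obtain ⟨i, j, h, hne⟩ := hv
    simp only [Set.mem_iUnion]
    exact ⟨i, j, hne, h⟩
  refine measure_mono_null h1 ?_
  rw [measure_iUnion_null_iff]; intro i
  rw [measure_iUnion_null_iff]; intro j
  rw [measure_iUnion_null_iff]; intro hij
  rw [unifLaw, ← Measure.restrict_pi_pi]
  refine le_antisymm ((Measure.restrict_apply_le _ _).trans ?_) zero_le
  have h2 := Measure.addHaar_submodule (volume : Measure (ι → ℝ))
    (LinearMap.ker (LinearMap.proj (R := ℝ) (φ := fun _ : ι => ℝ) i - LinearMap.proj j)) (by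
      intro htop
      have h3 : (Pi.single i 1 : ι → ℝ) ∈ LinearMap.ker
        (LinearMap.proj (R := ℝ) (φ := fun _ : ι => ℝ) i - LinearMap.proj j) := htop ▸ trivial
      simp [hij.symm] at h3)
  rw [volume_pi] at h2
  refine le_of_eq (Eq.trans ?_ h2)
  congr 1
  ext v
  simp [sub_eq_zero]

/-- Increasing order has probability at least `1 / k!`, so conditioning on it costs a factor of at
most `k!`. An upper bound is all that is needed, and it holds without measurability of `S`. -/
theorem inputLaw_le (n k : ℕ) (S : Set ((Fin n → ℝ) × (Fin k → ℝ))) :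
    inputLaw n k S ≤ k.factorial * unifLaw (Fin n ⊕ Fin k)
      {v | (v ∘ Sum.inl, v ∘ Sum.inr) ∈ S ∧ Monotone (v ∘ Sum.inr)} := by
  have hM : MeasurableSet {b : Fin k → ℝ | Monotone b} := isClosed_monotone.measurableSet
  have h1 : inputLaw n k S = (unifLaw (Fin k) {b | Monotone b})⁻¹ *
      ((unifLaw (Fin n)).prod (unifLaw (Fin k))) (S ∩ Set.univ ×ˢ {b | Monotone b}) := by
    have h2 : inputLaw n k = (unifLaw (Fin n)).prod
      ((unifLaw (Fin k) {b | Monotone b})⁻¹ • (unifLaw (Fin k)).restrict {b | Monotone b}) := rfl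
    rw [h2, Measure.prod_smul_right, Measure.smul_apply, smul_eq_mul]
    congr 1
    conv_lhs => rw [← Measure.restrict_univ (μ := unifLaw (Fin n))]
    rw [Measure.prod_restrict, Measure.restrict_apply' (MeasurableSet.univ.prod hM)]
  rw [h1]
  gcongr
  · have h2 := one_le_factorial_mul_unifLaw_monotone k
    set x := unifLaw (Fin k) {b | Monotone b}
    calc x⁻¹ = 1 * x⁻¹ := (one_mul _).symm
      _ ≤ k.factorial * x * x⁻¹ := by gcongr
      _ = k.factorial * (x * x⁻¹) := mul_assoc _ _ _
      _ ≤ k.factorial * 1 := by gcongr; exact ENNReal.mul_inv_le_one x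
      _ = _ := mul_one _
  · have h3 := measurePreserving_sumPiEquivProdPi (X := fun _ : Fin n ⊕ Fin k => ℝ)
      (fun _ => (volume : Measure ℝ).restrict (Set.Icc 0 1))
    have h4 := h3.measure_preimage_equiv (S ∩ Set.univ ×ˢ {b | Monotone b})
    change _ = ((unifLaw (Fin n)).prod (unifLaw (Fin k))) _ at h4
    rw [← h4]
    refine measure_mono fun v hv => ?_
    exact ⟨hv.1, hv.2.2⟩

/-- The places of the first letters, the last one first. -/
def headPlaces (n k : ℕ) : List (Fin n ⊕ Fin k) := (List.ofFn Sum.inl).reverse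

/-- The places of the last letters, the last one first. -/
def tailPlaces (n k : ℕ) : List (Fin n ⊕ Fin k) := (List.ofFn Sum.inr).reverse

theorem length_headPlaces (n k : ℕ) : (headPlaces n k).length = n := by simp [headPlaces]

theorem length_tailPlaces (n k : ℕ) : (tailPlaces n k).length = k := by simp [tailPlaces]

theorem map_headPlaces {n k : ℕ} {β : Type*} (v : Fin n ⊕ Fin k → β) :
    (headPlaces n k).map v = (List.ofFn (v ∘ Sum.inl)).reverse := by
  rw [headPlaces, List.map_reverse, List.map_ofFn]

theorem map_tailPlaces {n k : ℕ} {β : Type*} (v : Fin n ⊕ Fin k → β) :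
    (tailPlaces n k).map v = (List.ofFn (v ∘ Sum.inr)).reverse := by
  rw [tailPlaces, List.map_reverse, List.map_ofFn]

theorem nodup_places (n k : ℕ) : (tailPlaces n k ++ headPlaces n k).Nodup := by
  rw [List.nodup_append]
  refine ⟨?_, ?_, ?_⟩
  · rw [tailPlaces, List.nodup_reverse, List.nodup_ofFn]; exact Sum.inr_injective
  · rw [headPlaces, List.nodup_reverse, List.nodup_ofFn]; exact Sum.inl_injective
  · intro x hx y hy
    simp only [tailPlaces, headPlaces, List.mem_reverse, List.mem_ofFn] at hx hy
    obtain ⟨i, rfl⟩ := hx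
    obtain ⟨j, rfl⟩ := hy
    simp

/-- Probabilities of events that depend only on the two shapes are averages over permutations. -/
theorem inputLaw_shapes_le (n k : ℕ) (D : (ℕ →₀ ℕ) → (ℕ →₀ ℕ) → Prop) :
    inputLaw n k {ω | D (tabShape (revTab (List.ofFn ω.1).reverse))
        (tabShape (revTab ((List.ofFn ω.2).reverse ++ (List.ofFn ω.1).reverse)))}
      ≤ ENNReal.ofReal (k.factorial * 𝔼 σ : Equiv.Perm (Fin n ⊕ Fin k),
        if ((tailPlaces n k).map (finSumFinEquiv ∘ σ)).Pairwise (· ≥ ·) ∧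
          D (tabShape (revTab ((headPlaces n k).map (finSumFinEquiv ∘ σ))))
            (tabShape (revTab ((tailPlaces n k ++ headPlaces n k).map (finSumFinEquiv ∘ σ))))
        then (1 : ℝ) else 0) := by
  set N := n + k with hN
  set B : Finset (Equiv.Perm (Fin n ⊕ Fin k)) := {σ : Equiv.Perm (Fin n ⊕ Fin k) |
    ((tailPlaces n k).map (finSumFinEquiv ∘ σ)).Pairwise (· ≥ ·) ∧
          D (tabShape (revTab ((headPlaces n k).map (finSumFinEquiv ∘ σ))))
            (tabShape (revTab ((tailPlaces n k ++ headPlaces n k).map (finSumFinEquiv ∘ σ))))}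
    with hB
  let e : Equiv.Perm (Fin n ⊕ Fin k) → (Fin N ≃ Fin n ⊕ Fin k) := fun σ =>
    finSumFinEquiv.symm.trans σ.symm
  have hsub : {v : Fin n ⊕ Fin k → ℝ | (v ∘ Sum.inl, v ∘ Sum.inr) ∈
      {ω : (Fin n → ℝ) × (Fin k → ℝ) | D (tabShape (revTab (List.ofFn ω.1).reverse))
        (tabShape (revTab ((List.ofFn ω.2).reverse ++ (List.ofFn ω.1).reverse)))} ∧
        Monotone (v ∘ Sum.inr)}
      ⊆ {v | ¬ Function.Injective v} ∪ ⋃ σ ∈ B, {v | StrictMono (v ∘ e σ)} := by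
    rintro v ⟨hD, hmono⟩
    by_cases hv : Function.Injective v
    swap
    · exact Or.inl hv
    right
    -- `ρ` sorts the letters. Then `v` is a strictly increasing function of the ranks
    -- `finSumFinEquiv ∘ σ`, and the shapes see only the ranks.
    let ρ : Equiv.Perm (Fin N) := Tuple.sort (v ∘ finSumFinEquiv.symm)
    let σ : Equiv.Perm (Fin n ⊕ Fin k) :=
      (finSumFinEquiv.trans ρ.symm).trans finSumFinEquiv.symm
    have hf : StrictMono (v ∘ e σ) := by
      have h1 : v ∘ e σ = (v ∘ finSumFinEquiv.symm) ∘ ρ := by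
        funext i; simp [e, σ]
      rw [h1]
      exact (Tuple.monotone_sort _).strictMono_of_injective
        ((hv.comp finSumFinEquiv.symm.injective).comp ρ.injective)
    have hvf : v = (v ∘ e σ) ∘ (finSumFinEquiv ∘ σ) := by
      funext i; simp [e]
    simp only [Set.mem_iUnion]
    refine ⟨σ, ?_, hf⟩
    rw [hB, mem_filter]
    refine ⟨mem_univ _, ?_, ?_⟩
    · rw [map_tailPlaces, List.pairwise_reverse, List.pairwise_ofFn]
      intro i j hij
      have := hmono hij.le
      rw [hvf] at this
      exact hf.le_iff_le.1 this
    · have hD' : D (tabShape (revTab (List.ofFn (v ∘ Sum.inl)).reverse))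
        (tabShape (revTab ((List.ofFn (v ∘ Sum.inr)).reverse
          ++ (List.ofFn (v ∘ Sum.inl)).reverse))) := hD
      rw [← map_headPlaces, ← map_tailPlaces, ← List.map_append] at hD'
      have key : ∀ l : List (Fin n ⊕ Fin k), tabShape (revTab (l.map v))
          = tabShape (revTab (l.map (finSumFinEquiv ∘ σ))) := fun l => by
        conv_lhs => rw [hvf]
        rw [← List.map_map, tabShape_revTab_map hf]
      rwa [key, key] at hD'
  have hQ : unifLaw (Fin n ⊕ Fin k) {v | (v ∘ Sum.inl, v ∘ Sum.inr) ∈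
      {ω : (Fin n → ℝ) × (Fin k → ℝ) | D (tabShape (revTab (List.ofFn ω.1).reverse))
        (tabShape (revTab ((List.ofFn ω.2).reverse ++ (List.ofFn ω.1).reverse)))} ∧
        Monotone (v ∘ Sum.inr)} ≤ #B * (N.factorial : ENNReal)⁻¹ := by
    refine (measure_mono hsub).trans ((measure_union_le _ _).trans ?_)
    rw [unifLaw_not_injective, zero_add]
    refine (measure_biUnion_finset_le _ _).trans ?_
    rw [sum_congr rfl fun σ _ => unifLaw_strictMono_comp (e σ), sum_const, nsmul_eq_mul]
    gcongr
    rw [← one_div, ENNReal.le_div_iff_mul_le (by simp [Nat.factorial_ne_zero]) (by simp), mul_comm]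
    exact factorial_mul_unifLaw_strictMono_le N
  refine (inputLaw_le n k _).trans ((mul_le_mul_right hQ _).trans (le_of_eq ?_))
  rw [Fintype.expect_eq_sum_div_card, sum_boole, Fintype.card_perm, Fintype.card_sum,
    Fintype.card_fin, Fintype.card_fin, ENNReal.ofReal_mul (by positivity),
    ENNReal.ofReal_div_of_pos (by positivity), ENNReal.ofReal_natCast, ENNReal.ofReal_natCast,
    ENNReal.ofReal_natCast, div_eq_mul_inv]

end Uniform

end PieriGrowth

namespace PieriGrowth

/-! ### Moments of the semicircle distribution -/

section Semicircle

open MeasureTheory ProbabilityTheory Filter Topology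

theorem integral_sqrt_four_sub_sq : ∫ w in (-2 : ℝ)..2, √(4 - w ^ 2) = 2 * Real.pi := by
  have h := intervalIntegral.mul_integral_comp_mul_left (a := -1) (b := 1) (c := (2 : ℝ))
    (f := fun w => √(4 - w ^ 2))
  have h2 : ∀ x : ℝ, √(4 - (2 * x) ^ 2) = 2 * √(1 - x ^ 2) := fun x => by
    rw [show 4 - (2 * x) ^ 2 = 2 ^ 2 * (1 - x ^ 2) by ring, Real.sqrt_mul (by norm_num),
      Real.sqrt_sq (by norm_num)]
  simp only [h2, intervalIntegral.integral_const_mul, integral_sqrt_one_sub_sq] at h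
  norm_num at h
  rw [← h]; ring

/-- The integrand is the derivative of `P w * (4 - w ^ 2) ^ (3 / 2)`, which vanishes at both
endpoints. Monomials `P` yield the recursion of the moments. -/
theorem integral_deriv_semicircle (P P' : ℝ → ℝ) (hP : ∀ w, HasDerivAt P (P' w) w)
    (hP' : Continuous P') :
    ∫ w in (-2 : ℝ)..2, (P' w * (4 - w ^ 2) - 3 * (P w * w)) * √(4 - w ^ 2) = 0 := by
  have hPc : Continuous P := continuous_iff_continuousAt.2 fun w => (hP w).continuousAt
  have h := intervalIntegral.integral_eq_sub_of_hasDerivAt_of_le (a := -2) (b := 2) (by norm_num)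
    (f := fun w => P w * ((4 - w ^ 2) * √(4 - w ^ 2)))
    (f' := fun w => (P' w * (4 - w ^ 2) - 3 * (P w * w)) * √(4 - w ^ 2)) (by fun_prop) ?_ ?_
  · rw [h]; norm_num
  · intro w hw
    have hpos : 0 < 4 - w ^ 2 := by nlinarith [hw.1, hw.2]
    have h1 : HasDerivAt (fun w : ℝ => 4 - w ^ 2) (-(2 * w)) w := by
      simpa using (hasDerivAt_pow 2 w).const_sub 4
    have h2 := (hP w).mul (h1.mul (h1.sqrt hpos.ne'))
    refine h2.congr_deriv ?_
    have h3 : √(4 - w ^ 2) ≠ 0 := (Real.sqrt_pos.2 hpos).ne'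
    have h5 : (4 - w ^ 2) * (-(2 * w) / (2 * √(4 - w ^ 2))) = -w * √(4 - w ^ 2) := by
      nth_rewrite 1 [← Real.sq_sqrt hpos.le]
      field_simp
    rw [h5, Pi.mul_apply]
    ring
  · exact Continuous.intervalIntegrable (by fun_prop) _ _

/-- The unnormalized moments of the semicircle distribution. -/
theorem integral_pow_semicircle_succ (J : ℕ) :
    ((J : ℝ) + 4) * ∫ w in (-2 : ℝ)..2, w ^ (J + 2) * √(4 - w ^ 2)
      = 4 * (J + 1) * ∫ w in (-2 : ℝ)..2, w ^ J * √(4 - w ^ 2) := by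
  have h := integral_deriv_semicircle (fun w => w ^ (J + 1)) (fun w => ((J : ℝ) + 1) * w ^ J)
    (fun w => by simpa using hasDerivAt_pow (J + 1) w) (by fun_prop)
  have h2 : ∀ w : ℝ, (((J : ℝ) + 1) * w ^ J * (4 - w ^ 2) - 3 * (w ^ (J + 1) * w)) * √(4 - w ^ 2)
      = 4 * (J + 1) * (w ^ J * √(4 - w ^ 2)) - (J + 4) * (w ^ (J + 2) * √(4 - w ^ 2)) :=
    fun w => by ring
  simp only [h2] at h
  rw [intervalIntegral.integral_sub, intervalIntegral.integral_const_mul,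
    intervalIntegral.integral_const_mul] at h
  · linarith
  · exact Continuous.intervalIntegrable (by fun_prop) _ _
  · exact Continuous.intervalIntegrable (by fun_prop) _ _

theorem integral_id_semicircle : ∫ w in (-2 : ℝ)..2, w ^ 1 * √(4 - w ^ 2) = 0 := by
  have h := integral_deriv_semicircle (fun _ => 1) (fun _ => 0)
    (fun w => hasDerivAt_const w 1) (by fun_prop)
  have h2 : ∀ w : ℝ, ((0 : ℝ) * (4 - w ^ 2) - 3 * (1 * w)) * √(4 - w ^ 2)
      = (-3) * (w ^ 1 * √(4 - w ^ 2)) := fun w => by ring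
  simp only [h2, intervalIntegral.integral_const_mul] at h
  linarith

/-- The moments of the semicircle distribution. -/
noncomputable def scMoment (J : ℕ) : ℝ :=
  if Even J then (J.factorial : ℝ) / (J / 2 + 1).factorial / (J / 2).factorial else 0

theorem integral_pow_semicircle (J : ℕ) :
    ∫ w in (-2 : ℝ)..2, w ^ J * √(4 - w ^ 2) = 2 * Real.pi * scMoment J := by
  induction J using Nat.strong_induction_on with
  | _ J ih =>
  match J with
  | 0 => simp [scMoment, integral_sqrt_four_sub_sq]
  | 1 => rw [integral_id_semicircle, scMoment, if_neg (by simp)]; simp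
  | J + 2 =>
    have h1 := integral_pow_semicircle_succ J
    rw [ih J (by omega)] at h1
    have h2 : ((J : ℝ) + 4) * scMoment (J + 2) = 4 * (J + 1) * scMoment J := by
      rw [scMoment, scMoment]
      by_cases he : Even J
      · rw [if_pos he, if_pos (by simpa [Nat.even_add] using he)]
        obtain ⟨l, rfl⟩ := he.two_dvd
        rw [show (2 * l + 2) / 2 = l + 1 by omega, show 2 * l / 2 = l by omega,
          Nat.factorial_succ (2 * l + 1), Nat.factorial_succ (2 * l),
          Nat.factorial_succ (l + 1), Nat.factorial_succ l]
        have := Nat.factorial_ne_zero l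
        push_cast
        field_simp
        ring
      · rw [if_neg he, if_neg (by simpa [Nat.even_add] using he)]; simp
    have h3 : (0 : ℝ) < (J : ℝ) + 4 := by positivity
    refine mul_left_cancel₀ h3.ne' ?_
    rw [h1]
    linear_combination (-(2 * Real.pi)) * h2

theorem integral_semicircle (f : ℝ → ℝ) :
    ∫ w, f w ∂semicircle = (2 * Real.pi)⁻¹ * ∫ w in (-2 : ℝ)..2, f w * √(4 - w ^ 2) := by
  rw [semicircle, integral_withDensity_eq_integral_toReal_smul (by fun_prop)
    (ae_of_all _ fun _ => ENNReal.ofReal_lt_top), integral_Icc_eq_integral_Ioc,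
    ← intervalIntegral.integral_of_le (by norm_num), ← intervalIntegral.integral_const_mul]
  congr 1
  ext w
  rw [ENNReal.toReal_ofReal (by positivity), smul_eq_mul]
  ring

instance isProbabilityMeasure_semicircle : IsProbabilityMeasure semicircle := by
  refine ⟨?_⟩
  rw [semicircle, withDensity_apply _ MeasurableSet.univ, Measure.restrict_univ,
    ← ofReal_integral_eq_lintegral_ofReal]
  · rw [integral_Icc_eq_integral_Ioc, ← intervalIntegral.integral_of_le (by norm_num),
      intervalIntegral.integral_const_mul, integral_sqrt_four_sub_sq]
    have := Real.pi_pos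
    rw [show 1 / (2 * Real.pi) * (2 * Real.pi) = 1 by field_simp, ENNReal.ofReal_one]
  · exact Continuous.integrableOn_Icc (by fun_prop)
  · exact ae_of_all _ fun w => by positivity

theorem moment_semicircle (J : ℕ) : ∫ w, w ^ J ∂semicircle = scMoment J := by
  rw [integral_semicircle, integral_pow_semicircle]
  have := Real.pi_pos
  field_simp

theorem ae_semicircle : ∀ᵐ w ∂semicircle, w ∈ Set.Icc (-2 : ℝ) 2 := by
  have h : semicircle ≪ (volume : Measure ℝ).restrict (Set.Icc (-2) 2) :=
    withDensity_absolutelyContinuous _ _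
  exact h.ae_le (ae_restrict_mem measurableSet_Icc)

theorem integrable_pow_semicircle (J : ℕ) : Integrable (fun w : ℝ => w ^ J) semicircle := by
  refine Integrable.of_bound (by fun_prop) (2 ^ J) ?_
  filter_upwards [ae_semicircle] with w hw
  rw [Real.norm_eq_abs, abs_pow]
  exact pow_le_pow_left₀ (abs_nonneg _) (abs_le.2 hw) J

theorem scMoment_two_mul_le (D : ℕ) : scMoment (2 * D) ≤ 4 ^ D := by
  rw [← moment_semicircle]
  calc ∫ w, w ^ (2 * D) ∂semicircle ≤ ∫ _, (4 : ℝ) ^ D ∂semicircle := by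
        refine integral_mono_ae (integrable_pow_semicircle _) (integrable_const _) ?_
        filter_upwards [ae_semicircle] with w hw
        simp only [pow_mul]
        refine pow_le_pow_left₀ (sq_nonneg w) ?_ D
        nlinarith [hw.1, hw.2]
    _ = 4 ^ D := by simp

theorem semicircle_Ioc_le (u : ℝ) {η : ℝ} (hη : 0 ≤ η) : semicircle.real (Set.Ioc u (u + η)) ≤ η := by
  have h1 : semicircle (Set.Ioc u (u + η)) ≤ ENNReal.ofReal η := by
    rw [semicircle, withDensity_apply _ measurableSet_Ioc]
    calc _ ≤ ∫⁻ _ in Set.Ioc u (u + η), 1 ∂((volume : Measure ℝ).restrict (Set.Icc (-2) 2)) := by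
          refine lintegral_mono fun w => ?_
          rw [← ENNReal.ofReal_one]
          refine ENNReal.ofReal_le_ofReal ?_
          have h2 : √(4 - w ^ 2) ≤ 2 := by
            rw [Real.sqrt_le_left (by norm_num)]; nlinarith [sq_nonneg w]
          have h3 := Real.pi_gt_three
          rw [div_mul_eq_mul_div, one_mul, div_le_one (by positivity)]
          linarith
      _ ≤ volume (Set.Ioc u (u + η)) := by
          rw [setLIntegral_one]; exact Measure.restrict_apply_le _ _
      _ = ENNReal.ofReal η := by rw [Real.volume_Ioc]; congr 1; ring
  exact ENNReal.toReal_le_of_le_ofReal hη h1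

/-- In even degree `2 * l`, `n.choose l` is equivalent to `n ^ l / l!`, and the limit is the Catalan
number `(2 * l)! / (l! * (l + 1)!)`. -/
theorem tendsto_momCenter_div (J : ℕ) :
    Tendsto (fun n : ℕ => momCenter J n / √(n : ℝ) ^ J) atTop (𝓝 (scMoment J)) := by
  by_cases he : Even J
  · obtain ⟨l, rfl⟩ := he.two_dvd
    have h1 : ∀ n : ℕ, momCenter (2 * l) n / √(n : ℝ) ^ (2 * l)
        = ((2 * l).factorial : ℝ) / (l + 1).factorial * (n.choose l / (n : ℝ) ^ l) := fun n => by
      rw [momCenter, if_pos he, sqrt_pow_two_mul, show 2 * l / 2 = l by omega]; ring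
    simp only [h1]
    rw [scMoment, if_pos he, show 2 * l / 2 = l by omega, div_eq_mul_one_div _ (l.factorial : ℝ)]
    refine Tendsto.const_mul _ ?_
    have h2 := (Asymptotics.isEquivalent_iff_tendsto_one (by
      filter_upwards [eventually_ge_atTop 1] with n hn
      positivity)).1 (isEquivalent_choose l)
    have h3 := h2.mul_const (1 / (l.factorial : ℝ))
    rw [one_mul] at h3
    refine h3.congr fun n => ?_
    have := Nat.factorial_ne_zero l
    simp only [Pi.div_apply]
    field_simp
  · simp only [momCenter, scMoment, if_neg he, zero_div]
    exact tendsto_const_nhds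

end Semicircle

/-! ### From finitely many moments to integrals and distribution functions -/

section Moments

open MeasureTheory ProbabilityTheory Filter Topology

/-- Approximation of a bounded continuous function by a polynomial, with a control at infinity. -/
theorem exists_polynomial_approx (f : BoundedContinuousFunction ℝ ℝ) {ε : ℝ} (hε : 0 < ε) :
    ∃ (P : Polynomial ℝ) (D : ℕ) (η : ℝ), 0 ≤ η ∧ η ≤ ε ∧ η * 4 ^ D ≤ ε ∧
      ∀ x, |f x - P.eval x| ≤ ε + η * x ^ (2 * D) := by
  obtain ⟨P, hP⟩ := exists_polynomial_near_of_continuousOn (-3) 3 f f.continuous.continuousOn ε hε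
  set d := P.natDegree with hd
  set K : ℝ := ‖f‖ + ∑ i ∈ Finset.range (d + 1), |P.coeff i| with hK
  have hK0 : 0 ≤ K := by positivity
  have htail : ∀ x : ℝ, 3 < |x| → |f x - P.eval x| ≤ K * x ^ (2 * d) := by
    intro x hx
    have hx1 : 1 ≤ |x| := by linarith
    have h1 : |f x| ≤ ‖f‖ := f.norm_coe_le_norm x
    have h2 : x ^ (2 * d) = |x| ^ (2 * d) := by rw [pow_mul, pow_mul, sq_abs]
    have h3 : |P.eval x| ≤ (∑ i ∈ Finset.range (d + 1), |P.coeff i|) * |x| ^ (2 * d) := by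
      rw [Polynomial.eval_eq_sum_range, Finset.sum_mul]
      refine (Finset.abs_sum_le_sum_abs _ _).trans (Finset.sum_le_sum fun i hi => ?_)
      rw [abs_mul, abs_pow]
      have : i ≤ 2 * d := by have := Finset.mem_range.1 hi; omega
      gcongr
    have h4 : ‖f‖ ≤ ‖f‖ * |x| ^ (2 * d) := le_mul_of_one_le_right (norm_nonneg _) (one_le_pow₀ hx1)
    calc |f x - P.eval x| ≤ |f x| + |P.eval x| := abs_sub _ _
      _ ≤ _ := by rw [hK, h2, add_mul]; linarith
  -- For `|x| > 3` the tail bound may be multiplied by `(x ^ 2 / 9) ^ L`. Against the semicircle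
  -- moments, at most `4 ^ (d + L)`, this leaves the factor `(4 / 9) ^ L`.
  have hlim : Tendsto (fun L : ℕ => K * 4 ^ d * (4 / 9 : ℝ) ^ L) atTop (𝓝 0) := by
    simpa using (tendsto_pow_atTop_nhds_zero_of_lt_one (by norm_num : (0 : ℝ) ≤ 4 / 9)
      (by norm_num)).const_mul (K * 4 ^ d)
  obtain ⟨L, hL⟩ := ((tendsto_order.1 hlim).2 ε hε).exists
  have h9 : K * (1 / 9) ^ L * 4 ^ (d + L) ≤ ε := by
    have : K * (1 / 9) ^ L * 4 ^ (d + L) = K * 4 ^ d * (4 / 9 : ℝ) ^ L := by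
      rw [pow_add, show (4 / 9 : ℝ) = 1 / 9 * 4 by norm_num, mul_pow]; ring
    rw [this]; exact hL.le
  refine ⟨P, d + L, K * (1 / 9) ^ L, by positivity, ?_, h9, fun x => ?_⟩
  · exact (le_mul_of_one_le_right (by positivity) (one_le_pow₀ (by norm_num))).trans h9
  · rcases le_or_gt |x| 3 with hx | hx
    · have h1 := hP x (abs_le.1 hx)
      rw [abs_sub_comm] at h1
      have h2 : 0 ≤ K * (1 / 9) ^ L * x ^ (2 * (d + L)) := by
        rw [pow_mul]; positivity
      linarith
    · refine (htail x hx).trans (le_add_of_nonneg_of_le hε.le ?_)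
      have h9 : 1 ≤ 1 / 9 * x ^ 2 := by rw [← sq_abs]; nlinarith
      calc K * x ^ (2 * d) ≤ K * x ^ (2 * d) * (1 / 9 * x ^ 2) ^ L := by
            refine le_mul_of_one_le_right ?_ (one_le_pow₀ h9)
            rw [pow_mul]; positivity
        _ = _ := by rw [mul_pow, mul_add, pow_add, pow_mul x 2 L]; ring

theorem abs_integral_sub_polynomial_le {m : Measure ℝ} [IsProbabilityMeasure m]
    (hm : ∀ J : ℕ, Integrable (fun x : ℝ => x ^ J) m) (f : BoundedContinuousFunction ℝ ℝ)
    {P : Polynomial ℝ} {D : ℕ} {ε η : ℝ} (h : ∀ x, |f x - P.eval x| ≤ ε + η * x ^ (2 * D)) :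
    |∫ x, f x ∂m - ∑ i ∈ Finset.range (P.natDegree + 1), P.coeff i * ∫ x, x ^ i ∂m|
      ≤ ε + η * ∫ x, x ^ (2 * D) ∂m := by
  have h1 : ∫ x, P.eval x ∂m
      = ∑ i ∈ Finset.range (P.natDegree + 1), P.coeff i * ∫ x, x ^ i ∂m := by
    simp only [Polynomial.eval_eq_sum_range]
    rw [integral_finsetSum _ fun i _ => (hm i).const_mul _]
    simp only [integral_const_mul]
  have h2 : Integrable (fun x => P.eval x) m := by
    simp only [Polynomial.eval_eq_sum_range]
    exact integrable_finsetSum _ fun i _ => (hm i).const_mul _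
  rw [← h1, ← integral_sub (f.integrable m) h2]
  calc |∫ x, (f x - P.eval x) ∂m| ≤ ∫ x, |f x - P.eval x| ∂m := abs_integral_le_integral_abs
    _ ≤ ∫ x, (ε + η * x ^ (2 * D)) ∂m :=
        integral_mono ((f.integrable m).sub h2).abs
          ((integrable_const _).add ((hm _).const_mul _)) h
    _ = _ := by
        rw [integral_add (integrable_const _) ((hm _).const_mul _), integral_const_mul]
        simp

/-- Closeness of finitely many moments to those of the semicircle distribution implies closeness of
the integrals of a given bounded continuous function. -/
theorem exists_moments_close (f : BoundedContinuousFunction ℝ ℝ) {ε : ℝ} (hε : 0 < ε) :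
    ∃ (s : Finset ℕ) (δ : ℝ), 0 < δ ∧ (∀ J ∈ s, 1 ≤ J) ∧
      ∀ m : Measure ℝ, IsProbabilityMeasure m → (∀ J : ℕ, Integrable (fun x : ℝ => x ^ J) m) →
        (∀ J ∈ s, |∫ x, x ^ J ∂m - scMoment J| ≤ δ) →
        |∫ x, f x ∂m - ∫ x, f x ∂semicircle| ≤ ε := by
  obtain ⟨P, D, η, hη0, hη, hηD, hP⟩ := exists_polynomial_approx f (ε := ε / 6) (by positivity)
  set d := P.natDegree
  set A : ℝ := ∑ i ∈ Finset.range (d + 1), |P.coeff i| with hA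
  have hA0 : 0 ≤ A := by positivity
  -- The second bound absorbs the coefficients of `P`; `δ ≤ 1` keeps the moment of order `2 * D`
  -- below `4 ^ D + 1`, so that both `η ≤ ε / 6` and `η * 4 ^ D ≤ ε / 6` are used.
  set δ : ℝ := min 1 (ε / 6 / (A + 1)) with hδ
  have hδ0 : 0 < δ := by positivity
  refine ⟨Finset.Icc 1 (d + 2 * D), δ, hδ0, fun J hJ => (Finset.mem_Icc.1 hJ).1, ?_⟩
  intro m _ hm hclose
  have hall : ∀ J, J ≤ d + 2 * D → |∫ x, x ^ J ∂m - scMoment J| ≤ δ := by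
    intro J hJ
    rcases Nat.eq_zero_or_pos J with rfl | hJ0
    · simp [scMoment, hδ0.le]
    · exact hclose J (Finset.mem_Icc.2 ⟨hJ0, hJ⟩)
  have h1 := abs_integral_sub_polynomial_le hm f hP
  have h2 := abs_integral_sub_polynomial_le integrable_pow_semicircle f hP
  simp only [moment_semicircle] at h2
  have h3 : |∑ i ∈ Finset.range (d + 1), P.coeff i * ∫ x, x ^ i ∂m
      - ∑ i ∈ Finset.range (d + 1), P.coeff i * scMoment i| ≤ ε / 6 := by
    rw [← Finset.sum_sub_distrib]
    calc _ ≤ ∑ i ∈ Finset.range (d + 1), |P.coeff i| * δ := by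
          refine (Finset.abs_sum_le_sum_abs _ _).trans (Finset.sum_le_sum fun i hi => ?_)
          rw [← mul_sub, abs_mul]
          have := hall i (by have := Finset.mem_range.1 hi; omega)
          gcongr
      _ = A * δ := by rw [hA, Finset.sum_mul]
      _ ≤ A * (ε / 6 / (A + 1)) := by gcongr; exact min_le_right _ _
      _ ≤ ε / 6 := by
          rw [mul_div_assoc', div_le_iff₀ (by positivity)]
          nlinarith
  have h4 : η * ∫ x, x ^ (2 * D) ∂m ≤ ε / 3 := by
    have h5 := (abs_le.1 (hall (2 * D) (by omega))).2
    have h6 := scMoment_two_mul_le D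
    have h7 : δ ≤ 1 := min_le_left _ _
    calc η * ∫ x, x ^ (2 * D) ∂m ≤ η * (4 ^ D + 1) := by gcongr; linarith
      _ ≤ ε / 3 := by linarith
  have h8 : η * scMoment (2 * D) ≤ ε / 6 :=
    (mul_le_mul_of_nonneg_left (scMoment_two_mul_le D) hη0).trans hηD
  rw [abs_le] at *
  constructor <;> linarith [h1.1, h1.2, h2.1, h2.2, h3.1, h3.2]

/-- A continuous approximation of the indicator of a half line. -/
noncomputable def ramp (u η : ℝ) : BoundedContinuousFunction ℝ ℝ :=
  BoundedContinuousFunction.mkOfBound ⟨fun x => max 0 (min 1 (1 - (x - u) / η)), by fun_prop⟩ 1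
    (by
      intro x y
      rw [Real.dist_eq, abs_le]
      have h1 : ∀ z : ℝ, 0 ≤ max 0 (min 1 z) := fun z => le_max_left _ _
      have h2 : ∀ z : ℝ, max 0 (min 1 z) ≤ 1 := fun z => max_le zero_le_one (min_le_left _ _)
      simp only [ContinuousMap.coe_mk]
      constructor <;> linarith [h1 (1 - (x - u) / η), h2 (1 - (x - u) / η),
        h1 (1 - (y - u) / η), h2 (1 - (y - u) / η)])

theorem ramp_apply (u η x : ℝ) : ramp u η x = max 0 (min 1 (1 - (x - u) / η)) := rfl

theorem real_Iic_le_integral_ramp (m : Measure ℝ) [IsProbabilityMeasure m] (u : ℝ) {η : ℝ}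
    (hη : 0 < η) : m.real (Set.Iic u) ≤ ∫ x, ramp u η x ∂m := by
  rw [← integral_indicator_one measurableSet_Iic]
  refine integral_mono ((integrable_const 1).indicator measurableSet_Iic) ((ramp u η).integrable m)
    fun x => ?_
  rw [ramp_apply]
  by_cases hx : x ≤ u
  · rw [Set.indicator_of_mem (Set.mem_Iic.2 hx)]
    have : 0 ≤ (u - x) / η := div_nonneg (by linarith) hη.le
    refine le_max_of_le_right (le_min le_rfl ?_)
    rw [show (x - u) / η = -((u - x) / η) by ring]
    simp only [Pi.one_apply]
    linarith
  · rw [Set.indicator_of_notMem (by simpa using hx)]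
    exact le_max_left _ _

theorem integral_ramp_le_real_Iic (m : Measure ℝ) [IsProbabilityMeasure m] (u : ℝ) {η : ℝ}
    (hη : 0 < η) : ∫ x, ramp u η x ∂m ≤ m.real (Set.Iic (u + η)) := by
  rw [← integral_indicator_one measurableSet_Iic]
  refine integral_mono ((ramp u η).integrable m) ((integrable_const 1).indicator measurableSet_Iic)
    fun x => ?_
  rw [ramp_apply]
  by_cases hx : x ≤ u + η
  · rw [Set.indicator_of_mem (Set.mem_Iic.2 hx)]
    exact max_le zero_le_one (min_le_left _ _)
  · rw [Set.indicator_of_notMem (by simpa using hx)]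
    refine max_le le_rfl (min_le_of_right_le ?_)
    rw [sub_nonpos, one_le_div hη]
    linarith

/-- The indicator of a half line is squeezed between ramps of width `ε / 2` on either side of `u`.
An interval has semicircle mass at most its length, so the widening costs only another `ε / 2`. -/
theorem exists_moments_close_cdf (u : ℝ) {ε : ℝ} (hε : 0 < ε) :
    ∃ (s : Finset ℕ) (δ : ℝ), 0 < δ ∧ (∀ J ∈ s, 1 ≤ J) ∧
      ∀ m : Measure ℝ, IsProbabilityMeasure m → (∀ J : ℕ, Integrable (fun x : ℝ => x ^ J) m) →
        (∀ J ∈ s, |∫ x, x ^ J ∂m - scMoment J| ≤ δ) → |cdf m u - cdf semicircle u| ≤ ε := by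
  set η := ε / 2 with hη
  have hη0 : 0 < η := by positivity
  obtain ⟨s, δ, hδ, hs, h⟩ := exists_moments_close (ramp u η) hη0
  obtain ⟨s', δ', hδ', hs', h'⟩ := exists_moments_close (ramp (u - η) η) hη0
  refine ⟨s ∪ s', min δ δ', lt_min hδ hδ', fun J hJ => ?_, fun m _ hm hclose => ?_⟩
  · rcases Finset.mem_union.1 hJ with hJ | hJ
    exacts [hs J hJ, hs' J hJ]
  · have h1 := h m inferInstance hm fun J hJ =>
      (hclose J (Finset.mem_union_left _ hJ)).trans (min_le_left _ _)
    have h2 := h' m inferInstance hm fun J hJ =>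
      (hclose J (Finset.mem_union_right _ hJ)).trans (min_le_right _ _)
    have hsplit : ∀ v, semicircle.real (Set.Iic (v + η)) ≤ semicircle.real (Set.Iic v) + η := by
      intro v
      have h3 : Set.Iic (v + η) = Set.Iic v ∪ Set.Ioc v (v + η) :=
        (Set.Iic_union_Ioc_eq_Iic (by linarith)).symm
      rw [h3]
      exact (measureReal_union_le _ _).trans (by gcongr; exact semicircle_Ioc_le v hη0.le)
    have a1 := real_Iic_le_integral_ramp m u hη0
    have a2 := integral_ramp_le_real_Iic semicircle u hη0
    have a3 := real_Iic_le_integral_ramp semicircle (u - η) hη0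
    have a4 := integral_ramp_le_real_Iic m (u - η) hη0
    have a5 := hsplit u
    have a6 := hsplit (u - η)
    rw [sub_add_cancel] at a4 a6
    rw [cdf_eq_real, cdf_eq_real]
    rw [abs_le] at h1 h2 ⊢
    constructor <;> linarith [h1.1, h1.2, h2.1, h2.2]

end Moments

end PieriGrowth

namespace PieriGrowth

/-! ### Moments of the empirical measure and the final probability bound -/

section Empirical

open MeasureTheory ProbabilityTheory Filter Topology

theorem card_cells_sdiff {n k : ℕ} (ω : (Fin n → ℝ) × (Fin k → ℝ)) :
    ((largeDiagram ω).cells \ (smallDiagram ω).cells).card = k := by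
  have := card_rskShape_sdiff (List.ofFn ω.1) (List.ofFn ω.2)
  rwa [List.length_ofFn] at this

theorem isProbabilityMeasure_empiricalMeasure {n k : ℕ} (hk : 1 ≤ k)
    (ω : (Fin n → ℝ) × (Fin k → ℝ)) : IsProbabilityMeasure (empiricalMeasure ω) := by
  refine ⟨?_⟩
  rw [empiricalMeasure, Measure.smul_apply, Measure.finsetSum_apply]
  simp only [measure_univ, Finset.sum_const, card_cells_sdiff, nsmul_eq_mul, mul_one, smul_eq_mul]
  exact ENNReal.inv_mul_cancel (by simp; omega) (by simp)

theorem integrable_empiricalMeasure {n k : ℕ} (hk : 1 ≤ k) (ω : (Fin n → ℝ) × (Fin k → ℝ))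
    (g : ℝ → ℝ) : Integrable g (empiricalMeasure ω) := by
  refine Integrable.smul_measure ?_ (by simp; omega)
  rw [integrable_finsetSum_measure]
  exact fun c _ => integrable_dirac (by simp)

theorem moment_empiricalMeasure {n k : ℕ} (ω : (Fin n → ℝ) × (Fin k → ℝ)) (J : ℕ) :
    ∫ x, x ^ J ∂(empiricalMeasure ω)
      = (contentSum (pw J) (tabShape (revTab ((List.ofFn ω.2).reverse ++ (List.ofFn ω.1).reverse)))
        - contentSum (pw J) (tabShape (revTab (List.ofFn ω.1).reverse)))
          / (√(n : ℝ) ^ J * k) := by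
  rw [empiricalMeasure, integral_smul_measure, integral_finsetSum_measure
    fun c _ => integrable_dirac (by simp)]
  simp only [integral_dirac, smul_eq_mul, div_pow]
  rw [← Finset.sum_div]
  have h := sum_rskShape_sdiff (pw J) (List.ofFn ω.1) (List.ofFn ω.2)
  rw [← h]
  simp only [pw, largeDiagram, smallDiagram]
  rw [ENNReal.toReal_inv, ENNReal.toReal_natCast]
  ring

variable {k : ℕ → ℕ}

theorem eventually_sq_le
    (hk : (fun n => (k n : ℝ)) =o[atTop] fun n : ℕ => √(n : ℝ)) : ∀ᶠ n in atTop, k n ^ 2 ≤ n := by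
  filter_upwards [hk.def one_pos] with n hn
  rw [one_mul, Real.norm_of_nonneg (by positivity), Real.norm_of_nonneg (by positivity)] at hn
  have := (Real.le_sqrt (by positivity) (by positivity)).1 hn
  exact_mod_cast this

/-- For large `n` the normalized center is within `δ / 2` of the semicircle moment, so a deviation
`δ` forces a deviation `δ / 2` from the center. The factor `k!` from the conditioning cancels the `1
/ k!` of the permutation estimate. -/
theorem exists_moment_probability_le (hk_pos : ∀ n, 1 ≤ k n)
    (hk : (fun n => (k n : ℝ)) =o[atTop] fun n : ℕ => √(n : ℝ)) {J : ℕ} (hJ : 1 ≤ J) {δ : ℝ}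
    (hδ : 0 < δ) : ∃ C : ℝ, 0 ≤ C ∧ ∀ᶠ n : ℕ in atTop,
      inputLaw n (k n) {ω | δ < |∫ x, x ^ J ∂(empiricalMeasure ω) - scMoment J|}
        ≤ ENNReal.ofReal (C * (1 / (k n : ℝ) + (k n : ℝ) / √(n : ℝ))) := by
  obtain ⟨C, hC0, hC⟩ := exists_moment_deviation_le hJ (half_pos hδ)
  refine ⟨C, hC0, ?_⟩
  have hlim := (tendsto_momCenter_div J).eventually (Metric.ball_mem_nhds _ (half_pos hδ))
  filter_upwards [hlim, eventually_sq_le hk, eventually_ge_atTop 1] with n h1 h2 h3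
  have hn0 : (0 : ℝ) < n := by exact_mod_cast h3
  have hk0 : (0 : ℝ) < k n := by exact_mod_cast hk_pos n
  have hs0 : 0 < √(n : ℝ) := Real.sqrt_pos.2 hn0
  rw [Real.dist_eq] at h1
  have hsub : {ω : (Fin n → ℝ) × (Fin (k n) → ℝ) |
      δ < |∫ x, x ^ J ∂(empiricalMeasure ω) - scMoment J|} ⊆
      {ω | δ / 2 * √(n : ℝ) ^ J * k n < |contentSum (pw J)
        (tabShape (revTab ((List.ofFn ω.2).reverse ++ (List.ofFn ω.1).reverse)))
        - contentSum (pw J) (tabShape (revTab (List.ofFn ω.1).reverse))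
        - k n * momCenter J n|} := by
    intro ω hω
    rw [Set.mem_ofPred_eq, moment_empiricalMeasure] at hω
    rw [Set.mem_ofPred_eq]
    generalize contentSum (pw J)
        (tabShape (revTab ((List.ofFn ω.2).reverse ++ (List.ofFn ω.1).reverse)))
        - contentSum (pw J) (tabShape (revTab (List.ofFn ω.1).reverse)) = ψ at hω ⊢
    have h4 := abs_sub_le (ψ / (√(n : ℝ) ^ J * k n)) (momCenter J n / √(n : ℝ) ^ J) (scMoment J)
    have h5 : δ / 2 < |ψ / (√(n : ℝ) ^ J * k n) - momCenter J n / √(n : ℝ) ^ J| := by linarith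
    have h6 : ψ / (√(n : ℝ) ^ J * k n) - momCenter J n / √(n : ℝ) ^ J
        = (ψ - k n * momCenter J n) / (√(n : ℝ) ^ J * k n) := by
      field_simp
    rw [h6, abs_div, abs_of_pos (by positivity : 0 < √(n : ℝ) ^ J * k n),
      lt_div_iff₀ (by positivity), ← mul_assoc] at h5
    exact h5
  refine (measure_mono hsub).trans ((inputLaw_shapes_le n (k n) fun lam gam =>
    δ / 2 * √(n : ℝ) ^ J * k n < |contentSum (pw J) gam - contentSum (pw J) lam
      - k n * momCenter J n|).trans (ENNReal.ofReal_le_ofReal ?_))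
  have h4 := hC (Fin (n + k n)) (Fin n ⊕ Fin (k n)) finSumFinEquiv (tailPlaces n (k n))
    (headPlaces n (k n)) finSumFinEquiv.injective (nodup_places n (k n))
  simp only [length_headPlaces, length_tailPlaces] at h4
  have h5 := h4 h3 (hk_pos n) h2
  rw [le_div_iff₀ (by positivity), mul_comm] at h5
  exact h5

theorem exists_moments_probability_le (hk_pos : ∀ n, 1 ≤ k n)
    (hk : (fun n => (k n : ℝ)) =o[atTop] fun n : ℕ => √(n : ℝ)) (s : Finset ℕ)
    (hs : ∀ J ∈ s, 1 ≤ J) {δ : ℝ} (hδ : 0 < δ) : ∃ C : ℝ, 0 ≤ C ∧ ∀ᶠ n : ℕ in atTop,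
      inputLaw n (k n) {ω | ∃ J ∈ s, δ < |∫ x, x ^ J ∂(empiricalMeasure ω) - scMoment J|}
        ≤ ENNReal.ofReal (C * (1 / (k n : ℝ) + (k n : ℝ) / √(n : ℝ))) := by
  induction s using Finset.induction_on with
  | empty => exact ⟨0, le_rfl, Eventually.of_forall fun n => by simp⟩
  | insert J s _ ih =>
    obtain ⟨C₁, h1, hC₁⟩ := ih fun J hJ => hs J (Finset.mem_insert_of_mem hJ)
    obtain ⟨C₂, h2, hC₂⟩ := exists_moment_probability_le hk_pos hk
      (hs J (Finset.mem_insert_self _ _)) hδ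
    refine ⟨C₂ + C₁, by positivity, ?_⟩
    filter_upwards [hC₁, hC₂] with n g1 g2
    rw [add_mul, ENNReal.ofReal_add (by positivity) (by positivity)]
    refine le_trans (measure_mono ?_) ((measure_union_le _ _).trans (add_le_add g2 g1))
    rintro ω ⟨I, hI, h⟩
    rcases Finset.mem_insert.1 hI with rfl | hI
    · exact Or.inl h
    · exact Or.inr ⟨I, hI, h⟩

/-- An event that is excluded by the closeness of finitely many moments has a small probability. -/
theorem exists_probability_le (hk_pos : ∀ n, 1 ≤ k n)
    (hk : (fun n => (k n : ℝ)) =o[atTop] fun n : ℕ => √(n : ℝ)) {Φ : Measure ℝ → ℝ} {ε : ℝ}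
    (h : ∃ (s : Finset ℕ) (δ : ℝ), 0 < δ ∧ (∀ J ∈ s, 1 ≤ J) ∧
      ∀ m : Measure ℝ, IsProbabilityMeasure m → (∀ J : ℕ, Integrable (fun x : ℝ => x ^ J) m) →
        (∀ J ∈ s, |∫ x, x ^ J ∂m - scMoment J| ≤ δ) → Φ m ≤ ε) :
    ∃ C : ℝ, 0 ≤ C ∧ ∀ᶠ n : ℕ in atTop,
      inputLaw n (k n) {ω | ε < Φ (empiricalMeasure ω)}
        ≤ ENNReal.ofReal (C * (1 / (k n : ℝ) + (k n : ℝ) / √(n : ℝ))) := by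
  obtain ⟨s, δ, hδ, hs, hm⟩ := h
  obtain ⟨C, hC0, hC⟩ := exists_moments_probability_le hk_pos hk s hs hδ
  refine ⟨C, hC0, ?_⟩
  filter_upwards [hC] with n hn
  refine (measure_mono fun ω hω => ?_).trans hn
  by_contra hcon
  rw [Set.mem_ofPred_eq] at hcon
  push Not at hcon
  exact (hm _ (isProbabilityMeasure_empiricalMeasure (hk_pos n) ω)
    (fun J => integrable_empiricalMeasure (hk_pos n) ω _) hcon).not_gt hω

end Empirical

end PieriGrowth

open MeasureTheory ProbabilityTheory Filter Asymptotics PieriGrowth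
theorem mainTheorem8 (k : ℕ → ℕ) (hk_pos : ∀ n, 1 ≤ k n)
    (hk : (fun n => (k n : ℝ)) =o[atTop] fun n : ℕ => √(n : ℝ)) :
    (Tendsto k atTop atTop →
      TendstoWeaklyInProbability (fun n => inputLaw n (k n)) (fun _ ω => empiricalMeasure ω)
        semicircle) ∧
    ∀ ε : ℝ, 0 < ε → ∀ u : ℝ,
      (fun n => (inputLaw n (k n)).real
          {ω | ε < |cdf (empiricalMeasure ω) u - cdf semicircle u|})
        =O[atTop] fun n : ℕ => 1 / (k n : ℝ) + (k n : ℝ) / √(n : ℝ) := by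
  refine ⟨fun hk_top f ε hε => ?_, fun ε hε u => ?_⟩
  · obtain ⟨C, -, hC⟩ := exists_probability_le hk_pos hk
      (Φ := fun m => |∫ x, f x ∂m - ∫ x, f x ∂semicircle|) (exists_moments_close f hε)
    have h1 : Tendsto (fun n => 1 / (k n : ℝ)) atTop (nhds 0) :=
      tendsto_one_div_atTop_nhds_zero_nat.comp hk_top
    have h2 : Tendsto (fun n => C * (1 / (k n : ℝ) + (k n : ℝ) / √(n : ℝ))) atTop (nhds 0) := by
      simpa using (h1.add hk.tendsto_div_nhds_zero).const_mul C
    have h3 := ENNReal.tendsto_ofReal h2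
    rw [ENNReal.ofReal_zero] at h3
    exact tendsto_of_tendsto_of_tendsto_of_le_of_le' tendsto_const_nhds h3
      (Eventually.of_forall fun _ => zero_le) hC
  · obtain ⟨C, hC0, hC⟩ := exists_probability_le hk_pos hk
      (Φ := fun m => |cdf m u - cdf semicircle u|) (exists_moments_close_cdf u hε)
    refine IsBigO.of_bound C ?_
    filter_upwards [hC] with n hn
    rw [Real.norm_of_nonneg measureReal_nonneg, Real.norm_of_nonneg (by positivity)]
    exact ENNReal.toReal_le_of_le_ofReal (by positivity) hn
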